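/- Let $m\ge 2$, let $\mathbb S^m\subset\mathbb R^{m+1}$ be the unit sphere, $b\in\mathbb S^m$, and let $\mathbb B^m\subset\mathbb R^m$ be the open unit ball. Elements of $\pi_m(\mathbb S^m,b)$ are viewed as homotopy classes, relative to $\partial\mathbb B^m$, of continuous maps $\overline{\mathbb B^m}\to\mathbb S^m$ that are equal to $b$ on $\partial\mathbb B^m$. A map $f\in W^{1,m}(\mathbb B^m,\mathbb S^m)$ with trace $b$ on $\partial\mathbb B^m$ is said to belong to $\sigma\in\pi_m(\mathbb S^m,b)$, written $f\in\sigma$, if it can be joined, by a path that is continuous in the $W^{1,m}$ norm and consists of maps in $W^{1,m}(\mathbb B^m,\mathbb S^m)$ with trace $b$, to a continuous map whose class is $\sigma$. The topological energy of $\sigma$ is \[ \mathfrak E^{1,m}_{\mathrm{top}}(\sigma):=\inf\Bigl\{\int_{\mathbb B^m}|\mathrm Df|^m : f\in W^{1,m}(\mathbb B^m,\mathbb S^m),\ f\in\sigma\Bigr\}, \] where $|\mathrm Df|$ is the Euclidean (Frobenius) norm of the weak derivative. Let $\deg\sigma\in\mathbb Z$ be the Brouwer degree of $\sigma$: the number of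 preimages, counted with the sign of the Jacobian determinant, of any regular value $y\ne b$ of any smooth representative of $\sigma$ (extended smoothly by $b$ outside $\mathbb B^m$); this integer is well defined. Then, for every $\sigma\in\pi_m(\mathbb S^m,b)$, \[ \mathfrak E^{1,m}_{\mathrm{top}}(\sigma)=m^{m/2}\,|\mathbb S^m|\,|\deg\sigma| , \] where $|\mathbb S^m|$ is the $m$-dimensional surface area of $\mathbb S^m$. -/

import Mathlib

open MeasureTheory Metric Filter Topology
open scoped ENNReal ContDiff Topology.Homotopy

noncomputable section

namespace TopEnergy

/-- Euclidean space of dimension `n`. -/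
abbrev E (n : ℕ) : Type := EuclideanSpace ℝ (Fin n)

/-- The unit sphere `S^m` in `ℝ^(m+1)`. -/
abbrev S (m : ℕ) : Type := Metric.sphere (0 : E (m + 1)) 1

/-- The open unit ball `B^m` in `ℝ^m`. -/
abbrev B (m : ℕ) : Set (E m) := Metric.ball (0 : E m) 1

/-- The space of Jacobian matrices of maps `ℝ^m → ℝ^(m+1)`, given as the family of the `m` partial
derivatives, with the Euclidean (Frobenius) norm `|A|² = ∑ i, |A i|²`. -/
abbrev Jac (m : ℕ) : Type := PiLp 2 (fun _ : Fin m => E (m + 1))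

/-- Lebesgue measure on the unit ball. -/
abbrev volB (m : ℕ) : Measure (E m) := volume.restrict (B m)

/-- The `i`-th partial derivative. -/
def pderiv {m : ℕ} {F : Type*} [NormedAddCommGroup F] [NormedSpace ℝ F]
    (φ : E m → F) (i : Fin m) (x : E m) : F :=
  fderiv ℝ φ x (EuclideanSpace.single i 1)

/-! ### Sobolev maps on the ball -/

/-- `G` is the weak (distributional) gradient of `f` in the open ball `B^m`. -/
def HasWeakGradient {m : ℕ} (f : E m → E (m + 1)) (G : E m → Jac m) : Prop :=
  ∀ φ : E m → ℝ, ContDiff ℝ ∞ φ → HasCompactSupport φ → tsupport φ ⊆ B m →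
    ∀ i : Fin m, ∫ x in B m, pderiv φ i x • f x = - ∫ x in B m, φ x • G x i

/-- The map `f`, with weak gradient `G`, has constant trace `b` on the unit sphere `∂B^m`. This is
Green's formula `∫_B (∂ᵢφ f + φ ∂ᵢf) = ∫_∂B φ (tr f) νᵢ` with `tr f = b`, where
`∫_∂B φ b νᵢ = ∫_B ∂ᵢφ b`, tested with all `φ ∈ C_c^∞(ℝ^m)` (not only those supported in `B^m`). -/
def HasConstantTrace {m : ℕ} (f : E m → E (m + 1)) (G : E m → Jac m) (b : E (m + 1)) : Prop :=
  ∀ φ : E m → ℝ, ContDiff ℝ ∞ φ → HasCompactSupport φ →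
    ∀ i : Fin m, ∫ x in B m, (pderiv φ i x • f x + φ x • G x i) = ∫ x in B m, pderiv φ i x • b

/-- `f ∈ W^{1,m}(B^m, S^m)`, with weak gradient `G` and with trace `b` on `∂B^m`. -/
structure IsSobolevMap {m : ℕ} (b : S m) (f : E m → E (m + 1)) (G : E m → Jac m) : Prop where
  memLp : MemLp f m (volB m)
  memLp_grad : MemLp G m (volB m)
  mem_sphere : ∀ᵐ x ∂(volB m), f x ∈ Metric.sphere (0 : E (m + 1)) 1
  weakGradient : HasWeakGradient f G
  trace : HasConstantTrace f G b

/-- `f` and `g` are homotopic in `W^{1,m}(B^m, S^m)` with fixed trace `b`: they are joined by a path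
`[0,1] → W^{1,m}(B^m, S^m)` of maps with trace `b`, continuous for the `W^{1,m}` norm. -/
def SobolevHomotopic {m : ℕ} (b : S m) (f g : E m → E (m + 1)) : Prop :=
  ∃ (H : ℝ → E m → E (m + 1)) (G : ℝ → E m → Jac m),
    (∀ t ∈ Set.Icc (0 : ℝ) 1, IsSobolevMap b (H t) (G t)) ∧
    (∀ s ∈ Set.Icc (0 : ℝ) 1,
      Tendsto (fun t => eLpNorm (fun x => H t x - H s x) m (volB m))
          (𝓝[Set.Icc 0 1] s) (𝓝 0) ∧
      Tendsto (fun t => eLpNorm (fun x => G t x - G s x) m (volB m))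
          (𝓝[Set.Icc 0 1] s) (𝓝 0)) ∧
    H 0 = f ∧ H 1 = g

/-! ### Homotopy classes -/

/-- The affine map from the cube `[0,1]^m` onto the cube `[-1,1]^m`, which contains the closed unit
ball. -/
def cubeMap {m : ℕ} (t : Fin m → unitInterval) : E m :=
  WithLp.toLp 2 (fun i => 2 * (t i : ℝ) - 1)

open Classical in
/-- The map that equals `g` in the open unit ball and `b` outside. -/
def extendBy {m : ℕ} (b : S m) (g : E m → E (m + 1)) (x : E m) : E (m + 1) :=
  if x ∈ B m then g x else b

/-- `g` is a continuous map from the closed ball to `S^m`, equal to `b` on the boundary, whose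
homotopy class relative to the boundary is `σ ∈ π_m(S^m, b)`. (Only the values of `g` in the open
ball matter.) As Mathlib's homotopy groups are made of maps on the cube `[0,1]^m` that equal `b` on
its boundary, `g` is extended by `b` to the cube `[-1,1]^m ⊇ B^m`; that the result is a map into
`S^m`, continuous up to the boundary, is part of the requirement. -/
def ContinuousRep {m : ℕ} {b : S m} (σ : π_ m (S m) b) (g : E m → E (m + 1)) : Prop :=
  ∃ γ : Ω^ (Fin m) (S m) b, (Quotient.mk _ γ : π_ m (S m) b) = σ ∧
    ∀ t : Fin m → unitInterval, (γ t : E (m + 1)) = extendBy b g (cubeMap t)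

/-- A Sobolev map `f` belongs to `σ ∈ π_m(S^m, b)`: it is homotopic in `W^{1,m}(B^m, S^m)`, with
trace `b`, to a (continuous and Sobolev) map whose homotopy class is `σ`. -/
def MemClass {m : ℕ} {b : S m} (f : E m → E (m + 1)) (σ : π_ m (S m) b) : Prop :=
  ∃ g : E m → E (m + 1), ContinuousRep σ g ∧ SobolevHomotopic b f g

/-- The topological energy of `σ ∈ π_m(S^m, b)`: the infimum of `∫_{B^m} |Df|^m` over all maps
`f ∈ W^{1,m}(B^m, S^m)` that belong to `σ`. (The weak gradient `G = Df` is unique almost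
everywhere.) -/
def topEnergy {m : ℕ} {b : S m} (σ : π_ m (S m) b) : ℝ≥0∞ :=
  ⨅ (f : E m → E (m + 1)) (G : E m → Jac m) (_ : IsSobolevMap b f G) (_ : MemClass f σ),
    ∫⁻ x in B m, ‖G x‖ₑ ^ m

/-! ### The Brouwer degree -/

/-- The oriented Jacobian `det (g, ∂₁g, …, ∂ₘg)` at `x` of a map `g` with values in `S^m`, where
`S^m` is oriented as the boundary of the unit ball (outward normal first). -/
def orientedJacobian {m : ℕ} (g : E m → E (m + 1)) (x : E m) : ℝ :=
  Matrix.det (Matrix.of fun r c : Fin (m + 1) =>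
    (Fin.cons (α := fun _ => E (m + 1)) (g x) (fun i : Fin m => pderiv g i x) r) c)

/-- `y` is a regular value of the map `g : ℝ^m → S^m`. -/
def IsRegularValue {m : ℕ} (g : E m → E (m + 1)) (y : E (m + 1)) : Prop :=
  ∀ x : E m, g x = y → orientedJacobian g x ≠ 0

/-- The number of preimages of `y`, counted with the sign of the oriented Jacobian. -/
def signedCount {m : ℕ} (g : E m → E (m + 1)) (y : E (m + 1)) : ℤ :=
  ∑ᶠ x ∈ {x : E m | g x = y}, ((SignType.sign (orientedJacobian g x) : SignType) : ℤ)

/-- `d` is the Brouwer degree of `σ ∈ π_m(S^m, b)`: for every smooth representative `g` of `σ`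
(equal to `b` outside the unit ball) and every regular value `y ≠ b` of `g`, the preimages of `y`,
counted with sign, add up to `d`. -/
def IsBrouwerDegree {m : ℕ} {b : S m} (σ : π_ m (S m) b) (d : ℤ) : Prop :=
  ∀ g : E m → E (m + 1), ContDiff ℝ ∞ g → (∀ x ∉ B m, g x = b) → ContinuousRep σ g →
    ∀ y : S m, y ≠ b → IsRegularValue g y → signedCount g y = d

/-- The Brouwer degree of `σ ∈ π_m(S^m, b)`: the integer `d` such that `IsBrouwerDegree σ d`. -/
def brouwerDegree {m : ℕ} {b : S m} (σ : π_ m (S m) b) : ℤ :=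
  Classical.epsilon (IsBrouwerDegree σ)

/-- The surface area `|S^m|` of the unit sphere. -/
def sphereArea (m : ℕ) : ℝ≥0∞ :=
  (volume : Measure (E (m + 1))).toSphere Set.univ

end TopEnergy

end

/-! Lower bound. For a unit vector `p` and vectors `A₁, …, Aₘ`, Hadamard's inequality and the
inequality of means give `m^(m/2) |det (p, A)| ≤ |A|^m` (`abs_jacDet_le_norm_pow`), so the energy of
`f` is at least `m^(m/2)` times the absolute value of `∫ det (f, Df)`. It remains to see that this
integral is `|S^m| deg σ` for every `f ∈ σ`.

For smooth maps, the integral is a homotopy invariant because its time derivative is a divergence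
(`degInt_homotopy`). To evaluate it, weight the Jacobian by a function `k (⟨y, f⟩)`. The weighted
integral does not depend on the unit vector `y` (`integral_inner_mul_jacDet_const`). With `k`
concentrated near a regular value `y` it counts preimages with sign, and its average over `y` is a
multiple of the unweighted integral (`degInt_eq_signedCount`).

For Sobolev maps, the exponent `m` is critical: mollifications at small scales stay away from the
origin (`IsWeakMap.exists_half_le_norm_mol`), and the degree integrals of their radial projections
converge to that of `f` (`IsWeakMap.tendsto_degInt`). Hence the integral lies in the lattice `|S^m|
ℤ`. Being continuous for the `W^{1,m}` norm (`tendsto_jacInt`), it is constant along Sobolev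
homotopies (`SobolevHomotopic.exists_jacInt_eq`). For a continuous Sobolev map the mollifications
are uniformly close to the map, so they lie in its homotopy class (`IsSobolevMap.jacInt_eq_degInt`).

Upper bound. A bubble is the inverse stereographic projection, cut off far away. Stereographic
projection is conformal, so it gives equality in the pointwise inequality, and the cut-off costs an
energy that tends to zero (`eventually_lintegral_jac_bubble_le`). The `m`-energy is invariant under
scaling, so `n` small disjoint copies of a bubble have `n` times its energy and represent the `n`-th
power of its class (`exists_power`).

That such powers exhaust the homotopy group (`mem_zpowers_bubble`) is proved directly. A smooth
representative has a regular value, which a Möbius homotopy moves to `-b`. Near each of its finitely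
many preimages the map looks linear, so it is homotopic to a superposition of bubbles precomposed
with invertible linear maps. These linear maps factor into transvections and diagonal matrices, and
so only replace a class by one of its powers. A reflected bubble provides the negative powers at the
same energy, and comparing degree integrals shows that at most `|deg σ|` copies are used. -/

noncomputable section

namespace TopEnergy

/-! ### The determinant form -/

/-- The determinant of `m + 1` vectors of `ℝ^(m+1)`, as a continuous alternating form. -/
def detForm (m : ℕ) : E (m + 1) [⋀^Fin (m + 1)]→L[ℝ] ℝ :=
  { Matrix.detRowAlternating.compLinearMap
      (EuclideanSpace.equiv (Fin (m + 1)) ℝ).toLinearEquiv.toLinearMap with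
    cont := by
      change Continuous fun v : Fin (m + 1) → E (m + 1) =>
        Matrix.det (Matrix.of fun r c => v r c)
      fun_prop }

theorem detForm_apply {m : ℕ} (v : Fin (m + 1) → E (m + 1)) :
    detForm m v = Matrix.det (Matrix.of fun r c => v r c) := rfl

/-- The determinant `det (p, A₁, …, Aₘ)`. -/
def jacDet {m : ℕ} (p : E (m + 1)) (A : Fin m → E (m + 1)) : ℝ :=
  detForm m (Fin.cons (α := fun _ => E (m + 1)) p A)

/-- The family of all partial derivatives. -/
def grad {m : ℕ} {F : Type*} [NormedAddCommGroup F] [NormedSpace ℝ F]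
    (u : E m → F) (x : E m) (i : Fin m) : F := pderiv u i x

theorem orientedJacobian_eq {m : ℕ} (g : E m → E (m + 1)) (x : E m) :
    orientedJacobian g x = jacDet (g x) (grad g x) := rfl

theorem continuous_cons {m : ℕ} :
    Continuous fun q : E (m + 1) × (Fin m → E (m + 1)) =>
      (Fin.cons (α := fun _ => E (m + 1)) q.1 q.2 : Fin (m + 1) → E (m + 1)) := by
  refine continuous_pi fun j => ?_
  refine Fin.cases ?_ (fun i => ?_) j
  · simpa using continuous_fst
  · simp only [Fin.cons_succ]; fun_prop

theorem continuous_jacDet {m : ℕ} :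
    Continuous fun q : E (m + 1) × (Fin m → E (m + 1)) => jacDet q.1 q.2 :=
  (detForm m).cont.comp continuous_cons

/-- Hadamard's inequality, inherited from the volume form of an orientation. There the vectors are
the columns of the matrix, here the rows, hence the transpose. -/
theorem abs_detForm_le {m : ℕ} (v : Fin (m + 1) → E (m + 1)) :
    |detForm m v| ≤ ∏ i, ‖v i‖ := by
  have : Fact (Module.finrank ℝ (E (m + 1)) = m + 1) := ⟨by simp⟩
  let e := EuclideanSpace.basisFun (Fin (m + 1)) ℝ
  have h := e.toBasis.orientation.abs_volumeForm_apply_le v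
  rw [Orientation.volumeForm_robust _ e rfl, Module.Basis.det_apply] at h
  have h2 : e.toBasis.toMatrix v = (Matrix.of fun r c => v r c).transpose := by
    ext i j
    simp [Module.Basis.toMatrix_apply, e]
  rwa [h2, Matrix.det_transpose] at h

theorem abs_jacDet_le {m : ℕ} (p : E (m + 1)) (A : Fin m → E (m + 1)) :
    |jacDet p A| ≤ ‖p‖ * ∏ i, ‖A i‖ := by
  have h := abs_detForm_le (Fin.cons (α := fun _ => E (m + 1)) p A)
  rw [Fin.prod_univ_succ] at h
  exact h

/-- The inequality of means for the numbers `‖A i‖ ^ 2` with equal weights `1 / m`, raised to the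
power `m / 2`. -/
theorem prod_norm_le_norm_pow {m : ℕ} (hm : 0 < m) (A : Jac m) :
    (m : ℝ) ^ ((m : ℝ) / 2) * ∏ i, ‖A i‖ ≤ ‖A‖ ^ m := by
  have hm' : (0 : ℝ) < m := by exact_mod_cast hm
  have h := Real.geom_mean_le_arith_mean_weighted Finset.univ (fun _ : Fin m => (m : ℝ)⁻¹)
    (fun i => ‖A i‖ ^ 2) (fun _ _ => by positivity) (by simp [hm'.ne'])
    (fun _ _ => by positivity)
  rw [← Finset.mul_sum, ← PiLp.norm_sq_eq_of_L2] at h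
  have hP : 0 ≤ ∏ i, ‖A i‖ := Finset.prod_nonneg fun _ _ => norm_nonneg _
  rw [Real.finsetProd_rpow _ _ fun _ _ => by positivity, Finset.prod_pow] at h
  have h2 := Real.rpow_le_rpow (by positivity) h (by positivity : (0 : ℝ) ≤ (m : ℝ) / 2)
  rw [← Real.rpow_mul (by positivity), Real.mul_rpow (by positivity) (by positivity),
    Real.inv_rpow hm'.le, show (m : ℝ)⁻¹ * ((m : ℝ) / 2) = 1 / 2 by field_simp,
    ← Real.sqrt_eq_rpow, Real.sqrt_sq hP, ← Real.rpow_natCast (‖A‖) 2, ← Real.rpow_mul (norm_nonneg _),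
    show ((2 : ℕ) : ℝ) * ((m : ℝ) / 2) = m by push_cast; ring, Real.rpow_natCast] at h2
  have h3 : (0 : ℝ) < (m : ℝ) ^ ((m : ℝ) / 2) := by positivity
  calc _ ≤ (m : ℝ) ^ ((m : ℝ) / 2) * (((m : ℝ) ^ ((m : ℝ) / 2))⁻¹ * ‖A‖ ^ m) := by gcongr
    _ = ‖A‖ ^ m := by field_simp

/-- Hadamard's inequality followed by the inequality of means. This is the source of the constant in
the theorem; orthogonal vectors `A i` of equal length, orthogonal to a unit vector `p`, give
equality. -/
theorem abs_jacDet_le_norm_pow {m : ℕ} (hm : 0 < m) {p : E (m + 1)} (hp : ‖p‖ ≤ 1) (A : Jac m) :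
    (m : ℝ) ^ ((m : ℝ) / 2) * |jacDet p A| ≤ ‖A‖ ^ m := by
  refine le_trans ?_ (prod_norm_le_norm_pow hm A)
  gcongr
  refine (abs_jacDet_le p A).trans ?_
  have hP : 0 ≤ ∏ i, ‖A i‖ := Finset.prod_nonneg fun _ _ => norm_nonneg _
  nlinarith

/-- Cramer's rule. -/
theorem sum_detForm_update {m : ℕ} (w : Fin (m + 1) → E (m + 1)) (v : E (m + 1)) :
    ∑ i, detForm m (Function.update w i v) • w i = detForm m w • v := by
  let M : Matrix (Fin (m + 1)) (Fin (m + 1)) ℝ := Matrix.of fun r c => w r c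
  have h := Matrix.mulVec_cramer M.transpose v
  ext j
  have h1 := congrFun h j
  rw [Matrix.det_transpose] at h1
  simp only [Matrix.mulVec, dotProduct, Matrix.transpose_apply, Matrix.cramer_transpose_apply,
    Pi.smul_apply] at h1
  simp only [WithLp.ofLp_sum, Finset.sum_apply, PiLp.smul_apply]
  rw [detForm_apply w]
  refine Eq.trans (Finset.sum_congr rfl fun i _ => ?_) h1
  rw [smul_eq_mul, mul_comm, detForm_apply]
  refine congrArg (fun z => w i j * z) (congrArg Matrix.det (Matrix.ext fun r c => ?_))
  by_cases hr : r = i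
  · subst hr; simp
  · simp [hr, M]

theorem sum_inner_mul_detForm_update {m : ℕ} (w : Fin (m + 1) → E (m + 1)) (y v : E (m + 1)) :
    ∑ i, inner ℝ y (w i) * detForm m (Function.update w i v) = inner ℝ y v * detForm m w := by
  have h := congrArg (fun z => inner ℝ y z) (sum_detForm_update w v)
  simp only [inner_sum, inner_smul_right] at h
  rw [mul_comm (inner ℝ y v), ← h]
  exact Finset.sum_congr rfl fun i _ => mul_comm _ _

/-- Cramer's identity with `y` and `v` both equal to `u` reduces to `0 = |u|² det w`. In this way
tangency to the sphere makes determinants vanish. -/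
theorem detForm_eq_zero_of_orthogonal {m : ℕ} {w : Fin (m + 1) → E (m + 1)} {u : E (m + 1)}
    (hu : u ≠ 0) (h : ∀ i, inner ℝ u (w i) = 0) : detForm m w = 0 := by
  have h1 := sum_inner_mul_detForm_update w u u
  simp only [h, zero_mul, Finset.sum_const_zero] at h1
  exact (mul_eq_zero.1 h1.symm).resolve_left (by simpa using hu)

theorem jacDet_eq_zero_of_orthogonal {m : ℕ} {p u : E (m + 1)} {A : Fin m → E (m + 1)}
    (hu : u ≠ 0) (hp : inner ℝ u p = 0) (h : ∀ i, inner ℝ u (A i) = 0) : jacDet p A = 0 :=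
  detForm_eq_zero_of_orthogonal hu fun j => Fin.cases hp h j

theorem detForm_update_cons_zero {m : ℕ} (p q : E (m + 1)) (A : Fin m → E (m + 1)) :
    detForm m (Function.update (Fin.cons (α := fun _ => E (m + 1)) p A) 0 q) = jacDet q A := by
  rw [Fin.update_cons_zero]; rfl

theorem detForm_update_cons_succ {m : ℕ} (p q : E (m + 1)) (A : Fin m → E (m + 1)) (i : Fin m) :
    detForm m (Function.update (Fin.cons (α := fun _ => E (m + 1)) p A) i.succ q)
      = jacDet p (Function.update A i q) := by
  rw [← Fin.cons_update]; rfl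

/-- Cramer's rule for `jacDet`. -/
theorem sum_inner_mul_jacDet_update {m : ℕ} (p : E (m + 1)) (A : Fin m → E (m + 1))
    (y v : E (m + 1)) :
    ∑ i, inner ℝ y (A i) * jacDet p (Function.update A i v)
      = inner ℝ y v * jacDet p A - inner ℝ y p * jacDet v A := by
  have h := sum_inner_mul_detForm_update (Fin.cons (α := fun _ => E (m + 1)) p A) y v
  rw [Fin.sum_univ_succ] at h
  simp only [Fin.cons_zero, Fin.cons_succ, detForm_update_cons_zero,
    detForm_update_cons_succ] at h
  change _ = inner ℝ y v * jacDet p A at h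
  linarith

theorem jacDet_update_swap {m : ℕ} (q : E (m + 1)) (A : Fin m → E (m + 1)) (i : Fin m) :
    jacDet (A i) (Function.update A i q) = - jacDet q A := by
  have h := (detForm m).map_swap (Fin.cons (α := fun _ => E (m + 1)) q A)
    (Fin.succ_ne_zero i).symm
  have h2 : (Fin.cons (α := fun _ => E (m + 1)) q A : Fin (m + 1) → E (m + 1)) ∘
      Equiv.swap 0 i.succ = Fin.cons (α := fun _ => E (m + 1)) (A i) (Function.update A i q) := by
    ext1 j
    refine Fin.cases ?_ (fun k => ?_) j
    · simp
    · by_cases hk : k = i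
      · subst hk; simp
      · simp [hk, Equiv.swap_apply_of_ne_of_ne]
  rw [h2] at h
  exact h

theorem jacDet_update_update_swap {m : ℕ} (p : E (m + 1)) (A : Fin m → E (m + 1)) {i j : Fin m}
    (hij : i ≠ j) (v w : E (m + 1)) :
    jacDet p (Function.update (Function.update A i v) j w)
      = - jacDet p (Function.update (Function.update A i w) j v) := by
  have h := (detForm m).map_swap (Fin.cons (α := fun _ => E (m + 1)) p
    (Function.update (Function.update A i w) j v)) (i := i.succ) (j := j.succ)
    (by simpa using hij)
  refine Eq.trans (congrArg (detForm m) ?_) h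
  ext1 k
  refine Fin.cases ?_ (fun l => ?_) k
  · simp [Equiv.swap_apply_of_ne_of_ne, (Fin.succ_ne_zero _).symm]
  · by_cases h1 : l = i
    · subst h1; simp [hij]
    · by_cases h2 : l = j
      · subst h2; simp [hij]
      · simp [h1, h2, Equiv.swap_apply_of_ne_of_ne]

theorem jacDet_smul_left {m : ℕ} (c : ℝ) (p : E (m + 1)) (A : Fin m → E (m + 1)) :
    jacDet (c • p) A = c * jacDet p A := by
  have h := (detForm m).map_update_smul (Fin.cons (α := fun _ => E (m + 1)) p A) 0 c p
  rw [detForm_update_cons_zero, detForm_update_cons_zero] at h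
  exact h

theorem jacDet_update_smul {m : ℕ} (p : E (m + 1)) (A : Fin m → E (m + 1)) (i : Fin m) (c : ℝ)
    (v : E (m + 1)) :
    jacDet p (Function.update A i (c • v)) = c * jacDet p (Function.update A i v) := by
  have h := (detForm m).map_update_smul (Fin.cons (α := fun _ => E (m + 1)) p A) i.succ c v
  simpa only [detForm_update_cons_succ, smul_eq_mul] using h

theorem jacDet_update_add {m : ℕ} (p : E (m + 1)) (A : Fin m → E (m + 1)) (i : Fin m)
    (v w : E (m + 1)) :
    jacDet p (Function.update A i (v + w))
      = jacDet p (Function.update A i v) + jacDet p (Function.update A i w) := by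
  have h := (detForm m).map_update_add (Fin.cons (α := fun _ => E (m + 1)) p A) i.succ v w
  simpa only [detForm_update_cons_succ] using h

theorem jacDet_eq_zero_of_eq_zero {m : ℕ} (p : E (m + 1)) {A : Fin m → E (m + 1)} {i : Fin m}
    (h : A i = 0) : jacDet p A = 0 :=
  (detForm m).map_coord_zero (i := i.succ) (by simpa using h)

/-- The derivative of `jacDet`. -/
theorem hasFDerivAt_jacDet {m : ℕ} {H : Type*} [NormedAddCommGroup H] [NormedSpace ℝ H]
    {p : H → E (m + 1)} {A : H → Fin m → E (m + 1)} {p' : H →L[ℝ] E (m + 1)}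
    {A' : Fin m → H →L[ℝ] E (m + 1)} {x : H} (hp : HasFDerivAt p p' x)
    (hA : ∀ i, HasFDerivAt (fun z => A z i) (A' i) x) :
    ∃ L : H →L[ℝ] ℝ, HasFDerivAt (fun z => jacDet (p z) (A z)) L x ∧
      ∀ v, L v = jacDet (p' v) (A x)
        + ∑ i, jacDet (p x) (Function.update (A x) i (A' i v)) := by
  have h1 : HasFDerivAt (fun z => (Fin.cons (α := fun _ => E (m + 1)) (p z) (A z) :
      Fin (m + 1) → E (m + 1))) (ContinuousLinearMap.pi
        (Fin.cons (α := fun _ => H →L[ℝ] E (m + 1)) p' A')) x := by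
    rw [hasFDerivAt_pi]
    intro j
    refine Fin.cases ?_ (fun i => ?_) j
    · simpa using hp
    · simpa using hA i
  refine ⟨_, ((detForm m).hasFDerivAt _).comp x h1, fun v => ?_⟩
  rw [ContinuousLinearMap.comp_apply, ContinuousMultilinearMap.linearDeriv_apply,
    Fin.sum_univ_succ]
  change detForm m _ + ∑ i, detForm m _ = _
  simp only [detForm_update_cons_succ, detForm_update_cons_zero, ContinuousLinearMap.pi_apply,
    Fin.cons_zero, Fin.cons_succ]

/-! ### Integration by parts -/

theorem contDiff_cons {m : ℕ} {H : Type*} [NormedAddCommGroup H] [NormedSpace ℝ H] {n : ℕ∞ω}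
    {p : H → E (m + 1)} {A : H → Fin m → E (m + 1)} (hp : ContDiff ℝ n p)
    (hA : ∀ i, ContDiff ℝ n fun z => A z i) :
    ContDiff ℝ n fun z => (Fin.cons (α := fun _ => E (m + 1)) (p z) (A z) :
      Fin (m + 1) → E (m + 1)) := by
  rw [contDiff_pi]
  intro j
  refine Fin.cases ?_ (fun i => ?_) j
  · simpa using hp
  · simpa using hA i

theorem contDiff_jacDet {m : ℕ} {H : Type*} [NormedAddCommGroup H] [NormedSpace ℝ H] {n : ℕ∞ω}
    {p : H → E (m + 1)} {A : H → Fin m → E (m + 1)} (hp : ContDiff ℝ n p)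
    (hA : ∀ i, ContDiff ℝ n fun z => A z i) :
    ContDiff ℝ n fun z => jacDet (p z) (A z) :=
  (detForm m).toContinuousMultilinearMap.contDiff.comp (contDiff_cons hp hA)

theorem contDiff_pderiv {m : ℕ} {F : Type*} [NormedAddCommGroup F] [NormedSpace ℝ F]
    {u : E m → F} (hu : ContDiff ℝ ∞ u) (i : Fin m) : ContDiff ℝ ∞ (pderiv u i) :=
  (hu.fderiv_right (m := ∞) (by norm_num)).clm_apply contDiff_const

theorem hasCompactSupport_of_forall_norm {H F : Type*} [NormedAddCommGroup H]
    [ProperSpace H] [Zero F] {f : H → F} {R : ℝ} (h : ∀ x, R ≤ ‖x‖ → f x = 0) :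
    HasCompactSupport f := by
  refine HasCompactSupport.intro (isCompact_closedBall (0 : H) R) fun x hx => h x ?_
  simp only [mem_closedBall, dist_zero_right, not_le] at hx
  exact hx.le

theorem integral_pderiv_eq_zero {m : ℕ} {V : E m → ℝ} (hV : ContDiff ℝ 1 V)
    (hc : HasCompactSupport V) (i : Fin m) : ∫ x, pderiv V i x = 0 := by
  have hd : Integrable (fun x => pderiv V i x) volume := by
    refine Continuous.integrable_of_hasCompactSupport
      ((hV.continuous_fderiv one_ne_zero).clm_apply continuous_const) ?_
    exact (hc.fderiv (𝕜 := ℝ)).comp_left (g := fun L : E m →L[ℝ] ℝ => L (EuclideanSpace.single i 1))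
      rfl
  have h := integral_mul_fderiv_eq_neg_fderiv_mul_of_integrable (μ := (volume : Measure (E m)))
    (f := fun _ => (1 : ℝ)) (g := V) (v := EuclideanSpace.single i 1)
    (by simp) (by simp only [one_mul]; exact hd)
    (by simpa using hV.continuous.integrable_of_hasCompactSupport hc)
    (fun _ _ => differentiableAt_const _) (fun _ _ => (hV.differentiable one_ne_zero) _)
  simp only [one_mul] at h
  exact h.trans (by simp)

theorem contDiff_grad {m : ℕ} {F : Type*} [NormedAddCommGroup F] [NormedSpace ℝ F]
    {u : E m → F} (hu : ContDiff ℝ ∞ u) (i : Fin m) : ContDiff ℝ ∞ fun x => grad u x i :=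
  contDiff_pderiv hu i

theorem two_le_minSmoothness_infty : minSmoothness ℝ 2 ≤ (∞ : ℕ∞ω) := by
  rw [minSmoothness_of_isRCLikeNormedField]
  exact WithTop.coe_le_coe.2 (le_top (a := (2 : ℕ∞)))

theorem pderiv_comm {m : ℕ} {u : E m → E (m + 1)} (hu : ContDiff ℝ ∞ u) (i k : Fin m) (x : E m) :
    fderiv ℝ (pderiv u k) x (EuclideanSpace.single i 1)
      = fderiv ℝ (pderiv u i) x (EuclideanSpace.single k 1) := by
  have h1 : ∀ j : Fin m, ∀ v, fderiv ℝ (pderiv u j) x v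
      = fderiv ℝ (fderiv ℝ u) x v (EuclideanSpace.single j 1) := by
    intro j v
    have hd : DifferentiableAt ℝ (fderiv ℝ u) x :=
      ((hu.fderiv_right (m := ∞) (by norm_num)).differentiable (by simp)) x
    change fderiv ℝ (fun z => fderiv ℝ u z (EuclideanSpace.single j 1)) x v = _
    rw [fderiv_clm_apply hd (differentiableAt_const _)]
    simp
  rw [h1, h1]
  exact (hu.contDiffAt.isSymmSndFDerivAt two_le_minSmoothness_infty).eq _ _

/-- The summand is antisymmetric in `i` and `k`: the determinant alternates while second derivatives
commute. This is the classical fact that cofactors of a gradient are divergence free. -/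
theorem sum_jacDet_update_pderiv_pderiv {m : ℕ} {u : E m → E (m + 1)} (hu : ContDiff ℝ ∞ u)
    (x : E m) (v : E (m + 1)) :
    ∑ i, ∑ k, (if k = i then 0 else jacDet (u x) (Function.update (Function.update (grad u x) i v) k
      (fderiv ℝ (pderiv u k) x (EuclideanSpace.single i 1)))) = 0 := by
  set T : Fin m → Fin m → ℝ := fun i k => if k = i then 0 else
    jacDet (u x) (Function.update (Function.update (grad u x) i v) k
      (fderiv ℝ (pderiv u k) x (EuclideanSpace.single i 1))) with hT
  have hanti : ∀ i k, T i k = - T k i := by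
    intro i k
    by_cases h : k = i
    · simp [hT, h]
    · simp only [hT, if_neg h, if_neg (Ne.symm h)]
      rw [jacDet_update_update_swap _ _ (Ne.symm h), Function.update_comm (Ne.symm h),
        pderiv_comm hu i k x]
  have h1 : ∑ i, ∑ k, T i k = - ∑ i, ∑ k, T i k := by
    conv_lhs => rw [Finset.sum_comm]
    rw [← Finset.sum_neg_distrib]
    refine Finset.sum_congr rfl fun i _ => ?_
    rw [← Finset.sum_neg_distrib]
    exact Finset.sum_congr rfl fun k _ => hanti _ _
  linarith

theorem integrable_of_contDiff_of_grad {m : ℕ} {V : E m → ℝ} (hV : Continuous V)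
    {u : E m → E (m + 1)} (hc : HasCompactSupport (fderiv ℝ u))
    (h : ∀ x, fderiv ℝ u x = 0 → V x = 0) : HasCompactSupport V ∧ Integrable V volume := by
  have : HasCompactSupport V := by
    refine hc.mono fun x hx hx' => hx (h x ?_)
    simpa using hx'
  exact ⟨this, hV.integrable_of_hasCompactSupport this⟩

theorem grad_eq_zero {m : ℕ} {F : Type*} [NormedAddCommGroup F] [NormedSpace ℝ F] {u : E m → F}
    {x : E m} (h : fderiv ℝ u x = 0) (i : Fin m) : grad u x i = 0 := by
  simp [grad, pderiv, h]

/-- Integration by parts for the minors of a gradient. -/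
theorem integral_sum_jacDet_update {m : ℕ} (hm : 2 ≤ m) {u ξ : E m → E (m + 1)}
    (hu : ContDiff ℝ ∞ u) (hξ : ContDiff ℝ ∞ ξ) (hc : HasCompactSupport (fderiv ℝ u)) :
    ∫ x, ∑ i, jacDet (u x) (Function.update (grad u x) i (pderiv ξ i x))
      = m * ∫ x, jacDet (ξ x) (grad u x) := by
  -- A slot other than `i` still carries a derivative of `u`. Hence `V i` vanishes wherever `fderiv
  -- ℝ u` does and has compact support, although `u` and `ξ` need not have it.
  have hmm : ∀ i : Fin m, ∃ j : Fin m, j ≠ i := by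
    intro i
    have : Nontrivial (Fin m) := Fin.nontrivial_iff_two_le.2 hm
    exact exists_ne i
  set V : Fin m → E m → ℝ := fun i x => jacDet (u x) (Function.update (grad u x) i (ξ x)) with hVdef
  have hA : ∀ i k, ContDiff ℝ ∞ fun z => Function.update (grad u z) i (ξ z) k := by
    intro i k
    by_cases h : k = i
    · subst h; simpa using hξ
    · simpa [h] using contDiff_grad hu k
  have hV : ∀ i, ContDiff ℝ ∞ (V i) := fun i => contDiff_jacDet hu (hA i)
  have hVc : ∀ i, HasCompactSupport (V i) := by
    intro i
    refine (integrable_of_contDiff_of_grad (hV i).continuous hc fun x hx => ?_).1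
    obtain ⟨j, hj⟩ := hmm i
    exact jacDet_eq_zero_of_eq_zero _ (i := j) (by simp [hj, grad_eq_zero hx])
  -- Differentiating the first slot gives `-det (ξ, Du)` after a transposition, once for each `i`;
  -- this produces the factor `m`. The terms with second derivatives cancel in the sum over `i`.
  have hder : ∀ i x, pderiv (V i) i x = - jacDet (ξ x) (grad u x)
      + (jacDet (u x) (Function.update (grad u x) i (pderiv ξ i x))
      + ∑ k, (if k = i then 0 else
        jacDet (u x) (Function.update (Function.update (grad u x) i (ξ x)) k
        (fderiv ℝ (pderiv u k) x (EuclideanSpace.single i 1))))) := by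
    intro i x
    obtain ⟨L, hL, hLv⟩ := hasFDerivAt_jacDet (p := u) (A := fun z => Function.update (grad u z) i (ξ z))
      (x := x) ((hu.differentiable (by simp)) x).hasFDerivAt
      (fun k => ((hA i k).differentiable (by simp) x).hasFDerivAt)
    have h1 : pderiv (V i) i x = L (EuclideanSpace.single i 1) := by
      rw [pderiv, hL.fderiv]
    rw [h1, hLv]
    congr 1
    · exact jacDet_update_swap (ξ x) (grad u x) i
    · rw [← Finset.add_sum_erase _ _ (Finset.mem_univ i),
        ← Finset.add_sum_erase (a := i) (f := fun k => ite _ _ _) _ (Finset.mem_univ i)]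
      simp only [if_true, zero_add]
      congr 1
      · simp [Function.update_idem, pderiv]
      · refine Finset.sum_congr rfl fun k hk => ?_
        have hk' : k ≠ i := Finset.ne_of_mem_erase hk
        simp only [if_neg hk', Function.update_of_ne hk']
        rfl
  have hsum : ∀ x, ∑ i, pderiv (V i) i x = - (m * jacDet (ξ x) (grad u x))
      + ∑ i, jacDet (u x) (Function.update (grad u x) i (pderiv ξ i x)) := by
    intro x
    simp only [hder, Finset.sum_add_distrib]
    rw [sum_jacDet_update_pderiv_pderiv hu]
    simp
  have hint1 : Integrable (fun x => (m : ℝ) * jacDet (ξ x) (grad u x)) volume := by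
    refine (integrable_of_contDiff_of_grad (u := u) ?_ hc fun x hx => ?_).2
    · exact continuous_const.mul (contDiff_jacDet hξ (fun i => contDiff_pderiv hu i)).continuous
    · rw [jacDet_eq_zero_of_eq_zero _ (i := ⟨0, by omega⟩) (grad_eq_zero hx _), mul_zero]
  have hint2 : Integrable (fun x => ∑ i, jacDet (u x)
      (Function.update (grad u x) i (pderiv ξ i x))) volume := by
    refine integrable_finsetSum _ fun i _ =>
      (integrable_of_contDiff_of_grad (u := u) ?_ hc fun x hx => ?_).2
    · refine (contDiff_jacDet (n := ∞) hu fun k => ?_).continuous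
      by_cases h : k = i
      · subst h; simpa using contDiff_pderiv hξ k
      · simpa [h] using contDiff_grad hu k
    · obtain ⟨j, hj⟩ := hmm i
      exact jacDet_eq_zero_of_eq_zero _ (i := j) (by simp [hj, grad_eq_zero hx])
  have h0 : ∫ x, ∑ i, pderiv (V i) i x = 0 := by
    rw [integral_finsetSum]
    · exact Finset.sum_eq_zero fun i _ =>
        integral_pderiv_eq_zero ((hV i).of_le (by simp)) (hVc i) i
    · intro i _
      refine (contDiff_pderiv (hV i) i).continuous.integrable_of_hasCompactSupport ?_
      exact ((hVc i).fderiv (𝕜 := ℝ)).comp_left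
        (g := fun L : E m →L[ℝ] ℝ => L (EuclideanSpace.single i 1)) rfl
  simp only [hsum] at h0
  rw [integral_add (f := fun x => -(↑m * jacDet (ξ x) (grad u x))) hint1.neg hint2, integral_neg, integral_const_mul] at h0
  linarith

/-! ### Homotopy invariance of the degree integral -/

/-- Smooth maps `ℝ^m → S^m` that are equal to `b` outside a ball. -/
structure IsSmoothMap {m : ℕ} (b : E (m + 1)) (f : E m → E (m + 1)) : Prop where
  contDiff : ContDiff ℝ ∞ f
  norm_eq_one : ∀ x, ‖f x‖ = 1
  eq_base : ∃ R, ∀ x, R ≤ ‖x‖ → f x = b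

/-- The integral of the oriented Jacobian. -/
def degInt {m : ℕ} (f : E m → E (m + 1)) : ℝ := ∫ x, jacDet (f x) (grad f x)

theorem fderiv_eq_zero_of_norm_gt {H F : Type*} [NormedAddCommGroup H] [NormedSpace ℝ H]
    [NormedAddCommGroup F] [NormedSpace ℝ F] {f : H → F} {R : ℝ} {b : F}
    (h : ∀ x, R ≤ ‖x‖ → f x = b) {x : H} (hx : R < ‖x‖) : fderiv ℝ f x = 0 := by
  have : f =ᶠ[𝓝 x] fun _ => b := by
    filter_upwards [(isOpen_lt continuous_const continuous_norm).mem_nhds hx] with y hy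
    exact h y (le_of_lt hy)
  rw [this.fderiv_eq]
  simp

theorem IsSmoothMap.hasCompactSupport_fderiv {m : ℕ} {b : E (m + 1)} {f : E m → E (m + 1)}
    (h : IsSmoothMap b f) : HasCompactSupport (fderiv ℝ f) := by
  obtain ⟨R, hR⟩ := h.eq_base
  exact hasCompactSupport_of_forall_norm (R := R + 1) fun x hx =>
    fderiv_eq_zero_of_norm_gt hR (by linarith)

theorem inner_fderiv_eq_zero {H F : Type*} [NormedAddCommGroup H] [NormedSpace ℝ H]
    [NormedAddCommGroup F] [InnerProductSpace ℝ F] {f : H → F} {x : H}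
    (hf : DifferentiableAt ℝ f x) (h : ∀ x, ‖f x‖ = 1) (v : H) :
    inner ℝ (f x) (fderiv ℝ f x v) = 0 := by
  have h1 := (hf.hasFDerivAt.inner ℝ hf.hasFDerivAt).fderiv
  have h2 : (fun z => inner ℝ (f z) (f z)) = fun _ => (1 : ℝ) := by
    ext z; simp [h z]
  have h3 := congrArg (fun L : H →L[ℝ] ℝ => L v) h1
  rw [h2] at h3
  simp only [fderiv_fun_const, Pi.zero_apply, zero_apply,
    ContinuousLinearMap.comp_apply, ContinuousLinearMap.prod_apply, fderivInnerCLM_apply,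
    real_inner_comm (f x) (fderiv ℝ f x v)] at h3
  linarith

theorem hasDerivAt_integral_of_contDiff {H : Type*} [NormedAddCommGroup H] [NormedSpace ℝ H]
    [FiniteDimensional ℝ H] [MeasurableSpace H] [BorelSpace H] {μ : Measure H}
    [IsFiniteMeasureOnCompacts μ] {W : ℝ × H → ℝ} (hW : ContDiff ℝ 1 W) {R : ℝ}
    (hR : ∀ t x, R ≤ ‖x‖ → W (t, x) = 0) (t : ℝ) :
    HasDerivAt (fun t => ∫ x, W (t, x) ∂μ) (∫ x, fderiv ℝ W (t, x) (1, 0) ∂μ) t := by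
  have : ProperSpace H := FiniteDimensional.proper ℝ H
  have hd : ∀ s x, HasDerivAt (fun s => W (s, x)) (fderiv ℝ W (s, x) (1, 0)) s := by
    intro s x
    have h1 := (hW.differentiable one_ne_zero (s, x)).hasFDerivAt
    exact h1.comp_hasDerivAt s ((hasDerivAt_id s).prodMk (hasDerivAt_const s x))
  have hcont : Continuous fun p : ℝ × H => fderiv ℝ W p (1, 0) :=
    (hW.continuous_fderiv one_ne_zero).clm_apply continuous_const
  obtain ⟨C, hC⟩ := (((isCompact_closedBall t 1).prod (isCompact_closedBall (0 : H) R)).image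
    hcont.norm).bddAbove
  have hslice : ∀ s, Continuous fun x => W (s, x) := fun s =>
    hW.continuous.comp (Continuous.prodMk_right s)
  refine (hasDerivAt_integral_of_dominated_loc_of_deriv_le (F := fun t x => W (t, x))
    (F' := fun t x => fderiv ℝ W (t, x) (1, 0)) (s := ball t 1)
    (bound := (closedBall (0 : H) R).indicator fun _ => C) (ball_mem_nhds t one_pos)
    ?_ ?_ ?_ ?_ ?_ ?_).2
  · exact Eventually.of_forall fun s => (hslice s).aestronglyMeasurable
  · exact (hslice t).integrable_of_hasCompactSupport
      (hasCompactSupport_of_forall_norm fun x hx => hR t x hx)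
  · exact (hcont.comp (Continuous.prodMk_right t)).aestronglyMeasurable
  · refine Eventually.of_forall fun x s hs => ?_
    by_cases hx : x ∈ closedBall (0 : H) R
    · rw [Set.indicator_of_mem hx]
      exact hC ⟨(s, x), ⟨ball_subset_closedBall hs, hx⟩, rfl⟩
    · rw [Set.indicator_of_notMem hx]
      have hx' : R < ‖x‖ := by simpa using hx
      have h0 : (fun s => W (s, x)) = fun _ => 0 := funext fun s => hR s x hx'.le
      have := (hd s x)
      rw [h0] at this
      rw [this.unique (hasDerivAt_const s 0), norm_zero]
  · exact (integrable_indicator_iff measurableSet_closedBall).2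
      (integrableOn_const (isCompact_closedBall (0 : H) R).measure_lt_top.ne)
  · exact Eventually.of_forall fun x s _ => hd s x

/-- With `ξ = ∂ₜu`, the time derivative of the integrand is `det (ξ, Du)` plus the sum of the
determinants with `∂ᵢξ` in slot `i`. The first term is zero, as `ξ` and all `∂ᵢu` are orthogonal to
`u`; by parts, the remaining sum integrates to `m` times the integral of the first. -/
theorem degInt_homotopy {m : ℕ} (hm : 2 ≤ m) {b : E (m + 1)} {u : ℝ × E m → E (m + 1)}
    (hu : ContDiff ℝ ∞ u) (hn : ∀ p, ‖u p‖ = 1) {R : ℝ} (hR : ∀ t x, R ≤ ‖x‖ → u (t, x) = b)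
    (s t : ℝ) : degInt (fun x => u (s, x)) = degInt (fun x => u (t, x)) := by
  have hinr : ∀ t x, HasFDerivAt (fun x : E m => ((t, x) : ℝ × E m))
      (ContinuousLinearMap.inr ℝ ℝ (E m)) x := fun t x => hasFDerivAt_prodMk_right t x
  have hslice : ∀ t, ContDiff ℝ ∞ fun x => u (t, x) := fun t => hu.comp (contDiff_prodMk_right t)
  have hg : ∀ t x i, grad (fun x => u (t, x)) x i = fderiv ℝ u (t, x) (0, EuclideanSpace.single i 1) := by
    intro t x i
    have h1 := ((hu.differentiable (by simp) (t, x)).hasFDerivAt).comp x (hinr t x)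
    change fderiv ℝ (fun x => u (t, x)) x _ = _
    rw [show (fun x => u (t, x)) = u ∘ fun x => (t, x) from rfl, h1.fderiv]
    simp
  set A : ℝ × E m → Fin m → E (m + 1) := fun p i =>
    fderiv ℝ u p (0, EuclideanSpace.single i 1) with hAdef
  have hA : ∀ i, ContDiff ℝ ∞ fun p => A p i := fun i =>
    (hu.fderiv_right (m := ∞) (by norm_num)).clm_apply contDiff_const
  set W : ℝ × E m → ℝ := fun p => jacDet (u p) (A p) with hWdef
  have hW : ContDiff ℝ ∞ W := contDiff_jacDet hu hA
  have hW0 : ∀ t x, R + 1 ≤ ‖x‖ → W (t, x) = 0 := by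
    intro t x hx
    refine jacDet_eq_zero_of_eq_zero _ (i := ⟨0, by omega⟩) ?_
    change fderiv ℝ u (t, x) _ = 0
    rw [← hg t x]
    exact grad_eq_zero (fderiv_eq_zero_of_norm_gt (hR t) (by linarith)) _
  have hderiv : ∀ t, HasDerivAt (fun t => degInt fun x => u (t, x)) 0 t := by
    intro t
    have h1 := hasDerivAt_integral_of_contDiff (μ := (volume : Measure (E m)))
      (hW.of_le (by simp)) hW0 t
    have h2 : (fun t => ∫ x, W (t, x)) = fun t => degInt fun x => u (t, x) := by
      ext t
      refine integral_congr_ae (Eventually.of_forall fun x => ?_)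
      simp only [hWdef]
      congr 1
      ext1 i
      exact (hg t x i).symm
    rw [h2] at h1
    convert h1 using 1
    set ξ : E m → E (m + 1) := fun x => fderiv ℝ u (t, x) (1, 0) with hξdef
    have hξ : ContDiff ℝ ∞ ξ := ((hu.fderiv_right (m := ∞) (by norm_num)).clm_apply
      contDiff_const).comp (contDiff_prodMk_right t)
    have hzero : ∀ x, jacDet (ξ x) (grad (fun x => u (t, x)) x) = 0 := by
      intro x
      have hd := hu.differentiable (by simp) (t, x)
      refine jacDet_eq_zero_of_orthogonal (u := u (t, x)) ?_ ?_ fun i => ?_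
      · intro h0
        have := hn (t, x)
        simp [h0] at this
      · exact inner_fderiv_eq_zero hd hn _
      · rw [hg]
        exact inner_fderiv_eq_zero hd hn _
    have hsupp : HasCompactSupport (fderiv ℝ fun x => u (t, x)) :=
      hasCompactSupport_of_forall_norm (R := R + 1) fun x hx =>
        fderiv_eq_zero_of_norm_gt (hR t) (by linarith)
    have hP := integral_sum_jacDet_update hm (hslice t) hξ hsupp
    simp only [hzero, integral_zero, mul_zero] at hP
    rw [← hP]
    refine integral_congr_ae (Eventually.of_forall fun x => ?_)
    obtain ⟨L, hL, hLv⟩ := hasFDerivAt_jacDet (p := u) (A := A) (x := (t, x))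
      (hu.differentiable (by simp) (t, x)).hasFDerivAt
      (fun k => ((hA k).differentiable (by simp) (t, x)).hasFDerivAt)
    have hgA : A (t, x) = grad (fun x => u (t, x)) x := by
      ext1 i; exact (hg t x i).symm
    simp only
    rw [hL.fderiv, hLv, hgA, hzero x, zero_add]
    refine Finset.sum_congr rfl fun i _ => ?_
    congr 2
    have hdd : DifferentiableAt ℝ (fderiv ℝ u) (t, x) :=
      (hu.fderiv_right (m := ∞) (by norm_num)).differentiable (by simp) _
    have e1 : fderiv ℝ (fun p => A p i) (t, x) (1, 0)
        = fderiv ℝ (fderiv ℝ u) (t, x) (1, 0) (0, EuclideanSpace.single i 1) := by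
      simp only [hAdef]
      rw [fderiv_clm_apply hdd (differentiableAt_const _)]
      simp
    have e2 : pderiv ξ i x
        = fderiv ℝ (fderiv ℝ u) (t, x) (0, EuclideanSpace.single i 1) (1, 0) := by
      have h3 : HasFDerivAt (fun p => fderiv ℝ u p (1, 0))
          (fderiv ℝ (fun p => fderiv ℝ u p (1, 0)) (t, x)) (t, x) :=
        (hdd.clm_apply (differentiableAt_const _)).hasFDerivAt
      have h4 := h3.comp x (hinr t x)
      rw [pderiv, show ξ = (fun p => fderiv ℝ u p (1, 0)) ∘ fun x => (t, x) from rfl, h4.fderiv,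
        fderiv_clm_apply hdd (differentiableAt_const _)]
      simp
    rw [e1, e2]
    exact ((hu.contDiffAt.isSymmSndFDerivAt two_le_minSmoothness_infty).eq _ _).symm
  exact is_const_of_deriv_eq_zero (fun t => (hderiv t).differentiableAt)
    (fun t => (hderiv t).deriv) s t

/-! ### Radial projection and straight-line homotopies. -/

/-- The radial projection onto the unit sphere. -/
def normalize {F : Type*} [NormedAddCommGroup F] [NormedSpace ℝ F] (v : F) : F := ‖v‖⁻¹ • v

theorem norm_normalize {F : Type*} [NormedAddCommGroup F] [NormedSpace ℝ F] {v : F} (h : v ≠ 0) :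
    ‖normalize v‖ = 1 := by
  rw [normalize, norm_smul, norm_inv, norm_norm, inv_mul_cancel₀ (norm_ne_zero_iff.2 h)]

theorem normalize_of_norm {F : Type*} [NormedAddCommGroup F] [NormedSpace ℝ F] {v : F}
    (h : ‖v‖ = 1) : normalize v = v := by
  simp [normalize, h]

theorem contDiff_normalize {H F : Type*} [NormedAddCommGroup H] [NormedSpace ℝ H]
    [NormedAddCommGroup F] [InnerProductSpace ℝ F] {u : H → F} {n : ℕ∞ω} (hu : ContDiff ℝ n u)
    (h : ∀ x, u x ≠ 0) : ContDiff ℝ n fun x => normalize (u x) :=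
  ((hu.norm ℝ h).inv fun x => norm_ne_zero_iff.2 (h x)).smul hu

/-- Comparing norms, the segment between two unit vectors can meet the origin only at its midpoint,
and then the vectors are antipodal. -/
theorem segment_ne_zero {F : Type*} [NormedAddCommGroup F] [NormedSpace ℝ F] {p q : F}
    (hp : ‖p‖ = 1) (hq : ‖q‖ = 1) (h : p ≠ -q) {s : ℝ} (hs : s ∈ Set.Icc (0 : ℝ) 1) :
    (1 - s) • p + s • q ≠ 0 := by
  intro h0
  have h1 : (1 - s) • p = -(s • q) := eq_neg_of_add_eq_zero_left h0
  have h2 := congrArg norm h1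
  rw [norm_neg, norm_smul, norm_smul, hp, hq, Real.norm_of_nonneg (by linarith [hs.2]),
    Real.norm_of_nonneg hs.1] at h2
  have h3 : s = 1 / 2 := by linarith
  subst h3
  apply h
  rw [show (1 : ℝ) - 1 / 2 = 1 / 2 by norm_num, ← smul_neg] at h1
  exact smul_right_injective F (by norm_num : (1 / 2 : ℝ) ≠ 0) h1

theorem degInt_eq_of_ne_neg {m : ℕ} (hm : 2 ≤ m) {b : E (m + 1)} {f g : E m → E (m + 1)}
    (hf : IsSmoothMap b f) (hg : IsSmoothMap b g) (h : ∀ x, f x ≠ - g x) :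
    degInt f = degInt g := by
  obtain ⟨R, hR⟩ := hf.eq_base
  obtain ⟨R', hR'⟩ := hg.eq_base
  -- The smooth transition function keeps the interpolation parameter in `[0, 1]` while making the
  -- homotopy smooth for all real times, as `degInt_homotopy` requires.
  set v : ℝ × E m → E (m + 1) := fun p =>
    (1 - Real.smoothTransition p.1) • f p.2 + Real.smoothTransition p.1 • g p.2 with hv
  have hθ : ContDiff ℝ ∞ fun p : ℝ × E m => Real.smoothTransition p.1 :=
    Real.smoothTransition.contDiff.comp contDiff_fst
  have hv0 : ∀ p, v p ≠ 0 := fun p => segment_ne_zero (hf.norm_eq_one _) (hg.norm_eq_one _) (h _)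
    ⟨Real.smoothTransition.nonneg _, Real.smoothTransition.le_one _⟩
  have hvs : ContDiff ℝ ∞ v := ((contDiff_const.sub hθ).smul (hf.contDiff.comp contDiff_snd)).add
    (hθ.smul (hg.contDiff.comp contDiff_snd))
  have hb : ‖b‖ = 1 := by
    have : Nontrivial (E m) := Module.nontrivial_of_finrank_pos (R := ℝ) (by simp; omega)
    obtain ⟨x, hx⟩ := NormedSpace.exists_lt_norm ℝ (E m) R
    rw [← hR x hx.le]; exact hf.norm_eq_one x
  have key := degInt_homotopy hm (b := b) (contDiff_normalize hvs hv0)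
    (fun p => norm_normalize (hv0 p)) (R := max R R') (fun t x hx => by
      simp only [hv]
      rw [hR x (le_trans (le_max_left _ _) hx), hR' x (le_trans (le_max_right _ _) hx), ← add_smul]
      simp [normalize_of_norm hb]) 0 1
  simpa [hv, normalize_of_norm (hf.norm_eq_one _), normalize_of_norm (hg.norm_eq_one _)] using key

/-! ### Spherical means of the degree integral -/

theorem exists_isometry_orthogonal {m : ℕ} {b : E (m + 1)} (hb : ‖b‖ = 1) :
    ∃ ι : E m →ₗᵢ[ℝ] E (m + 1), ∀ x, inner ℝ b (ι x) = 0 := by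
  have hb0 : b ≠ 0 := by rintro rfl; simp at hb
  have : Fact (Module.finrank ℝ (E (m + 1)) = m + 1) := ⟨by simp⟩
  have hf : Module.finrank ℝ (ℝ ∙ b)ᗮ = m := Submodule.finrank_orthogonal_span_singleton hb0
  let e : E m ≃ₗᵢ[ℝ] (ℝ ∙ b)ᗮ :=
    ((stdOrthonormalBasis ℝ (ℝ ∙ b)ᗮ).reindex (finCongr hf)).repr.symm
  refine ⟨(ℝ ∙ b)ᗮ.subtypeₗᵢ.comp e.toLinearIsometry, fun x => ?_⟩
  exact Submodule.mem_orthogonal_singleton_iff_inner_right.1 (e x).2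

theorem jacDet_sub_left {m : ℕ} (p q : E (m + 1)) (A : Fin m → E (m + 1)) :
    jacDet (p - q) A = jacDet p A - jacDet q A := by
  have := (detForm m).map_update_sub (Fin.cons (α := fun _ => E (m + 1)) 0 A) 0 p q
  simpa only [detForm_update_cons_zero] using this

/-- The integral is the derivative, in the direction `v`, of the weighted degree integral as a
function of `y`. Integrate by parts with the field `ξ = k (⟨y, u⟩) A u`, where `A` is the skew map
generating the rotation in the plane of `y` and `v`. As `A u` is tangent, `det (ξ, Du) = 0`, and
Cramer's rule evaluates what is left: the terms with `k'` give the integrand up to sign and those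
with `k` combine to a multiple of `det (A u, Du) = 0`. -/
theorem integral_deriv_inner_mul_jacDet {m : ℕ} (hm : 2 ≤ m) {b : E (m + 1)}
    {u : E m → E (m + 1)} (hu : IsSmoothMap b u) {k : ℝ → ℝ} (hk : ContDiff ℝ ∞ k)
    {y v : E (m + 1)} (hyv : inner ℝ y v = 0) (hy : ‖y‖ = 1) :
    ∫ x, deriv k (inner ℝ y (u x)) * inner ℝ v (u x) * jacDet (u x) (grad u x) = 0 := by
  set A : E (m + 1) →L[ℝ] E (m + 1) :=
    (innerSL ℝ y).smulRight v - (innerSL ℝ v).smulRight y with hA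
  have hAp : ∀ p, A p = inner ℝ y p • v - inner ℝ v p • y := fun p => by simp [hA]
  have hAs : ∀ p, inner ℝ p (A p) = 0 := fun p => by
    rw [hAp, inner_sub_right, inner_smul_right, inner_smul_right, real_inner_comm p v,
      real_inner_comm p y]
    ring
  have hus := hu.contDiff
  set ξ : E m → E (m + 1) := fun x => k (inner ℝ y (u x)) • A (u x) with hξdef
  have hin : ContDiff ℝ ∞ fun x => inner ℝ y (u x) := contDiff_const.inner ℝ hus
  have hξ : ContDiff ℝ ∞ ξ := (hk.comp hin).smul (A.contDiff.comp hus)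
  have hP := integral_sum_jacDet_update hm hus hξ hu.hasCompactSupport_fderiv
  have hu0 : ∀ x, u x ≠ 0 := fun x h0 => by
    have := hu.norm_eq_one x
    simp [h0] at this
  have hperp : ∀ x i, inner ℝ (u x) (grad u x i) = 0 := fun x i =>
    inner_fderiv_eq_zero (hus.differentiable (by simp) x) hu.norm_eq_one _
  have hAz : ∀ x, jacDet (A (u x)) (grad u x) = 0 := fun x =>
    jacDet_eq_zero_of_orthogonal (hu0 x) (hAs _) (hperp x)
  have hz : ∀ x, jacDet (ξ x) (grad u x) = 0 := fun x => by
    simp only [hξdef]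
    rw [jacDet_smul_left, hAz, mul_zero]
  simp only [hz, integral_zero, mul_zero] at hP
  have hpd : ∀ x i, pderiv ξ i x = (deriv k (inner ℝ y (u x)) * inner ℝ y (grad u x i)) • A (u x)
      + k (inner ℝ y (u x)) • A (grad u x i) := by
    intro x i
    have hd := (hus.differentiable (by simp) x).hasFDerivAt
    have h1 : HasFDerivAt (fun x => inner ℝ y (u x)) ((innerSL ℝ y).comp (fderiv ℝ u x)) x :=
      (innerSL ℝ y).hasFDerivAt.comp x hd
    have h2 : HasFDerivAt (fun x => k (inner ℝ y (u x)))
        (deriv k (inner ℝ y (u x)) • ((innerSL ℝ y).comp (fderiv ℝ u x))) x :=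
      (hk.differentiable (by simp) _).hasDerivAt.comp_hasFDerivAt x h1
    have h3 := h2.smul (A.hasFDerivAt.comp x hd)
    rw [pderiv, show ξ = (fun x => k (inner ℝ y (u x))) • (A ∘ u) from rfl, h3.fderiv]
    exact add_comm _ _
  have hfin : ∀ x, ∑ i, jacDet (u x) (Function.update (grad u x) i (pderiv ξ i x))
      = - (deriv k (inner ℝ y (u x)) * inner ℝ v (u x) * jacDet (u x) (grad u x)) := by
    intro x
    have c1 := sum_inner_mul_jacDet_update (u x) (grad u x) y (A (u x))
    have c2 := sum_inner_mul_jacDet_update (u x) (grad u x) y v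
    have c3 := sum_inner_mul_jacDet_update (u x) (grad u x) v y
    have c4 : inner ℝ y (A (u x)) = - inner ℝ v (u x) := by
      rw [hAp, inner_sub_right, inner_smul_right, inner_smul_right, hyv,
        real_inner_self_eq_norm_sq, hy]
      ring
    have c5 : inner ℝ y (u x) * jacDet v (grad u x) - inner ℝ v (u x) * jacDet y (grad u x) = 0 := by
      rw [← hAz x, hAp, jacDet_sub_left, jacDet_smul_left, jacDet_smul_left]
    rw [hAz, mul_zero, sub_zero, c4] at c1
    rw [hyv] at c2
    rw [real_inner_comm, hyv] at c3
    have c6 : ∀ i, jacDet (u x) (Function.update (grad u x) i (pderiv ξ i x))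
        = deriv k (inner ℝ y (u x)) *
            (inner ℝ y (grad u x i) * jacDet (u x) (Function.update (grad u x) i (A (u x))))
          + k (inner ℝ y (u x)) *
            (inner ℝ y (grad u x i) * jacDet (u x) (Function.update (grad u x) i v)
            - inner ℝ v (grad u x i) * jacDet (u x) (Function.update (grad u x) i y)) := by
      intro i
      rw [hpd, jacDet_update_add, jacDet_update_smul, jacDet_update_smul, hAp (grad u x i),
        sub_eq_add_neg, ← neg_smul, jacDet_update_add, jacDet_update_smul, jacDet_update_smul]
      ring
    rw [Finset.sum_congr rfl fun i _ => c6 i, Finset.sum_add_distrib, ← Finset.mul_sum,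
      ← Finset.mul_sum, Finset.sum_sub_distrib, c1, c2, c3]
    linear_combination (-k (inner ℝ y (u x))) * c5
  simp only [hfin, integral_neg, neg_eq_zero] at hP
  exact hP

/-- Move `y` to `z` along the normalised segment. Its velocity is orthogonal to its position, so
`integral_deriv_inner_mul_jacDet` makes the time derivative vanish. -/
theorem integral_inner_mul_jacDet_const_of_ne {m : ℕ} (hm : 2 ≤ m) {b : E (m + 1)}
    {u : E m → E (m + 1)} (hu : IsSmoothMap b u) {k : ℝ → ℝ} (hk : ContDiff ℝ ∞ k)
    {y z : E (m + 1)} (hy : ‖y‖ = 1) (hz : ‖z‖ = 1) (hyz : y ≠ -z) :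
    ∫ x, k (inner ℝ y (u x)) * jacDet (u x) (grad u x)
      = ∫ x, k (inner ℝ z (u x)) * jacDet (u x) (grad u x) := by
  set w : ℝ → E (m + 1) := fun t =>
    (1 - Real.smoothTransition t) • y + Real.smoothTransition t • z with hw
  have hw0 : ∀ t, w t ≠ 0 := fun t => segment_ne_zero hy hz hyz
    ⟨Real.smoothTransition.nonneg _, Real.smoothTransition.le_one _⟩
  have hws : ContDiff ℝ ∞ w := ((contDiff_const.sub Real.smoothTransition.contDiff).smul
    contDiff_const).add (Real.smoothTransition.contDiff.smul contDiff_const)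
  set c : ℝ → E (m + 1) := fun t => normalize (w t) with hc
  have hcs : ContDiff ℝ ∞ c := contDiff_normalize hws hw0
  have hcn : ∀ t, ‖c t‖ = 1 := fun t => norm_normalize (hw0 t)
  have hus := hu.contDiff
  have hJ : ContDiff ℝ ∞ fun x => jacDet (u x) (grad u x) :=
    contDiff_jacDet hus fun i => contDiff_grad hus i
  obtain ⟨R, hR⟩ := hu.eq_base
  have hJ0 : ∀ x, R + 1 ≤ ‖x‖ → jacDet (u x) (grad u x) = 0 := fun x hx =>
    jacDet_eq_zero_of_eq_zero _ (i := ⟨0, by omega⟩)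
      (grad_eq_zero (fderiv_eq_zero_of_norm_gt hR (by linarith)) _)
  set W : ℝ × E m → ℝ := fun p => k (inner ℝ (c p.1) (u p.2)) * jacDet (u p.2) (grad u p.2)
  have hin : ContDiff ℝ ∞ fun p : ℝ × E m => inner ℝ (c p.1) (u p.2) :=
    (hcs.comp contDiff_fst).inner ℝ (hus.comp contDiff_snd)
  have hW : ContDiff ℝ ∞ W := (hk.comp hin).mul (hJ.comp contDiff_snd)
  have hd : ∀ t, HasDerivAt (fun t => ∫ x, W (t, x)) 0 t := by
    intro t
    have h1 := hasDerivAt_integral_of_contDiff (μ := (volume : Measure (E m))) (R := R + 1)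
      (hW.of_le (by simp)) (fun t x hx => by simp [W, hJ0 x hx]) t
    convert h1 using 1
    have h0 : inner ℝ (c t) (deriv c t) = 0 := by
      simpa using inner_fderiv_eq_zero (hcs.differentiable (by simp) t) hcn 1
    rw [← integral_deriv_inner_mul_jacDet hm hu hk h0 (hcn t)]
    refine integral_congr_ae (Eventually.of_forall fun x => ?_)
    have h2 : HasDerivAt (fun s => W (s, x)) (fderiv ℝ W (t, x) (1, 0)) t :=
      (hW.differentiable (by simp) (t, x)).hasFDerivAt.comp_hasDerivAt (f := fun s => (s, x)) t
        ((hasDerivAt_id t).prodMk (hasDerivAt_const t x))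
    have h3 : HasDerivAt (fun s => inner ℝ (c s) (u x)) (inner ℝ (deriv c t) (u x)) t := by
      simpa using (hcs.differentiable (by simp) t).hasDerivAt.inner ℝ (hasDerivAt_const t (u x))
    have h4 := ((hk.differentiable (by simp) _).hasDerivAt.comp t h3).mul_const
      (jacDet (u x) (grad u x))
    exact h4.unique h2
  have h5 := is_const_of_deriv_eq_zero (fun t => (hd t).differentiableAt)
    (fun t => (hd t).deriv) 0 1
  simpa [W, hc, hw, normalize_of_norm hy, normalize_of_norm hz] using h5

theorem integral_inner_mul_jacDet_const {m : ℕ} (hm : 2 ≤ m) {b : E (m + 1)}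
    {u : E m → E (m + 1)} (hu : IsSmoothMap b u) {k : ℝ → ℝ} (hk : ContDiff ℝ ∞ k)
    {y z : E (m + 1)} (hy : ‖y‖ = 1) (hz : ‖z‖ = 1) :
    ∫ x, k (inner ℝ y (u x)) * jacDet (u x) (grad u x)
      = ∫ x, k (inner ℝ z (u x)) * jacDet (u x) (grad u x) := by
  -- The segment between antipodal points passes through the origin, so this case goes through a
  -- unit vector orthogonal to both.
  by_cases hyz : y = -z
  · obtain ⟨ι, hι⟩ := exists_isometry_orthogonal hy
    set p := ι (EuclideanSpace.single ⟨0, by omega⟩ 1)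
    have hp : ‖p‖ = 1 := by simp [p]
    have hyp : inner ℝ y p = 0 := hι _
    have hyy : inner ℝ y y = (1 : ℝ) := by rw [real_inner_self_eq_norm_sq, hy]; norm_num
    rw [integral_inner_mul_jacDet_const_of_ne hm hu hk hy hp,
      integral_inner_mul_jacDet_const_of_ne hm hu hk hp hz]
    · intro h
      rw [h, ← hyz, hyy] at hyp
      exact one_ne_zero hyp
    · intro h
      rw [h, inner_neg_left, real_inner_self_eq_norm_sq, hp] at hyp
      norm_num at hyp
  · exact integral_inner_mul_jacDet_const_of_ne hm hu hk hy hz hyz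

/-- The reflection exchanging `p` and `q` preserves the ball and Lebesgue measure. Averages over the
sphere are expressed throughout as ball integrals of functions of `z / |z|`. -/
theorem integral_ball_inner_normalize {n : ℕ} {k : ℝ → ℝ} {p q : E n} (hp : ‖p‖ = 1)
    (hq : ‖q‖ = 1) :
    ∫ z in ball (0 : E n) 1, k (inner ℝ (normalize z) p)
      = ∫ z in ball (0 : E n) 1, k (inner ℝ (normalize z) q) := by
  set e := (ℝ ∙ (p - q))ᗮ.reflection
  have he : e p = q := Submodule.reflection_sub (hp.trans hq.symm)
  have h1 := e.measurePreserving.setIntegral_preimage_emb e.toHomeomorph.measurableEmbedding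
    (fun z => k (inner ℝ (normalize z) q)) (ball 0 1)
  rw [← h1]
  have h2 : e ⁻¹' ball 0 1 = ball 0 1 := by ext z; simp
  rw [h2]
  refine setIntegral_congr_fun measurableSet_ball fun z _ => ?_
  rw [← he, normalize, normalize, e.norm_map, inner_smul_left, inner_smul_left, e.inner_map_map]

/-! ### The cone over a map to the sphere -/

/-- The last `m` coordinates of a point of `ℝ^(m+1)`. -/
def tail (m : ℕ) : E (m + 1) →L[ℝ] E m :=
  (EuclideanSpace.equiv (Fin m) ℝ).symm.toContinuousLinearMap.comp
    (ContinuousLinearMap.pi fun i => EuclideanSpace.proj i.succ)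

theorem tail_apply {m : ℕ} (z : E (m + 1)) (i : Fin m) : tail m z i = z i.succ := rfl

/-- Splitting off the first coordinate. -/
def splitEquiv (m : ℕ) : E (m + 1) ≃ᵐ ℝ × E m :=
  ((MeasurableEquiv.toLp 2 (Fin (m + 1) → ℝ)).symm.trans
    (MeasurableEquiv.piFinSuccAbove (fun _ => ℝ) 0)).trans
    (MeasurableEquiv.prodCongr (MeasurableEquiv.refl ℝ) (MeasurableEquiv.toLp 2 (Fin m → ℝ)))

theorem splitEquiv_apply {m : ℕ} (z : E (m + 1)) : splitEquiv m z = (z 0, tail m z) := by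
  rfl

theorem measurePreserving_splitEquiv (m : ℕ) :
    MeasurePreserving (splitEquiv m) volume volume := by
  have h1 := EuclideanSpace.volume_preserving_symm_measurableEquiv_toLp (Fin (m + 1))
  have h2 := volume_preserving_piFinSuccAbove (fun _ : Fin (m + 1) => ℝ) 0
  have h3 := (EuclideanSpace.volume_preserving_symm_measurableEquiv_toLp (Fin m)).symm
  exact (((MeasurePreserving.id volume).prod h3).comp h2).comp h1

/-- The cone of height one over a set. -/
def coneSet {m : ℕ} (s : Set (E m)) : Set (E (m + 1)) := {z | z 0 ∈ Set.Ioo (0 : ℝ) 1 ∧ tail m z ∈ s}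

theorem coneSet_eq {m : ℕ} (s : Set (E m)) :
    coneSet s = splitEquiv m ⁻¹' (Set.Ioo (0 : ℝ) 1 ×ˢ s) := by
  ext z; simp [coneSet, splitEquiv_apply]

theorem measurableSet_coneSet {m : ℕ} {s : Set (E m)} (hs : MeasurableSet s) :
    MeasurableSet (coneSet s) := by
  rw [coneSet_eq]
  exact (splitEquiv m).measurable (measurableSet_Ioo.prod hs)

/-- Fubini, with `∫₀¹ r^m dr = 1 / (m + 1)`. Passing to cones turns a map from `ℝ^m` to `S^m` into a
map between spaces of equal dimension, where the change of variables formula, the inverse function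
theorem and the easy case of Sard's theorem apply. -/
theorem setIntegral_coneSet {m : ℕ} (s : Set (E m)) (h : E m → ℝ) :
    ∫ z in coneSet s, z 0 ^ m * h (tail m z) = (m + 1 : ℝ)⁻¹ * ∫ x in s, h x := by
  rw [coneSet_eq]
  have h1 := (measurePreserving_splitEquiv m).setIntegral_preimage_emb
    (splitEquiv m).measurableEmbedding (fun p : ℝ × E m => p.1 ^ m * h p.2) (Set.Ioo (0 : ℝ) 1 ×ˢ s)
  simp only [splitEquiv_apply] at h1
  rw [h1, Measure.volume_eq_prod, setIntegral_prod_mul (fun r : ℝ => r ^ m) h]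
  congr 1
  rw [← integral_Ioc_eq_integral_Ioo, ← intervalIntegral.integral_of_le zero_le_one, integral_pow]
  simp

/-- The cone over a map. -/
def coneMap {m : ℕ} (g : E m → E (m + 1)) (z : E (m + 1)) : E (m + 1) := z 0 • g (tail m z)

theorem detForm_eq_det {m : ℕ} (L : E (m + 1) →L[ℝ] E (m + 1)) :
    detForm m (fun j => L (EuclideanSpace.single j 1)) = L.det := by
  have h := LinearMap.det_toMatrix (EuclideanSpace.basisFun (Fin (m + 1)) ℝ).toBasis
    (L : E (m + 1) →ₗ[ℝ] E (m + 1))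
  rw [detForm_apply, ContinuousLinearMap.det, ← h, ← Matrix.det_transpose]
  congr 1

theorem contDiff_coneMap {m : ℕ} {g : E m → E (m + 1)} (hg : ContDiff ℝ ∞ g) :
    ContDiff ℝ ∞ (coneMap g) :=
  (EuclideanSpace.proj (𝕜 := ℝ) (0 : Fin (m + 1))).contDiff.smul (hg.comp (tail m).contDiff)

theorem tail_single_succ {m : ℕ} (i : Fin m) :
    tail m (EuclideanSpace.single i.succ 1) = EuclideanSpace.single i 1 := by
  ext j; simp [tail_apply]

theorem tail_single_zero {m : ℕ} : tail m (EuclideanSpace.single 0 1) = 0 := by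
  ext j; simp [tail_apply]

/-- The derivative in the height direction is `g`; in each of the other `m` coordinate directions it
is `z 0` times a partial derivative of `g`. -/
theorem det_fderiv_coneMap {m : ℕ} {g : E m → E (m + 1)} (hg : ContDiff ℝ ∞ g) (z : E (m + 1)) :
    (fderiv ℝ (coneMap g) z).det = z 0 ^ m * jacDet (g (tail m z)) (grad g (tail m z)) := by
  have h1 := (hg.differentiable (by simp) (tail m z)).hasFDerivAt.comp z (tail m).hasFDerivAt
  have h2 := ((EuclideanSpace.proj (𝕜 := ℝ) (0 : Fin (m + 1))).hasFDerivAt (x := z)).smul h1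
  rw [← detForm_eq_det, show fderiv ℝ (coneMap g) z = _ from
    HasFDerivAt.fderiv (f := coneMap g) h2]
  have h3 : (fun j : Fin (m + 1) => (z 0 • (fderiv ℝ g (tail m z)).comp (tail m) +
      ContinuousLinearMap.smulRight (EuclideanSpace.proj (𝕜 := ℝ) (0 : Fin (m + 1)))
        (g (tail m z))) (EuclideanSpace.single j 1))
      = fun j => (Fin.cons (α := fun _ => ℝ) 1 (fun _ => z 0) j) •
        (Fin.cons (α := fun _ => E (m + 1)) (g (tail m z)) (grad g (tail m z)) j) := by
    ext1 j
    refine Fin.cases ?_ (fun i => ?_) j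
    · simp [tail_single_zero]
    · simp [tail_single_succ, grad, pderiv]
  refine (congrArg (detForm m) h3).trans ?_
  have h4 := (detForm m).map_smul_univ (Fin.cons (α := fun _ => ℝ) 1 fun _ => z 0)
    (Fin.cons (α := fun _ => E (m + 1)) (g (tail m z)) (grad g (tail m z)))
  refine h4.trans ?_
  rw [Fin.prod_univ_succ]
  simp [jacDet]

theorem normalize_coneMap {m : ℕ} {g : E m → E (m + 1)} (hn : ∀ x, ‖g x‖ = 1) {z : E (m + 1)}
    (hz : 0 < z 0) : normalize (coneMap g z) = g (tail m z) := by
  rw [normalize, coneMap, norm_smul, hn, mul_one, Real.norm_of_nonneg hz.le, smul_smul,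
    inv_mul_cancel₀ hz.ne', one_smul]

theorem ext_zero_tail {m : ℕ} {z w : E (m + 1)} (h0 : z 0 = w 0) (h : tail m z = tail m w) :
    z = w := by
  ext j
  refine Fin.cases h0 (fun i => ?_) j
  rw [← tail_apply, ← tail_apply, h]

theorem injOn_coneMap {m : ℕ} {g : E m → E (m + 1)} (hn : ∀ x, ‖g x‖ = 1) {s : Set (E m)}
    (hs : Set.InjOn g s) : Set.InjOn (coneMap g) (coneSet s) := by
  intro z hz w hw h
  have h0 : z 0 = w 0 := by
    have := congrArg norm h
    simpa [coneMap, norm_smul, hn, abs_of_pos hz.1.1, abs_of_pos hw.1.1] using this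
  refine ext_zero_tail h0 (hs hz.2 hw.2 ?_)
  rw [← normalize_coneMap hn hz.1.1, ← normalize_coneMap hn hw.1.1, h]

/-- The area formula for injective maps to the sphere. -/
theorem setIntegral_image_coneMap {m : ℕ} {g : E m → E (m + 1)} (hg : ContDiff ℝ ∞ g)
    (hn : ∀ x, ‖g x‖ = 1) {s : Set (E m)} (hs : MeasurableSet s) (hi : Set.InjOn g s)
    (h : E (m + 1) → ℝ) :
    ∫ z in coneMap g '' coneSet s, h (normalize z)
      = (m + 1 : ℝ)⁻¹ * ∫ x in s, |jacDet (g x) (grad g x)| * h (g x) := by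
  rw [integral_image_eq_integral_abs_det_fderiv_smul volume (measurableSet_coneSet hs)
    (fun z _ => ((contDiff_coneMap hg).differentiable (by simp) z).hasFDerivAt.hasFDerivWithinAt)
    (injOn_coneMap hn hi), ← setIntegral_coneSet]
  refine setIntegral_congr_fun (measurableSet_coneSet hs) fun z hz => ?_
  simp only
  rw [det_fderiv_coneMap hg, normalize_coneMap hn hz.1.1, abs_mul,
    abs_of_nonneg (pow_nonneg hz.1.1.le _), smul_eq_mul, mul_assoc]

theorem coneMap_image_subset_ball {m : ℕ} {g : E m → E (m + 1)} (hn : ∀ x, ‖g x‖ = 1)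
    (s : Set (E m)) : coneMap g '' coneSet s ⊆ ball 0 1 := by
  rintro _ ⟨z, hz, rfl⟩
  simp [coneMap, norm_smul, hn, abs_of_pos hz.1.1, hz.1.2]

theorem mem_coneMap_image {m : ℕ} {g : E m → E (m + 1)} {s : Set (E m)} {z : E (m + 1)}
    (hz : z ∈ ball (0 : E (m + 1)) 1) (h0 : z ≠ 0) (h : normalize z ∈ g '' s) :
    z ∈ coneMap g '' coneSet s := by
  obtain ⟨x, hx, hxz⟩ := h
  let w : E (m + 1) := WithLp.toLp 2 (Fin.cons (α := fun _ => ℝ) ‖z‖ fun i => x i)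
  have hw0 : w 0 = ‖z‖ := rfl
  have hw : tail m w = x := by ext i; rfl
  refine ⟨w, ⟨⟨by simpa [hw0] using h0, by simpa [hw0] using hz⟩, by rwa [hw]⟩, ?_⟩
  rw [coneMap, hw0, hw, hxz, normalize, smul_smul, mul_inv_cancel₀ (norm_ne_zero_iff.2 h0),
    one_smul]

/-- The inverse function theorem for the cone map at height one above `x₀`, where its differential
has determinant `jacDet (g x₀) (grad g x₀)`. -/
theorem exists_nhds_injOn {m : ℕ} {g : E m → E (m + 1)} (hg : ContDiff ℝ ∞ g)
    (hn : ∀ x, ‖g x‖ = 1) {x₀ : E m} (h : jacDet (g x₀) (grad g x₀) ≠ 0) {V : Set (E m)}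
    (hV : V ∈ 𝓝 x₀) :
    ∃ U ⊆ V, IsOpen U ∧ x₀ ∈ U ∧ Set.InjOn g U ∧
      (∀ x ∈ U, SignType.sign (jacDet (g x) (grad g x)) = SignType.sign (jacDet (g x₀) (grad g x₀))) ∧
      ∃ η > 0, ∀ p, ‖p‖ = 1 → dist p (g x₀) < η → p ∈ g '' U := by
  let inc : E m → E (m + 1) := fun x =>
    WithLp.toLp 2 (Fin.cons (α := fun _ => ℝ) 1 fun i => x i)
  have hinc : Continuous inc := by
    refine (PiLp.continuous_toLp 2 _).comp (continuous_pi fun j => ?_)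
    refine Fin.cases ?_ (fun i => ?_) j
    · simpa using continuous_const
    · simp only [Fin.cons_succ]; fun_prop
  have hinc0 : ∀ x, inc x 0 = 1 := fun x => rfl
  have hinct : ∀ x, tail m (inc x) = x := fun x => by ext i; rfl
  set z₀ := inc x₀ with hz₀
  have hcm : ∀ x, coneMap g (inc x) = g x := fun x => by simp [coneMap, hinc0, hinct]
  have hdet : (fderiv ℝ (coneMap g) z₀).det ≠ 0 := by
    rw [det_fderiv_coneMap hg, hinct, hinc0]; simpa using h
  let L := (fderiv ℝ (coneMap g) z₀).toContinuousLinearEquivOfDetNeZero hdet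
  have hst : HasStrictFDerivAt (coneMap g) (L : E (m + 1) →L[ℝ] E (m + 1)) z₀ :=
    (contDiff_coneMap hg).contDiffAt.hasStrictFDerivAt (by simp)
  set Φ := hst.toOpenPartialHomeomorph (coneMap g)
  have hΦ : ∀ z, Φ z = coneMap g z := fun z => rfl
  have hJc : Continuous fun x => jacDet (g x) (grad g x) :=
    (contDiff_jacDet hg fun i => contDiff_grad hg i).continuous
  obtain ⟨V', hV'V, hV'o, hxV'⟩ := _root_.mem_nhds_iff.1 hV
  set U : Set (E m) := V' ∩ inc ⁻¹' Φ.source ∩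
    {x | 0 < jacDet (g x) (grad g x) * jacDet (g x₀) (grad g x₀)} with hU
  have hz₀s : z₀ ∈ Φ.source := hst.mem_toOpenPartialHomeomorph_source
  have hUo : IsOpen U := (hV'o.inter (Φ.open_source.preimage hinc)).inter
    (isOpen_lt continuous_const (hJc.mul continuous_const))
  have hx₀U : x₀ ∈ U := ⟨⟨hxV', hz₀s⟩, mul_self_pos.2 h⟩
  refine ⟨U, fun x hx => hV'V hx.1.1, hUo, hx₀U, ?_, ?_, ?_⟩
  · intro x hx y hy hxy
    have := Φ.injOn hx.1.2 hy.1.2 (by rw [hΦ, hΦ, hcm, hcm, hxy])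
    rw [← hinct x, this, hinct]
  · intro x hx
    have hx2 : 0 < jacDet (g x) (grad g x) * jacDet (g x₀) (grad g x₀) := hx.2
    rcases pos_and_pos_or_neg_and_neg_of_mul_pos hx2 with h1 | h1
    · rw [sign_pos h1.1, sign_pos h1.2]
    · rw [sign_neg h1.1, sign_neg h1.2]
  -- The cone map is open at `z₀`. A unit vector near `g x₀` is therefore some `coneMap g z` with
  -- positive height, and normalising it gives `g (tail m z)`.
  · have hnh : {z | 0 < z 0 ∧ tail m z ∈ U} ∈ 𝓝 z₀ := by
      refine IsOpen.mem_nhds ?_ ⟨by rw [hinc0]; norm_num, by rw [hinct]; exact hx₀U⟩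
      exact (isOpen_lt continuous_const
        (EuclideanSpace.proj (𝕜 := ℝ) (0 : Fin (m + 1))).continuous).inter (hUo.preimage (tail m).continuous)
    have him : coneMap g '' {z | 0 < z 0 ∧ tail m z ∈ U} ∈ 𝓝 (g x₀) := by
      rw [← hcm x₀, ← hst.map_nhds_eq_of_equiv]
      exact image_mem_map hnh
    obtain ⟨η, hη, hb⟩ := Metric.mem_nhds_iff.1 him
    refine ⟨η, hη, fun p hp hpd => ?_⟩
    obtain ⟨z, ⟨hz0, hzU⟩, rfl⟩ := hb hpd
    refine ⟨tail m z, hzU, ?_⟩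
    rw [← normalize_coneMap hn hz0, normalize_of_norm hp]

/-! ### The degree formula -/

theorem sphereArea_eq (m : ℕ) : sphereArea m = (m + 1 : ℕ) * volume (ball (0 : E (m + 1)) 1) := by
  rw [sphereArea, Measure.toSphere_apply_univ]
  simp

theorem sphereArea_ne_top (m : ℕ) : sphereArea m ≠ ⊤ := by
  rw [sphereArea_eq]
  exact ENNReal.mul_ne_top (ENNReal.natCast_ne_top _) measure_ball_lt_top.ne

theorem sphereArea_toReal (m : ℕ) :
    (sphereArea m).toReal = (m + 1) * volume.real (ball (0 : E (m + 1)) 1) := by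
  rw [sphereArea_eq, ENNReal.toReal_mul, measureReal_def, ENNReal.toReal_natCast]
  push_cast
  rfl

theorem sphereArea_toReal_pos (m : ℕ) : 0 < (sphereArea m).toReal := by
  rw [sphereArea_toReal]
  have : 0 < volume.real (ball (0 : E (m + 1)) 1) :=
    ENNReal.toReal_pos (measure_ball_pos _ _ one_pos).ne' measure_ball_lt_top.ne
  positivity

theorem measurable_normalize {n : ℕ} : Measurable (normalize : E n → E n) :=
  (measurable_norm.inv).smul measurable_id

/-- A smooth bump on the sphere, as a function of the inner product with the centre. -/
def capBump (η : ℝ) (s : ℝ) : ℝ := Real.smoothTransition (s - (1 - η ^ 2 / 2))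

theorem contDiff_capBump (η : ℝ) : ContDiff ℝ ∞ (capBump η) :=
  Real.smoothTransition.contDiff.comp (contDiff_id.sub contDiff_const)

/-- For unit vectors `|p - y|² = 2 - 2 ⟨y, p⟩`, so the threshold `1 - η² / 2` in `capBump` is
exactly the boundary of the cap of radius `η`. -/
theorem capBump_eq_zero {n : ℕ} {η : ℝ} (hη : 0 ≤ η) {y p : E n} (hy : ‖y‖ = 1) (hp : ‖p‖ = 1)
    (h : η ≤ dist p y) : capBump η (inner ℝ y p) = 0 := by
  refine Real.smoothTransition.zero_of_nonpos ?_
  have h1 := norm_sub_sq_real p y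
  rw [hy, hp, ← dist_eq_norm, real_inner_comm] at h1
  nlinarith [pow_le_pow_left₀ hη h 2]

theorem integral_capBump_pos {n : ℕ} {η : ℝ} (h0 : 0 < η) {y : E n}
    (hy : ‖y‖ = 1) : 0 < ∫ z in ball (0 : E n) 1, capBump η (inner ℝ (normalize z) y) := by
  have hb : ∀ s, ‖capBump η s‖ ≤ 1 := fun s => by
    rw [capBump, Real.norm_of_nonneg (Real.smoothTransition.nonneg _)]
    exact Real.smoothTransition.le_one _
  have hmeas : Measurable fun z : E n => capBump η (inner ℝ (normalize z) y) :=
    (contDiff_capBump η).continuous.measurable.comp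
      (measurable_normalize.inner measurable_const)
  have hint : Integrable (fun z : E n => capBump η (inner ℝ (normalize z) y))
      (volume.restrict (ball 0 1)) :=
    Measure.integrableOn_of_bounded (M := 1) measure_ball_lt_top.ne
      hmeas.aestronglyMeasurable (Eventually.of_forall fun z => hb _)
  rw [integral_pos_iff_support_of_nonneg
    (show (0 : E n → ℝ) ≤ fun z => capBump η (inner ℝ (normalize z) y) from
      fun z => Real.smoothTransition.nonneg _) hint,
    Measure.restrict_apply' measurableSet_ball]
  have hy0 : y ≠ 0 := by rintro rfl; simp at hy
  have hyy : inner ℝ y y = (1 : ℝ) := by rw [real_inner_self_eq_norm_sq, hy]; norm_num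
  set O : Set (E n) := {z | z ∈ ball (0 : E n) 1 ∧ (1 - η ^ 2 / 2) * ‖z‖ < inner ℝ z y ∧ 0 < inner ℝ z y} with hO
  have hic : Continuous fun z : E n => (inner ℝ z y : ℝ) := by fun_prop
  have hOo : IsOpen O := isOpen_ball.inter
    ((isOpen_lt (continuous_const.mul continuous_norm) hic).inter (isOpen_lt continuous_const hic))
  have hOn : O.Nonempty := by
    refine ⟨(1 / 2 : ℝ) • y, ?_, ?_, ?_⟩
    · simp only [mem_ball, dist_zero_right, norm_smul, hy]; norm_num
    · rw [norm_smul, hy, inner_smul_left, hyy]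
      simp
      positivity
    · rw [inner_smul_left, hyy]; simp
  refine lt_of_lt_of_le (hOo.measure_pos volume hOn) (measure_mono fun z hz => ⟨?_, hz.1⟩)
  have hz0 : z ≠ 0 := by
    rintro rfl
    have := hz.2.2
    simp at this
  have hzn : 0 < ‖z‖ := norm_pos_iff.2 hz0
  refine (Real.smoothTransition.pos_of_pos ?_).ne'
  rw [normalize, inner_smul_left, sub_pos]
  simp only [conj_trivial]
  rw [inv_mul_eq_div, lt_div_iff₀ hzn]
  exact hz.2.1

/-- The fibre over `y` is compact because `y ≠ b`, and discrete by local injectivity, hence finite.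
Off the neighbourhoods of its points, compactness of a closed ball and the value `b` outside it keep
`g` at a positive distance from `y`; `η` is the least of finitely many such bounds. -/
theorem exists_separation {m : ℕ} {b : E (m + 1)} {g : E m → E (m + 1)} (hg : IsSmoothMap b g)
    {y : E (m + 1)} (hyb : y ≠ b) (hr : IsRegularValue g y) :
    ∃ (T : Finset (E m)) (U : E m → Set (E m)) (η : ℝ),
      (∀ x, x ∈ T ↔ g x = y) ∧ (T : Set (E m)).PairwiseDisjoint U ∧ 0 < η ∧ η ≤ 1 ∧
      (∀ x ∈ T, IsOpen (U x) ∧ Set.InjOn g (U x) ∧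
        (∀ z ∈ U x, SignType.sign (jacDet (g z) (grad g z)) = SignType.sign (jacDet (g x) (grad g x))) ∧
        (∀ p, ‖p‖ = 1 → dist p y < η → p ∈ g '' U x)) ∧
      ∀ x, (∀ c ∈ T, x ∉ U c) → η ≤ dist (g x) y := by
  obtain ⟨R, hR⟩ := hg.eq_base
  have hgc := hg.contDiff.continuous
  set P : Set (E m) := {x | g x = y}
  have hPc : IsCompact P := by
    refine (isCompact_closedBall (0 : E m) R).of_isClosed_subset
      (isClosed_eq hgc continuous_const) fun x hx => ?_
    by_contra h
    rw [mem_closedBall, dist_zero_right, not_le] at h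
    exact hyb (hx.symm.trans (hR x h.le))
  have hPf : P.Finite := by
    have hN : ∀ x ∈ P, ∃ U, IsOpen U ∧ x ∈ U ∧ Set.InjOn g U := fun x hx => by
      obtain ⟨U, -, h1, h2, h3, -⟩ := exists_nhds_injOn hg.contDiff hg.norm_eq_one
        (hr x hx) univ_mem
      exact ⟨U, h1, h2, h3⟩
    choose! U hUo hxU hUi using hN
    obtain ⟨t, htP, ht⟩ := hPc.elim_nhds_subcover U fun x hx => (hUo x hx).mem_nhds (hxU x hx)
    refine t.finite_toSet.subset fun x hx => ?_
    obtain ⟨c, hc, hxc⟩ := Set.mem_iUnion₂.1 (ht hx)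
    have : x = c := hUi c (htP c hc) hxc (hxU c (htP c hc))
      ((show g x = y from hx).trans (htP c hc).symm)
    rw [this]; exact hc
  obtain ⟨W, hW, hWd⟩ := hPf.t2_separation
  have hN : ∀ x ∈ P, ∃ U ⊆ W x, IsOpen U ∧ x ∈ U ∧ Set.InjOn g U ∧
      (∀ z ∈ U, SignType.sign (jacDet (g z) (grad g z)) = SignType.sign (jacDet (g x) (grad g x))) ∧
      ∃ η > 0, ∀ p, ‖p‖ = 1 → dist p (g x) < η → p ∈ g '' U := fun x hx =>
    exists_nhds_injOn hg.contDiff hg.norm_eq_one (hr x hx) ((hW x).2.mem_nhds (hW x).1)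
  choose! U hUW hUo hxU hUi hUs η hη hUη using hN
  set T := hPf.toFinset
  have hT : ∀ x, x ∈ T ↔ g x = y := fun x => hPf.mem_toFinset
  have hK : ∃ δ > 0, ∀ x, (∀ c ∈ T, x ∉ U c) → δ ≤ dist (g x) y := by
    set K : Set (E m) := closedBall 0 R ∩ (⋃ c ∈ T, U c)ᶜ
    have hKc : IsCompact K := (isCompact_closedBall _ _).inter_right
      (isOpen_biUnion fun c hc => hUo c ((hT c).1 hc)).isClosed_compl
    have hby : 0 < dist b y := dist_pos.2 hyb.symm
    rcases K.eq_empty_or_nonempty with hKe | hKn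
    · refine ⟨dist b y, hby, fun x hx => ?_⟩
      have : x ∉ K := by rw [hKe]; simp
      have hx' : R ≤ ‖x‖ := by
        by_contra h
        exact this ⟨by simpa using (not_le.1 h).le, by simpa using hx⟩
      rw [hR x hx']
    · obtain ⟨x₀, hx₀, hmin⟩ := hKc.exists_isMinOn hKn
        (hgc.dist continuous_const : Continuous fun x => dist (g x) y).continuousOn
      have h0 : 0 < dist (g x₀) y := by
        refine dist_pos.2 fun h => ?_
        exact hx₀.2 (Set.mem_iUnion₂.2 ⟨x₀, (hT x₀).2 h, hxU x₀ h⟩)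
      refine ⟨min (dist b y) (dist (g x₀) y), lt_min hby h0, fun x hx => ?_⟩
      by_cases hxR : R ≤ ‖x‖
      · rw [hR x hxR]; exact min_le_left _ _
      · exact (min_le_right _ _).trans
          (hmin ⟨by simpa using (not_le.1 hxR).le, by simpa using hx⟩)
  obtain ⟨δ, hδ, hδK⟩ := hK
  have hmin : ∃ ε > 0, ∀ x ∈ T, ε ≤ η x := by
    rcases T.eq_empty_or_nonempty with h | h
    · exact ⟨1, one_pos, by simp [h]⟩
    · obtain ⟨c, hc, hcm⟩ := T.exists_min_image η h
      exact ⟨η c, hη c ((hT c).1 hc), hcm⟩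
  obtain ⟨ε, hε, hεT⟩ := hmin
  refine ⟨T, U, min (min ε δ) 1, hT, ?_, by positivity, min_le_right _ _, fun x hx => ?_, fun x hx => ?_⟩
  · intro x hx z hz hxz
    exact (hWd ((hT x).1 hx) ((hT z).1 hz) hxz).mono (hUW x ((hT x).1 hx)) (hUW z ((hT z).1 hz))
  · have hxP := (hT x).1 hx
    refine ⟨hUo x hxP, hUi x hxP, hUs x hxP, fun p hp hpd => hUη x hxP p hp ?_⟩
    rw [hxP]
    exact lt_of_lt_of_le hpd (((min_le_left _ _).trans (min_le_left _ _)).trans (hεT x hx))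
  · exact ((min_le_left _ _).trans (min_le_right _ _)).trans (hδK x hx)

/-- The degree integral of a smooth map counts the preimages of any regular value. -/
theorem degInt_eq_signedCount {m : ℕ} (hm : 2 ≤ m) {b : E (m + 1)} {g : E m → E (m + 1)}
    (hg : IsSmoothMap b g) {y : E (m + 1)} (hy : ‖y‖ = 1) (hyb : y ≠ b)
    (hr : IsRegularValue g y) :
    degInt g = (sphereArea m).toReal * signedCount g y := by
  obtain ⟨T, U, η, hT, hdisj, hη, hη1, hU, hout⟩ := exists_separation hg hyb hr
  have hgs := hg.contDiff
  have hn := hg.norm_eq_one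
  set J : E m → ℝ := fun x => jacDet (g x) (grad g x) with hJdef
  have hJc : Continuous J := (contDiff_jacDet hgs fun i => contDiff_grad hgs i).continuous
  have hJi : HasCompactSupport J ∧ Integrable J volume :=
    integrable_of_contDiff_of_grad hJc hg.hasCompactSupport_fderiv fun x hx =>
      jacDet_eq_zero_of_eq_zero _ (i := ⟨0, by omega⟩) (grad_eq_zero hx _)
  set k := capBump η with hkdef
  have hk : ContDiff ℝ ∞ k := contDiff_capBump η
  have hkb : ∀ s, ‖k s‖ ≤ 1 := fun s => by
    rw [hkdef, capBump, Real.norm_of_nonneg (Real.smoothTransition.nonneg _)]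
    exact Real.smoothTransition.le_one _
  -- This uses `η ≤ 1`. It is needed at `z = 0`, where `normalize z` takes the default value `0`.
  have hk0 : k 0 = 0 := Real.smoothTransition.zero_of_nonpos (by nlinarith)
  set Z : ℝ := ∫ z in ball (0 : E (m + 1)) 1, k (inner ℝ (normalize z) y) with hZ
  have hZpos : 0 < Z := integral_capBump_pos hη hy
  -- The weighted degree integral is independent of the unit vector `p`. It is computed at `p = y`,
  -- where only neighbourhoods of the preimages contribute, and in the mean over all `p`.
  set F : E (m + 1) → ℝ := fun p => ∫ x, k (inner ℝ p (g x)) * J x with hF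
  have hm1 : (0 : ℝ) < m + 1 := by positivity
  -- the value of `F` at `y`
  have hFy : F y = (m + 1) * Z * signedCount g y := by
    have hsc : (signedCount g y : ℝ) = ∑ x ∈ T, ((SignType.sign (J x) : SignType) : ℝ) := by
      have hset : {x : E m | g x = y} = (T : Set (E m)) := by ext x; simp [hT]
      rw [signedCount, hset, finsum_mem_coe_finset]
      push_cast
      refine Finset.sum_congr rfl fun x _ => ?_
      rw [orientedJacobian_eq]
    have hkJ : Integrable (fun x => k (inner ℝ y (g x)) * J x) volume :=
      ((hk.continuous.comp (by fun_prop)).mul hJc).integrable_of_hasCompactSupport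
        (hJi.1.mul_left)
    have h1 : F y = ∑ c ∈ T, ∫ x in U c, k (inner ℝ y (g x)) * J x := by
      rw [← integral_biUnion_finset T (fun c hc => (hU c hc).1.measurableSet) hdisj
        fun c _ => hkJ.integrableOn]
      refine (setIntegral_eq_integral_of_forall_compl_eq_zero fun x hx => ?_).symm
      rw [show k (inner ℝ y (g x)) = 0 from capBump_eq_zero hη.le hy (hn x) (hout x (by simpa using hx)), zero_mul]
    rw [h1, hsc, Finset.mul_sum]
    refine Finset.sum_congr rfl fun c hc => ?_
    obtain ⟨hUo, hUi, hUs, hUη⟩ := hU c hc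
    have h2 := setIntegral_image_coneMap hgs hn hUo.measurableSet hUi (fun p => k (inner ℝ p y))
    -- The cap of radius `η` about `y` lies in `g '' U c`, so restricting to the cone over this
    -- image loses nothing: every preimage contributes the same `Z`.
    have h3 : ∫ z in coneMap g '' coneSet (U c), k (inner ℝ (normalize z) y) = Z := by
      rw [hZ]
      refine (setIntegral_eq_of_subset_of_forall_sdiff_eq_zero measurableSet_ball
        (coneMap_image_subset_ball hn _) fun z hz => ?_).symm
      by_cases hz0 : z = 0
      · simp [hz0, normalize, hk0]
      · have hz1 := norm_normalize hz0
        rw [real_inner_comm]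
        refine capBump_eq_zero hη.le hy hz1 (not_lt.1 fun hlt => hz.2 ?_)
        exact mem_coneMap_image hz.1 hz0 (hUη _ hz1 hlt)
    rw [h3] at h2
    have h4 : ∫ x in U c, k (inner ℝ y (g x)) * J x
        = ((SignType.sign (J c) : SignType) : ℝ) * ∫ x in U c, |J x| * k (inner ℝ (g x) y) := by
      rw [← integral_const_mul]
      refine setIntegral_congr_fun hUo.measurableSet fun x hx => ?_
      change k (inner ℝ y (g x)) * J x = ((SignType.sign (J c) : SignType) : ℝ) *
        (|J x| * k (inner ℝ (g x) y))
      rw [← show SignType.sign (J x) = SignType.sign (J c) from hUs x hx, real_inner_comm]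
      have := sign_mul_abs (J x)
      simp only [hJdef] at this ⊢
      linear_combination (-(k (inner ℝ (g x) y))) * this
    rw [h4]
    have h5 : ∫ x in U c, |J x| * k (inner ℝ (g x) y) = (m + 1) * Z := by
      rw [h2]; field_simp; rfl
    rw [h5]; ring
  -- averaging `F`
  have hconst : ∀ z : E (m + 1), z ≠ 0 → F (normalize z) = F y := fun z hz =>
    integral_inner_mul_jacDet_const hm hg hk (norm_normalize hz) hy
  have hne : ∀ᵐ z ∂(volume.restrict (ball (0 : E (m + 1)) 1)), z ≠ 0 :=
    ae_restrict_of_ae (by simp [ae_iff])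
  have hL : ∫ z in ball (0 : E (m + 1)) 1, F (normalize z)
      = volume.real (ball (0 : E (m + 1)) 1) * F y := by
    rw [integral_congr_ae (g := fun _ => F y) (hne.mono fun z hz => hconst z hz)]
    simp
  -- By Fubini the weight is averaged first, and its mean is `Z` whatever the unit vector `g x` is.
  have hR : ∫ z in ball (0 : E (m + 1)) 1, F (normalize z) = Z * degInt g := by
    simp only [hF]
    rw [integral_integral_swap, degInt, ← integral_const_mul]
    · refine integral_congr_ae (Eventually.of_forall fun x => ?_)
      simp only
      rw [integral_mul_const, integral_ball_inner_normalize (k := k) (hn x) hy]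
    · have : IsFiniteMeasure (volume.restrict (ball (0 : E (m + 1)) 1)) :=
        ⟨by simpa using measure_ball_lt_top⟩
      refine ((hJi.2.comp_snd _).norm.mono ?_ (Eventually.of_forall fun p => ?_))
      · refine Measurable.aestronglyMeasurable ?_
        refine (hk.continuous.measurable.comp ((measurable_normalize.comp measurable_fst).inner
          (hgs.continuous.measurable.comp measurable_snd))).mul
          (hJc.measurable.comp measurable_snd)
      · simp only [Function.uncurry, norm_mul, norm_norm]
        calc _ ≤ 1 * ‖J p.2‖ := by gcongr; exact hkb _
          _ = _ := one_mul _
  rw [hL, hFy] at hR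
  rw [sphereArea_toReal]
  have h6 : Z * degInt g = Z * ((m + 1) * volume.real (ball (0 : E (m + 1)) 1) * signedCount g y) := by
    rw [← hR]; ring
  exact mul_left_cancel₀ hZpos.ne' h6

/-! ### Homotopy classes of maps that are constant at infinity -/

/-- Continuous maps `ℝ^m → S^m` that are equal to `b` outside a ball. -/
structure IsContMap {m : ℕ} (b : S m) (f : E m → E (m + 1)) : Prop where
  continuous : Continuous f
  norm_eq_one : ∀ x, ‖f x‖ = 1
  eq_base : ∃ R, ∀ x, R ≤ ‖x‖ → f x = b

/-- `f` is equal to `b` outside the open cube `(-R, R)^m`. -/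
def BaseOff {m : ℕ} (b : S m) (R : ℝ) (f : E m → E (m + 1)) : Prop :=
  ∀ x : E m, (∃ i, R ≤ |x i|) → f x = b

theorem BaseOff.mono {m : ℕ} {b : S m} {R R' : ℝ} {f : E m → E (m + 1)} (h : BaseOff b R f)
    (hR : R ≤ R') : BaseOff b R' f := fun x ⟨i, hi⟩ => h x ⟨i, hR.trans hi⟩

theorem abs_apply_le_norm {m : ℕ} (x : E m) (i : Fin m) : |x i| ≤ ‖x‖ := by
  simpa using PiLp.norm_apply_le x i

theorem baseOff_of_norm {m : ℕ} {b : S m} {R : ℝ} {f : E m → E (m + 1)}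
    (h : ∀ x, R ≤ ‖x‖ → f x = b) : BaseOff b R f :=
  fun x ⟨i, hi⟩ => h x (hi.trans (abs_apply_le_norm x i))

theorem continuous_cubeMap {m : ℕ} : Continuous (cubeMap (m := m)) :=
  (PiLp.continuous_toLp 2 _).comp (by fun_prop)

theorem cubeMap_apply {m : ℕ} (t : Fin m → unitInterval) (i : Fin m) :
    cubeMap t i = 2 * (t i : ℝ) - 1 := rfl

theorem abs_cubeMap_of_boundary {m : ℕ} {t : Fin m → unitInterval} {i : Fin m}
    (h : t i = 0 ∨ t i = 1) : |cubeMap t i| = 1 := by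
  rw [cubeMap_apply]
  rcases h with h | h <;> rw [h] <;> norm_num

theorem IsContMap.continuous_comp_cubeMap {m : ℕ} {b : S m} {f : E m → E (m + 1)}
    (hf : IsContMap b f) (R : ℝ) :
    Continuous fun t : Fin m → unitInterval => f (R • cubeMap t) :=
  hf.continuous.comp (continuous_cubeMap.const_smul R)

theorem IsContMap.mem_sphere {m : ℕ} {b : S m} {f : E m → E (m + 1)} (hf : IsContMap b f)
    (x : E m) : f x ∈ sphere (0 : E (m + 1)) 1 := by
  simp [hf.norm_eq_one]

/-- The `m`-dimensional loop given by the values on the cube `[-R, R]^m`. -/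
def toLoop {m : ℕ} {b : S m} {f : E m → E (m + 1)} (hf : IsContMap b f) (R : ℝ) (h0 : 0 < R)
    (h : BaseOff b R f) : Ω^ (Fin m) (S m) b :=
  ⟨⟨fun t => ⟨f (R • cubeMap t), hf.mem_sphere _⟩,
    (hf.continuous_comp_cubeMap R).subtype_mk fun _ => hf.mem_sphere _⟩, by
    rintro t ⟨i, hi⟩
    refine Subtype.ext (a1 := (⟨f (R • cubeMap t), hf.mem_sphere _⟩ : S m)) (h _ ⟨i, ?_⟩)
    rw [PiLp.smul_apply, smul_eq_mul, abs_mul, abs_cubeMap_of_boundary hi, abs_of_pos h0, mul_one]⟩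

theorem toLoop_apply {m : ℕ} {b : S m} {f : E m → E (m + 1)} (hf : IsContMap b f) {R : ℝ}
    (h0 : 0 < R) (h : BaseOff b R f) (t : Fin m → unitInterval) :
    (toLoop hf R h0 h t : E (m + 1)) = f (R • cubeMap t) := rfl

theorem IsContMap.exists_baseOff {m : ℕ} {b : S m} {f : E m → E (m + 1)} (hf : IsContMap b f) :
    ∃ R, 0 < R ∧ BaseOff b R f := by
  obtain ⟨R, hR⟩ := hf.eq_base
  exact ⟨max R 1, by positivity, (baseOff_of_norm hR).mono (le_max_left _ _)⟩

/-- The homotopy class of a map that is constant at infinity. -/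
def cls {m : ℕ} {b : S m} {f : E m → E (m + 1)} (hf : IsContMap b f) : π_ m (S m) b :=
  Quotient.mk _ (toLoop hf hf.exists_baseOff.choose hf.exists_baseOff.choose_spec.1
    hf.exists_baseOff.choose_spec.2)

theorem mk_eq_of_homotopy {m : ℕ} {b : S m} {γ γ' : Ω^ (Fin m) (S m) b}
    {H : unitInterval × (Fin m → unitInterval) → E (m + 1)} (hH : Continuous H)
    (hn : ∀ p, ‖H p‖ = 1) (hb : ∀ s t, t ∈ Cube.boundary (Fin m) → H (s, t) = b)
    (h0 : ∀ t, H (0, t) = γ t) (h1 : ∀ t, H (1, t) = γ' t) :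
    (Quotient.mk _ γ : π_ m (S m) b) = Quotient.mk _ γ' := by
  have hmem : ∀ p, H p ∈ sphere (0 : E (m + 1)) 1 := fun p => by simp [hn]
  refine Quotient.sound ⟨⟨⟨⟨fun p => ⟨H p, hmem p⟩, hH.subtype_mk hmem⟩, ?_, ?_⟩, ?_⟩⟩
  · intro t
    exact Subtype.ext (a1 := (⟨H (0, t), hmem _⟩ : S m)) (h0 t)
  · intro t
    exact Subtype.ext (a1 := (⟨H (1, t), hmem _⟩ : S m)) (h1 t)
  · intro s t ht
    refine Subtype.ext (a1 := (⟨H (s, t), hmem _⟩ : S m)) ?_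
    change H (s, t) = _
    rw [hb s t ht]
    exact (congrArg Subtype.val (GenLoop.boundary γ t ht)).symm

/-- Interpolate linearly between the two radii: no intermediate radius is below the smaller one, so
the boundary of the cube is always sent to `b`. Thus the radius chosen in `cls` is irrelevant. -/
theorem toLoop_radius {m : ℕ} {b : S m} {f : E m → E (m + 1)} (hf : IsContMap b f) {R R' : ℝ}
    (hR : 0 < R) (hR' : 0 < R') (hfR : BaseOff b R f) (hfR' : BaseOff b R' f) :
    (Quotient.mk _ (toLoop hf R hR hfR) : π_ m (S m) b)
      = Quotient.mk _ (toLoop hf R' hR' hfR') := by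
  refine mk_eq_of_homotopy
    (H := fun p => f (((1 - (p.1 : ℝ)) * R + p.1 * R') • cubeMap p.2)) ?_
    (fun p => hf.norm_eq_one _) ?_ (fun t => by simp [toLoop_apply])
    (fun t => by simp [toLoop_apply])
  · have h1 : Continuous fun p : unitInterval × (Fin m → unitInterval) => cubeMap p.2 :=
      continuous_cubeMap.comp continuous_snd
    have h2 : Continuous fun p : unitInterval × (Fin m → unitInterval) =>
      (1 - (p.1 : ℝ)) * R + p.1 * R' := by fun_prop
    exact hf.continuous.comp (h2.smul h1)
  · rintro s t ⟨i, hi⟩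
    have h0 := s.2.1
    have h1 := s.2.2
    have hmin : BaseOff b (min R R') f := by
      rcases min_choice R R' with h | h <;> rw [h] <;> assumption
    refine hmin _ ⟨i, ?_⟩
    rw [PiLp.smul_apply, smul_eq_mul, abs_mul, abs_cubeMap_of_boundary hi, mul_one]
    refine le_trans ?_ (le_abs_self _)
    nlinarith [min_le_left R R', min_le_right R R']

theorem cls_eq {m : ℕ} {b : S m} {f : E m → E (m + 1)} (hf : IsContMap b f) {R : ℝ} (h0 : 0 < R)
    (h : BaseOff b R f) : cls hf = Quotient.mk _ (toLoop hf R h0 h) :=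
  toLoop_radius hf _ _ _ _

theorem cls_homotopy {m : ℕ} {b : S m} {f g : E m → E (m + 1)} (hf : IsContMap b f)
    (hg : IsContMap b g) {H : unitInterval × E m → E (m + 1)} (hH : Continuous H)
    (hn : ∀ p, ‖H p‖ = 1) {R : ℝ} (hb : ∀ s x, R ≤ ‖x‖ → H (s, x) = b)
    (h0 : ∀ x, H (0, x) = f x) (h1 : ∀ x, H (1, x) = g x) : cls hf = cls hg := by
  have hR : 0 < max R 1 := by positivity
  have hb' : ∀ s x, (∃ i, max R 1 ≤ |x i|) → H (s, x) = b := fun s x ⟨i, hi⟩ =>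
    hb s x (((le_max_left _ _).trans hi).trans (abs_apply_le_norm x i))
  rw [cls_eq hf hR fun x hx => by rw [← h0]; exact hb' 0 x hx,
    cls_eq hg hR fun x hx => by rw [← h1]; exact hb' 1 x hx]
  refine mk_eq_of_homotopy (H := fun p => H (p.1, max R 1 • cubeMap p.2)) ?_
    (fun p => hn _) ?_ (fun t => h0 _) (fun t => h1 _)
  · have h1 : Continuous fun p : unitInterval × (Fin m → unitInterval) => cubeMap p.2 :=
      continuous_cubeMap.comp continuous_snd
    exact hH.comp (continuous_fst.prodMk (h1.const_smul (max R 1)))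
  · rintro s t ⟨i, hi⟩
    refine hb' _ _ ⟨i, ?_⟩
    rw [PiLp.smul_apply, smul_eq_mul, abs_mul, abs_cubeMap_of_boundary hi, mul_one, abs_of_pos hR]

theorem continuous_normalize {X F : Type*} [TopologicalSpace X] [NormedAddCommGroup F]
    [NormedSpace ℝ F] {u : X → F} (hu : Continuous u) (h : ∀ x, u x ≠ 0) :
    Continuous fun x => normalize (u x) :=
  (hu.norm.inv₀ fun x => norm_ne_zero_iff.2 (h x)).smul hu

theorem norm_base {m : ℕ} (b : S m) : ‖(b : E (m + 1))‖ = 1 := by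
  simp

/-- A homotopy given by nowhere vanishing vectors. -/
theorem cls_homotopy_normalize {m : ℕ} {b : S m} {f g : E m → E (m + 1)} (hf : IsContMap b f)
    (hg : IsContMap b g) {H : unitInterval × E m → E (m + 1)} (hH : Continuous H)
    (hn : ∀ p, H p ≠ 0) {R : ℝ} (hb : ∀ s x, R ≤ ‖x‖ → normalize (H (s, x)) = b)
    (h0 : ∀ x, normalize (H (0, x)) = f x) (h1 : ∀ x, normalize (H (1, x)) = g x) :
    cls hf = cls hg :=
  cls_homotopy hf hg (continuous_normalize hH hn) (fun p => norm_normalize (hn p)) hb h0 h1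

theorem cls_eq_of_ne_neg {m : ℕ} {b : S m} {f g : E m → E (m + 1)} (hf : IsContMap b f)
    (hg : IsContMap b g) (h : ∀ x, f x ≠ - g x) : cls hf = cls hg := by
  obtain ⟨R, hR⟩ := hf.eq_base
  obtain ⟨R', hR'⟩ := hg.eq_base
  refine cls_homotopy_normalize hf hg
    (H := fun p => (1 - (p.1 : ℝ)) • f p.2 + (p.1 : ℝ) • g p.2) ?_
    (fun p => segment_ne_zero (hf.norm_eq_one _) (hg.norm_eq_one _) (h _) p.1.2)
    (R := max R R') ?_ ?_ ?_
  · have := hf.continuous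
    have := hg.continuous
    fun_prop
  · intro s x hx
    simp only
    rw [hR x (le_trans (le_max_left _ _) hx), hR' x (le_trans (le_max_right _ _) hx), ← add_smul]
    simp [normalize_of_norm (norm_base b)]
  · intro x; simp [normalize_of_norm (hf.norm_eq_one x)]
  · intro x; simp [normalize_of_norm (hg.norm_eq_one x)]

theorem isContMap_const {m : ℕ} (b : S m) : IsContMap b fun _ => (b : E (m + 1)) :=
  ⟨continuous_const, fun _ => norm_base b, 0, fun _ _ => rfl⟩

/-! ### Passing between loops on the cube and maps on `ℝ^m`. -/

/-- The inverse of `cubeMap`, with clamping. -/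
def clampCube {m : ℕ} (x : E m) : Fin m → unitInterval :=
  fun i => Set.projIcc 0 1 zero_le_one ((x i + 1) / 2)

theorem continuous_clampCube {m : ℕ} : Continuous (clampCube (m := m)) :=
  continuous_pi fun i => continuous_projIcc.comp (by fun_prop)

theorem clampCube_cubeMap {m : ℕ} (t : Fin m → unitInterval) : clampCube (cubeMap t) = t := by
  ext1 i
  rw [clampCube, cubeMap_apply, show (2 * (t i : ℝ) - 1 + 1) / 2 = t i by ring]
  exact Set.projIcc_val _ _

theorem clampCube_boundary {m : ℕ} {x : E m} {i : Fin m} (h : 1 ≤ |x i|) :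
    clampCube x ∈ Cube.boundary (Fin m) := by
  refine ⟨i, ?_⟩
  rcases le_abs'.1 h with h | h
  · left; exact Set.projIcc_of_le_left _ (by linarith)
  · right; exact Set.projIcc_of_right_le _ (by linarith)

theorem cubeMap_clampCube {m : ℕ} {x : E m} (h : ∀ i, |x i| ≤ 1) : cubeMap (clampCube x) = x := by
  ext i
  have := abs_le.1 (h i)
  rw [cubeMap_apply, clampCube, Set.projIcc_of_mem _ (⟨by linarith, by linarith⟩)]
  simp only
  ring

theorem exists_coord_of_norm {m : ℕ} {x : E m} (h : (m : ℝ) + 1 ≤ ‖x‖) : ∃ i, 1 ≤ |x i| := by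
  by_contra! hc
  have h1 : ‖x‖ ^ 2 ≤ m := by
    rw [EuclideanSpace.norm_sq_eq]
    calc ∑ i, ‖x i‖ ^ 2 ≤ ∑ i : Fin m, (1 : ℝ) := by
          refine Finset.sum_le_sum fun i _ => ?_
          rw [Real.norm_eq_abs]
          exact pow_le_one₀ (abs_nonneg _) (hc i).le
      _ = m := by simp
  nlinarith [Nat.cast_nonneg (α := ℝ) m]

theorem isContMap_ofLoop {m : ℕ} {b : S m} (γ : Ω^ (Fin m) (S m) b) :
    IsContMap b fun x => (γ (clampCube x) : E (m + 1)) := by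
  refine ⟨continuous_subtype_val.comp (γ.1.continuous.comp continuous_clampCube),
    fun x => norm_base _, m + 1, fun x hx => ?_⟩
  obtain ⟨i, hi⟩ := exists_coord_of_norm hx
  rw [GenLoop.boundary γ _ (clampCube_boundary hi)]

theorem cls_ofLoop {m : ℕ} {b : S m} (γ : Ω^ (Fin m) (S m) b) :
    cls (isContMap_ofLoop γ) = Quotient.mk _ γ := by
  have h : BaseOff b 1 fun x => (γ (clampCube x) : E (m + 1)) := fun x ⟨i, hi⟩ => by
    simp only
    rw [GenLoop.boundary γ _ (clampCube_boundary hi)]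
  rw [cls_eq _ one_pos h]
  congr 1
  refine GenLoop.ext _ _ fun t => Subtype.ext ((toLoop_apply _ _ _ _).trans ?_)
  rw [one_smul, clampCube_cubeMap]

theorem exists_cls_eq {m : ℕ} {b : S m} (σ : π_ m (S m) b) :
    ∃ (f : E m → E (m + 1)) (hf : IsContMap b f), cls hf = σ := by
  induction σ using Quotient.inductionOn with
  | h γ => exact ⟨_, isContMap_ofLoop γ, cls_ofLoop γ⟩

theorem continuousRep_cls {m : ℕ} {b : S m} {f : E m → E (m + 1)} (hf : IsContMap b f)
    (h : ∀ x ∉ B m, f x = b) : ContinuousRep (cls hf) f := by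
  have h1 : BaseOff b 1 f := baseOff_of_norm fun x hx => h x (by simpa using hx)
  refine ⟨toLoop hf 1 one_pos h1, (cls_eq hf one_pos h1).symm, fun t => ?_⟩
  rw [toLoop_apply, one_smul, extendBy]
  split_ifs with hx
  · rfl
  · exact h _ hx

/-- The loop determines the extension on the cube, and outside the cube both the clamped loop and
the extension equal `b`. Continuity and unit norm on all of `ℝ^m` are then inherited from the loop.
-/
theorem ContinuousRep.exists_cls {m : ℕ} {b : S m} {σ : π_ m (S m) b} {g : E m → E (m + 1)}
    (h : ContinuousRep σ g) : ∃ hf : IsContMap b (extendBy b g), cls hf = σ := by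
  obtain ⟨γ, hγ, hg⟩ := h
  have h1 : (fun x => (γ (clampCube x) : E (m + 1))) = extendBy b g := by
    ext1 x
    by_cases hx : ∃ i, 1 ≤ |x i|
    · obtain ⟨i, hi⟩ := hx
      rw [GenLoop.boundary γ _ (clampCube_boundary hi), extendBy, if_neg]
      simpa using hi.trans (abs_apply_le_norm x i)
    · push Not at hx
      rw [hg, cubeMap_clampCube fun i => (hx i).le]
  rw [← h1]
  exact ⟨isContMap_ofLoop γ, (cls_ofLoop γ).trans hγ⟩

theorem cls_congr {m : ℕ} {b : S m} {f g : E m → E (m + 1)} (hf : IsContMap b f)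
    (hg : IsContMap b g) (h : ∀ x, f x = g x) : cls hf = cls hg := by
  obtain rfl : f = g := funext h
  rfl

/-! ### The group structure -/

theorem cls_const {m : ℕ} [Nontrivial (Fin m)] (b : S m) : cls (isContMap_const b) = 1 := by
  rw [cls_eq _ one_pos fun x _ => rfl]
  rfl

theorem cls_reflect {m : ℕ} [Nontrivial (Fin m)] {b : S m} {f g : E m → E (m + 1)}
    (hf : IsContMap b f) (hg : IsContMap b g) (i : Fin m)
    (h : ∀ x, g x = f (x - (2 * x i) • EuclideanSpace.single i 1)) : cls hg = (cls hf)⁻¹ := by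
  obtain ⟨R, hR, hfR⟩ := hf.exists_baseOff
  obtain ⟨R', hR', hgR⟩ := hg.exists_baseOff
  have hm : 0 < max R R' := lt_max_of_lt_left hR
  have hfm := hfR.mono (le_max_left R R')
  have hgm := hgR.mono (le_max_right R R')
  rw [cls_eq hf hm hfm, cls_eq hg hm hgm]
  refine Eq.trans ?_ (HomotopyGroup.inv_spec (i := i)).symm
  congr 1
  refine GenLoop.ext _ _ fun t => Subtype.ext ?_
  change _ = ((toLoop hf (max R R') hm hfm fun j => if j = i then unitInterval.symm (t i) else t j :
    S m) : E (m + 1))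
  rw [toLoop_apply, toLoop_apply, h]
  congr 1
  ext j
  by_cases hj : j = i
  · subst hj; simp [cubeMap_apply]; ring
  · simp [cubeMap_apply, hj]

theorem cls_mul {m : ℕ} [Nontrivial (Fin m)] {b : S m} {f f₁ f₂ : E m → E (m + 1)}
    (hf : IsContMap b f) (hf₁ : IsContMap b f₁) (hf₂ : IsContMap b f₂) (i : Fin m) (a : ℝ)
    (h₁ : ∀ x, a ≤ x i → f₁ x = b) (h₂ : ∀ x, x i ≤ a → f₂ x = b)
    (h : ∀ x, f x = f₁ x + f₂ x - b) : cls hf = cls hf₁ * cls hf₂ := by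
  obtain ⟨R, hR, hfR⟩ := hf.exists_baseOff
  obtain ⟨R₁, hR₁, hfR₁⟩ := hf₁.exists_baseOff
  obtain ⟨R₂, hR₂, hfR₂⟩ := hf₂.exists_baseOff
  obtain ⟨M, hM0, hfM, hfM₁, hfM₂⟩ :
      ∃ M, 0 < M ∧ BaseOff b M f ∧ BaseOff b M f₁ ∧ BaseOff b M f₂ :=
    ⟨max R (max R₁ R₂), lt_max_of_lt_left hR, hfR.mono (le_max_left R (max R₁ R₂)),
      hfR₁.mono ((le_max_left R₁ R₂).trans (le_max_right R _)),
      hfR₂.mono ((le_max_right R₁ R₂).trans (le_max_right R _))⟩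
  -- `HomotopyGroup.mul_spec` lists the factors in the order opposite to the concatenation; the
  -- group is commutative.
  rw [mul_comm, cls_eq hf hM0 hfM, cls_eq hf₁ hM0 hfM₁, cls_eq hf₂ hM0 hfM₂]
  refine Eq.trans ?_ (HomotopyGroup.mul_spec (i := i)).symm
  set γ := GenLoop.transAt i (toLoop hf₁ M hM0 hfM₁) (toLoop hf₂ M hM0 hfM₂) with hγ
  set e : E m := EuclideanSpace.single i 1 with he
  -- At time `s` the `i`-th coordinate `x` becomes `x + s (x + M)` in `f₁` and `x + s (x - M)` in
  -- `f₂`; at `s = 1` these stretch each half of the cube onto the whole cube. The argument of `f₁`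
  -- is never below that of `f₂`, so one of the two values is always `b` and `H` stays on the
  -- sphere.
  set H : unitInterval × (Fin m → unitInterval) → E (m + 1) := fun p =>
    f₁ (M • cubeMap p.2 + ((p.1 : ℝ) * (M * cubeMap p.2 i + M)) • e) +
    f₂ (M • cubeMap p.2 + ((p.1 : ℝ) * (M * cubeMap p.2 i - M)) • e) - b with hH
  have hcube : ∀ t : Fin m → unitInterval, -1 ≤ cubeMap t i ∧ cubeMap t i ≤ 1 := fun t => by
    have := (t i).2.1; have := (t i).2.2
    rw [cubeMap_apply]; constructor <;> linarith
  have hHc : Continuous H := by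
    have h3 : Continuous fun p : unitInterval × (Fin m → unitInterval) => cubeMap p.2 :=
      continuous_cubeMap.comp continuous_snd
    have h4 : Continuous fun p : unitInterval × (Fin m → unitInterval) => cubeMap p.2 i := by
      simp only [cubeMap_apply]; fun_prop
    have h6 : Continuous fun p : unitInterval × (Fin m → unitInterval) => (p.1 : ℝ) := by fun_prop
    have h7 : ∀ c : ℝ, Continuous fun p : unitInterval × (Fin m → unitInterval) =>
        M • cubeMap p.2 + ((p.1 : ℝ) * (M * cubeMap p.2 i + c)) • e := fun c =>
      (h3.const_smul M).add
        ((h6.mul ((continuous_const.mul h4).add continuous_const)).smul continuous_const)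
    exact ((hf₁.continuous.comp (h7 M)).add (hf₂.continuous.comp (h7 (-M)))).sub continuous_const
  have hHn : ∀ p, ‖H p‖ = 1 := by
    rintro ⟨s, t⟩
    have hs := s.2.1
    simp only [hH]
    by_cases hc : a ≤ (M • cubeMap t + ((s : ℝ) * (M * cubeMap t i + M)) • e) i
    · rw [h₁ _ hc, add_sub_cancel_left, hf₂.norm_eq_one]
    · rw [h₂, add_sub_cancel_right, hf₁.norm_eq_one]
      simp [he] at hc ⊢
      nlinarith [mul_nonneg hs hM0.le]
  have hHb : ∀ s t, t ∈ Cube.boundary (Fin m) → H (s, t) = b := by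
    rintro s t ⟨j, hj⟩
    have hs := s.2.1
    have hj' := abs_cubeMap_of_boundary hj
    have e1 : f₁ (M • cubeMap t + ((s : ℝ) * (M * cubeMap t i + M)) • e) = b := by
      refine hfM₁ _ ⟨j, ?_⟩
      by_cases hji : j = i
      · subst hji
        simp only [he, PiLp.add_apply, PiLp.smul_apply, PiLp.single_apply, if_true, smul_eq_mul,
          mul_one]
        rcases (abs_eq zero_le_one).1 hj' with h' | h' <;> rw [h']
        · refine le_trans ?_ (le_abs_self _); nlinarith [mul_nonneg hs hM0.le]
        · refine le_trans ?_ (neg_le_abs _); nlinarith [mul_nonneg hs hM0.le]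
      · simp [he, hji, abs_mul, hj', abs_of_pos hM0]
    have e2 : f₂ (M • cubeMap t + ((s : ℝ) * (M * cubeMap t i - M)) • e) = b := by
      refine hfM₂ _ ⟨j, ?_⟩
      by_cases hji : j = i
      · subst hji
        simp only [he, PiLp.add_apply, PiLp.smul_apply, PiLp.single_apply, if_true, smul_eq_mul,
          mul_one]
        rcases (abs_eq zero_le_one).1 hj' with h' | h' <;> rw [h']
        · refine le_trans ?_ (le_abs_self _); nlinarith [mul_nonneg hs hM0.le]
        · refine le_trans ?_ (neg_le_abs _); nlinarith [mul_nonneg hs hM0.le]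
      · simp [he, hji, abs_mul, hj', abs_of_pos hM0]
    simp only [hH]
    rw [e1, e2, add_sub_cancel_right]
  refine mk_eq_of_homotopy hHc hHn hHb ?_ ?_
  · intro t
    rw [toLoop_apply]
    simp [hH, h]
  · intro t
    change H (1, t) = ((if (t i : ℝ) ≤ 1 / 2
      then toLoop hf₁ M hM0 hfM₁ (Function.update t i <| Set.projIcc 0 1 zero_le_one (2 * t i))
      else toLoop hf₂ M hM0 hfM₂ (Function.update t i <|
        Set.projIcc 0 1 zero_le_one (2 * t i - 1)) : S m) : E (m + 1))
    have ht0 := (t i).2.1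
    have ht1 := (t i).2.2
    simp only [hH]
    split_ifs with hti
    · rw [toLoop_apply, hfM₂ _ ⟨i, ?_⟩, add_sub_cancel_right]
      · congr 1
        ext j
        by_cases hj : j = i
        · subst hj
          have : ((Set.projIcc (0 : ℝ) 1 zero_le_one (2 * t j) : unitInterval) : ℝ) = 2 * t j := by
            rw [Set.projIcc_of_mem _ ⟨by linarith, by linarith⟩]
          simp [he, cubeMap_apply, this]; ring
        · simp [he, cubeMap_apply, hj]
      · simp only [he, PiLp.add_apply, PiLp.smul_apply, PiLp.single_apply, if_true, smul_eq_mul,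
          mul_one, cubeMap_apply, Set.Icc.coe_one, one_mul]
        refine le_trans ?_ (neg_le_abs _); nlinarith
    · rw [toLoop_apply, hfM₁ _ ⟨i, ?_⟩, add_sub_cancel_left]
      · congr 1
        ext j
        by_cases hj : j = i
        · subst hj
          have : ((Set.projIcc (0 : ℝ) 1 zero_le_one (2 * t j - 1) : unitInterval) : ℝ)
              = 2 * t j - 1 := by
            rw [Set.projIcc_of_mem _ ⟨by linarith, by linarith⟩]
          simp [he, cubeMap_apply, this]; ring
        · simp [he, cubeMap_apply, hj]
      · simp only [he, PiLp.add_apply, PiLp.smul_apply, PiLp.single_apply, if_true, smul_eq_mul,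
          mul_one, cubeMap_apply, Set.Icc.coe_one, one_mul]
        refine le_trans ?_ (le_abs_self _); nlinarith

/-! ### Smooth representatives -/

theorem IsSmoothMap.isContMap {m : ℕ} {b : S m} {f : E m → E (m + 1)}
    (h : IsSmoothMap (b : E (m + 1)) f) : IsContMap b f :=
  ⟨h.contDiff.continuous, h.norm_eq_one, h.eq_base⟩

theorem ne_neg_of_dist_lt {F : Type*} [NormedAddCommGroup F] [NormedSpace ℝ F] {p q : F}
    (hq : ‖q‖ = 1) (h : dist p q < 2) : p ≠ -q := by
  rintro rfl
  rw [dist_eq_norm, show -q - q = (-2 : ℝ) • q by rw [neg_smul, two_smul]; abel, norm_smul, hq] at h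
  norm_num at h

theorem dist_normalize_le {F : Type*} [NormedAddCommGroup F] [NormedSpace ℝ F] {v p : F}
    (hp : ‖p‖ = 1) (hv : v ≠ 0) : dist (normalize v) p ≤ 2 * dist v p := by
  have h1 : dist (normalize v) v ≤ dist v p := by
    have h0 : 0 < ‖v‖ := norm_pos_iff.2 hv
    rw [dist_eq_norm, normalize, show ‖v‖⁻¹ • v - v = (‖v‖⁻¹ - 1) • v by rw [sub_smul, one_smul],
      norm_smul, Real.norm_eq_abs, ← abs_of_pos h0, ← abs_mul, abs_of_pos h0, sub_mul,
      inv_mul_cancel₀ h0.ne', one_mul, ← hp, dist_eq_norm, abs_sub_comm]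
    exact abs_norm_sub_norm_le _ _
  calc _ ≤ dist (normalize v) v + dist v p := dist_triangle _ _ _
    _ ≤ _ := by linarith

theorem IsContMap.uniformContinuous {m : ℕ} {b : S m} {f : E m → E (m + 1)}
    (hf : IsContMap b f) : UniformContinuous f := by
  obtain ⟨R, hR⟩ := hf.eq_base
  have h1 : HasCompactSupport fun x => f x - b :=
    hasCompactSupport_of_forall_norm fun x hx => by rw [hR x hx, sub_self]
  have h2 := Continuous.uniformContinuous_of_tendsto_cocompact (f := fun x => f x - b)
    (hf.continuous.sub continuous_const) h1.is_zero_at_infty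
  simpa using h2.add_const (b : E (m + 1))

theorem IsContMap.exists_smooth {m : ℕ} {b : S m} {f : E m → E (m + 1)} (hf : IsContMap b f)
    {R : ℝ} (hR : ∀ x, R ≤ ‖x‖ → f x = b) {ε δ : ℝ} (hε : 0 < ε) (hδ : 0 < δ) :
    ∃ g, IsSmoothMap (b : E (m + 1)) g ∧ (∀ x, R + δ ≤ ‖x‖ → g x = b) ∧
      ∀ x, dist (g x) (f x) < ε := by
  -- The bound `1 / 2` keeps the approximation away from the origin; `ε / 3` allows for the radial
  -- projection, which at most doubles the distance.
  set ε' := min (ε / 3) (1 / 2)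
  have hε' : 0 < ε' := by positivity
  obtain ⟨δ', hδ', hu⟩ := Metric.uniformContinuous_iff.1 hf.uniformContinuous ε' hε'
  obtain ⟨g, hg, hgd⟩ := hf.continuous.exists_contDiff_dist_le_of_forall_mem_ball_dist_le
    (lt_min hδ hδ')
  have h1 : ∀ x, dist (g x) (f x) ≤ ε' := fun x => hgd x ε' fun y hy =>
    (hu (lt_of_lt_of_le hy (min_le_right _ _))).le
  have h0 : ∀ x, g x ≠ 0 := fun x hx => by
    have := h1 x
    rw [hx, dist_zero_left, hf.norm_eq_one] at this
    have := min_le_right (ε / 3) (1 / 2 : ℝ)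
    linarith
  have hb : ∀ x, R + δ ≤ ‖x‖ → normalize (g x) = b := by
    intro x hx
    -- Where `f` is constant on the whole averaging ball the smoothing is exact, so the error bound
    -- holds with `0`.
    have h2 : dist (g x) (f x) ≤ 0 := hgd x 0 fun y hy => by
      have hy' : dist y x < δ := lt_of_lt_of_le hy (min_le_left _ _)
      have : R ≤ ‖y‖ := by
        have := norm_sub_norm_le x y
        rw [← dist_eq_norm, dist_comm] at this
        linarith
      rw [hR y this, hR x (by linarith), dist_self]
    rw [dist_le_zero.1 h2, hR x (by linarith), normalize_of_norm (norm_base b)]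
  refine ⟨fun x => normalize (g x), ⟨contDiff_normalize hg h0, fun x => norm_normalize (h0 x),
    _, hb⟩, hb, fun x => ?_⟩
  calc _ ≤ 2 * dist (g x) (f x) := dist_normalize_le (hf.norm_eq_one x) (h0 x)
    _ ≤ 2 * (ε / 3) := by gcongr; exact (h1 x).trans (min_le_left _ _)
    _ < ε := by linarith

/-- The degree integral depends only on the homotopy class. -/
theorem degInt_eq_of_cls_eq {m : ℕ} (hm : 2 ≤ m) {b : S m} {f g : E m → E (m + 1)}
    (hf : IsSmoothMap (b : E (m + 1)) f) (hg : IsSmoothMap (b : E (m + 1)) g)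
    (h : cls hf.isContMap = cls hg.isContMap) : degInt f = degInt g := by
  obtain ⟨R, hR, hfR, hgR⟩ : ∃ R, 0 < R ∧ BaseOff b R f ∧ BaseOff b R g := by
    obtain ⟨R, hR, h1⟩ := hf.isContMap.exists_baseOff
    obtain ⟨R', hR', h2⟩ := hg.isContMap.exists_baseOff
    exact ⟨max R R', lt_max_of_lt_left hR, h1.mono (le_max_left _ _), h2.mono (le_max_right _ _)⟩
  rw [cls_eq _ hR hfR, cls_eq _ hR hgR] at h
  obtain ⟨H⟩ : GenLoop.Homotopic _ _ := Quotient.exact h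
  set hh : unitInterval → E m → E (m + 1) := fun s x => (H (s, clampCube (R⁻¹ • x)) : S m) with hhdef
  have hback : ∀ {u : E m → E (m + 1)} (hu : IsContMap b u) (huR : BaseOff b R u) (x : E m),
      (toLoop hu R hR huR (clampCube (R⁻¹ • x)) : E (m + 1)) = u x := by
    intro u hu huR x
    by_cases hx : ∃ i, R ≤ |x i|
    · obtain ⟨i, hi⟩ := hx
      rw [huR x ⟨i, hi⟩, GenLoop.boundary (toLoop hu R hR huR) _ (clampCube_boundary (i := i) _)]
      rw [PiLp.smul_apply, smul_eq_mul, abs_mul, abs_inv, abs_of_pos hR, inv_mul_eq_div,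
        le_div_iff₀ hR, one_mul]
      exact hi
    · push Not at hx
      rw [toLoop_apply, cubeMap_clampCube, smul_smul, mul_inv_cancel₀ hR.ne', one_smul]
      intro i
      rw [PiLp.smul_apply, smul_eq_mul, abs_mul, abs_inv, abs_of_pos hR, inv_mul_eq_div,
        div_le_iff₀ hR, one_mul]
      exact (hx i).le
  have h0 : hh 0 = f := by
    ext1 x
    refine Eq.trans (congrArg Subtype.val (H.apply_zero _)) (hback hf.isContMap hfR x)
  have h1 : hh 1 = g := by
    ext1 x
    refine Eq.trans (congrArg Subtype.val (H.apply_one _)) (hback hg.isContMap hgR x)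
  have hcont : ∀ s, IsContMap b (hh s) := by
    intro s
    refine ⟨continuous_subtype_val.comp (H.continuous.comp (continuous_const.prodMk
      (continuous_clampCube.comp (continuous_const_smul R⁻¹)))), fun x => norm_base _,
      R * (m + 1), fun x hx => ?_⟩
    have : (m : ℝ) + 1 ≤ ‖R⁻¹ • x‖ := by
      rw [norm_smul, norm_inv, Real.norm_of_nonneg hR.le, inv_mul_eq_div, le_div_iff₀ hR]
      linarith
    obtain ⟨i, hi⟩ := exists_coord_of_norm this
    have hmem := clampCube_boundary hi
    simp only [hhdef]
    rw [H.eq_fst s hmem]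
    exact congrArg Subtype.val (GenLoop.boundary (toLoop hf.isContMap R hR hfR) _ hmem)
  -- Each time slice is smoothed separately, with no continuity in `s`. For nearby times two such
  -- approximations differ by less than `3 / 2 < 2`, hence are never antipodal, so their degree
  -- integrals agree and `s ↦ degInt (A s)` is locally constant.
  have happ : ∀ s, ∃ A, IsSmoothMap (b : E (m + 1)) A ∧ ∀ x, dist (A x) (hh s x) < 1 / 2 := by
    intro s
    obtain ⟨R', hR'⟩ := (hcont s).eq_base
    obtain ⟨A, hA, -, hd⟩ := (hcont s).exists_smooth hR' (ε := 1 / 2) (by norm_num) one_pos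
    exact ⟨A, hA, hd⟩
  choose A hA hAd using happ
  have hclose : ∀ {u v : E m → E (m + 1)}, IsSmoothMap (b : E (m + 1)) u →
      IsSmoothMap (b : E (m + 1)) v → (∀ x, dist (u x) (v x) < 2) → degInt u = degInt v :=
    fun hu hv huv => degInt_eq_of_ne_neg hm hu hv fun x =>
      ne_neg_of_dist_lt (hv.norm_eq_one x) (huv x)
  have hloc : IsLocallyConstant fun s => degInt (A s) := by
    rw [IsLocallyConstant.iff_eventually_eq]
    intro s
    have hc := H.curry.continuous.tendsto s
    filter_upwards [hc.eventually (Metric.ball_mem_nhds _ (by norm_num : (0 : ℝ) < 1 / 2))] with s' hs'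
    refine hclose (hA s') (hA s) fun x => ?_
    have h3 : dist (hh s' x) (hh s x) < 1 / 2 :=
      (ContinuousMap.dist_lt_iff (by norm_num)).1 hs' (clampCube (R⁻¹ • x))
    have h4 := hAd s' x
    have h5 := hAd s x
    have h6 := dist_triangle4 (A s' x) (hh s' x) (hh s x) (A s x)
    rw [dist_comm (hh s x)] at h6
    linarith
  have h01 : degInt (A 0) = degInt (A 1) := hloc.apply_eq_of_preconnectedSpace 0 1
  have e0 : degInt (A 0) = degInt f := hclose (hA 0) hf fun x => by
    have := hAd 0 x; rw [h0] at this; linarith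
  have e1 : degInt (A 1) = degInt g := hclose (hA 1) hg fun x => by
    have := hAd 1 x; rw [h1] at this; linarith
  rw [← e0, h01, e1]

theorem cls_comp_smul {m : ℕ} {b : S m} {f g : E m → E (m + 1)} (hf : IsContMap b f)
    (hg : IsContMap b g) {L : ℝ} (hL : 0 < L) (h : ∀ x, g x = f (L • x)) : cls hg = cls hf := by
  obtain ⟨R, hR, hfR⟩ := hf.exists_baseOff
  have hgR : BaseOff b (R / L) g := fun x ⟨i, hi⟩ => by
    rw [h]
    refine hfR _ ⟨i, ?_⟩
    rw [PiLp.smul_apply, smul_eq_mul, abs_mul, abs_of_pos hL]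
    rwa [div_le_iff₀' hL] at hi
  rw [cls_eq hf hR hfR, cls_eq hg (div_pos hR hL) hgR]
  congr 1
  refine GenLoop.ext _ _ fun t => Subtype.ext ?_
  rw [toLoop_apply, toLoop_apply, h, smul_smul, mul_div_cancel₀ _ hL.ne']

/-- Every homotopy class has a smooth representative supported in a small ball. -/
theorem exists_smooth_rep {m : ℕ} {b : S m} (σ : π_ m (S m) b) {r : ℝ} (hr : 0 < r) :
    ∃ (f : E m → E (m + 1)) (hf : IsSmoothMap (b : E (m + 1)) f),
      (∀ x, r ≤ ‖x‖ → f x = b) ∧ cls hf.isContMap = σ := by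
  obtain ⟨f, hf, rfl⟩ := exists_cls_eq σ
  obtain ⟨R, hR⟩ := hf.eq_base
  set M := max R 1
  have hM : 0 < M := by positivity
  -- This dilation confines the nonconstant part to radius `r / 2`, leaving room `r / 2` for the
  -- smoothing.
  have hL : 0 < 2 * M / r := by positivity
  have hb : ∀ x : E m, r / 2 ≤ ‖x‖ → f ((2 * M / r) • x) = b := fun x hx => by
    refine hR _ ((le_max_left R 1).trans ?_)
    rw [norm_smul, Real.norm_of_nonneg hL.le, div_mul_eq_mul_div, le_div_iff₀ hr]
    nlinarith
  have hg : IsContMap b fun x => f ((2 * M / r) • x) :=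
    ⟨hf.continuous.comp (continuous_const_smul _), fun x => hf.norm_eq_one _, _, hb⟩
  obtain ⟨g, hgs, hgb, hgd⟩ := hg.exists_smooth hb (ε := 2) (by norm_num) (half_pos hr)
  refine ⟨g, hgs, fun x hx => hgb x (by linarith), ?_⟩
  rw [← cls_comp_smul hf hg hL fun x => rfl]
  exact cls_eq_of_ne_neg _ _ fun x => ne_neg_of_dist_lt (hg.norm_eq_one x) (hgd x)

/-! ### Linear changes of variables -/

/-- The linear map of `ℝ^m` given by a matrix. -/
def linMap {m : ℕ} (M : Matrix (Fin m) (Fin m) ℝ) (x : E m) : E m :=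
  WithLp.toLp 2 (M.mulVec x.ofLp)

theorem linMap_mul {m : ℕ} (M N : Matrix (Fin m) (Fin m) ℝ) (x : E m) :
    linMap (M * N) x = linMap M (linMap N x) := by
  simp [linMap, Matrix.mulVec_mulVec]

theorem linMap_one {m : ℕ} (x : E m) : linMap 1 x = x := by
  simp [linMap]

theorem linMap_smul {m : ℕ} (M : Matrix (Fin m) (Fin m) ℝ) (r : ℝ) (x : E m) :
    linMap M (r • x) = r • linMap M x := by
  simp [linMap, Matrix.mulVec_smul]

theorem continuous_linMap_comp {X : Type*} [TopologicalSpace X] {m : ℕ}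
    {M : X → Matrix (Fin m) (Fin m) ℝ} {x : X → E m} (hM : Continuous M) (hx : Continuous x) :
    Continuous fun p => linMap (M p) (x p) :=
  (PiLp.continuous_toLp 2 _).comp
    (hM.matrix_mulVec ((PiLp.continuous_ofLp 2 _).comp hx))

theorem linMap_ne_zero {m : ℕ} {M : Matrix (Fin m) (Fin m) ℝ} (hM : M.det ≠ 0) {x : E m}
    (hx : x ≠ 0) : linMap M x ≠ 0 := by
  intro h
  apply hx
  have : M.mulVec x.ofLp = 0 := by
    have := congrArg WithLp.ofLp h
    simpa [linMap] using this
  have := Matrix.eq_zero_of_mulVec_eq_zero hM this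
  ext i
  simpa using congrFun this i

/-- A uniform lower bound for a continuous path of invertible matrices. -/
theorem exists_mul_norm_le_linMap {m : ℕ} {M : unitInterval → Matrix (Fin m) (Fin m) ℝ}
    (hM : Continuous M) (h : ∀ s, (M s).det ≠ 0) :
    ∃ c > 0, ∀ s x, c * ‖x‖ ≤ ‖linMap (M s) x‖ := by
  rcases Set.eq_empty_or_nonempty (sphere (0 : E m) 1) with hs | hs
  · refine ⟨1, one_pos, fun s x => ?_⟩
    rcases eq_or_ne x 0 with rfl | hx
    · simp
    · exfalso
      have : ‖x‖⁻¹ • x ∈ sphere (0 : E m) 1 := by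
        simp [norm_smul, norm_ne_zero_iff.2 hx]
      rw [hs] at this
      exact this
  · obtain ⟨p, hp, hmin⟩ := (isCompact_univ.prod (isCompact_sphere (0 : E m) 1)).exists_isMinOn
      ((Set.univ_nonempty (α := unitInterval)).prod hs)
      (f := fun p : unitInterval × E m => ‖linMap (M p.1) p.2‖)
      (continuous_linMap_comp (hM.comp continuous_fst) continuous_snd).norm.continuousOn
    have hp2 : p.2 ≠ 0 := ne_of_mem_sphere hp.2 one_ne_zero
    refine ⟨_, norm_pos_iff.2 (linMap_ne_zero (h p.1) hp2), fun s x => ?_⟩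
    rcases eq_or_ne x 0 with rfl | hx
    · simp
    · have hx' := norm_pos_iff.2 hx
      have := hmin (show (s, ‖x‖⁻¹ • x) ∈ Set.univ ×ˢ sphere (0 : E m) 1 from
        ⟨trivial, by simp [norm_smul, hx'.ne']⟩)
      simp only [Set.mem_ofPred_eq, linMap_smul, norm_smul, norm_inv, norm_norm] at this
      rwa [← div_eq_inv_mul, le_div_iff₀ hx'] at this

theorem IsContMap.comp_linMap {m : ℕ} {b : S m} {f : E m → E (m + 1)} (hf : IsContMap b f)
    {M : Matrix (Fin m) (Fin m) ℝ} (hM : M.det ≠ 0) : IsContMap b fun x => f (linMap M x) := by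
  obtain ⟨c, hc, h⟩ := exists_mul_norm_le_linMap (M := fun _ => M) continuous_const fun _ => hM
  obtain ⟨R, hR⟩ := hf.eq_base
  refine ⟨hf.continuous.comp (continuous_linMap_comp continuous_const continuous_id),
    fun x => hf.norm_eq_one _, R / c, fun x hx => hR _ (le_trans ?_ (h 0 x))⟩
  rwa [div_le_iff₀ hc, mul_comm] at hx

theorem cls_comp_linMap_path {m : ℕ} {b : S m} {f : E m → E (m + 1)} (hf : IsContMap b f)
    {M : unitInterval → Matrix (Fin m) (Fin m) ℝ} (hM : Continuous M) (h : ∀ s, (M s).det ≠ 0) :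
    cls (hf.comp_linMap (h 0)) = cls (hf.comp_linMap (h 1)) := by
  obtain ⟨c, hc, h'⟩ := exists_mul_norm_le_linMap hM h
  obtain ⟨R, hR⟩ := hf.eq_base
  refine cls_homotopy _ _ (H := fun p => f (linMap (M p.1) p.2)) (R := R / c)
    (hf.continuous.comp (continuous_linMap_comp (hM.comp continuous_fst) continuous_snd))
    (fun p => hf.norm_eq_one _) (fun s x hx => hR _ (le_trans ?_ (h' s x)))
    (fun _ => rfl) (fun _ => rfl)
  rwa [div_le_iff₀ hc, mul_comm] at hx

theorem cls_comp_sub {m : ℕ} {b : S m} {f g : E m → E (m + 1)} (hf : IsContMap b f)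
    (hg : IsContMap b g) (c : E m) (h : ∀ x, g x = f (x - c)) : cls hg = cls hf := by
  obtain ⟨R, hR⟩ := hf.eq_base
  symm
  refine cls_homotopy hf hg (H := fun p => f (p.2 - (p.1 : ℝ) • c)) (R := R + ‖c‖)
    (hf.continuous.comp (by fun_prop)) (fun p => hf.norm_eq_one _) (fun s x hx => hR _ ?_)
    (fun x => by simp) (fun x => by simp [h])
  have h1 : ‖(s : ℝ) • c‖ ≤ ‖c‖ := by
    rw [norm_smul, Real.norm_of_nonneg s.2.1]
    exact mul_le_of_le_one_left (norm_nonneg _) s.2.2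
  have := norm_sub_norm_le x ((s : ℝ) • c)
  linarith

/-- The factor `a` can be moved to `1` or `-1`, according to its sign, without crossing zero. The
first leaves the class unchanged, the second is a reflection and inverts it. -/
theorem cls_comp_linMap_coord {m : ℕ} [Nontrivial (Fin m)] {b : S m} {f : E m → E (m + 1)}
    (hf : IsContMap b f) (i : Fin m) {a : ℝ} (ha : a ≠ 0)
    (hg : IsContMap b fun x => f (linMap (Matrix.diagonal (Function.update 1 i a)) x)) :
    cls hg ∈ Subgroup.zpowers (cls hf) := by
  have hdet : ∀ r : ℝ, r ≠ 0 → (Matrix.diagonal (Function.update (1 : Fin m → ℝ) i r)).det ≠ 0 := by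
    intro r hr
    rw [Matrix.det_diagonal, Finset.prod_ne_zero_iff]
    intro j _
    by_cases hj : j = i
    · subst hj; simpa using hr
    · simp [hj]
  have key : ∀ r : ℝ, 0 < r * a → ∀ hr : r ≠ 0, cls hg = cls (hf.comp_linMap (hdet r hr)) := by
    intro r hra hr
    have hne : ∀ s : unitInterval, (1 - (s : ℝ)) * a + s * r ≠ 0 := by
      intro s h0
      have h1 := s.2.1
      have h2 := s.2.2
      have : (1 - (s : ℝ)) * (a * a) + s * (r * a) = 0 := by linear_combination a * h0
      have h3 : 0 < a * a := mul_self_pos.2 ha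
      rcases eq_or_lt_of_le h1 with h4 | h4
      · rw [← h4] at this; linarith
      · nlinarith [mul_pos h4 hra, mul_nonneg (sub_nonneg.2 h2) h3.le]
    have := cls_comp_linMap_path hf
      (M := fun s : unitInterval =>
        Matrix.diagonal (Function.update (1 : Fin m → ℝ) i ((1 - (s : ℝ)) * a + s * r)))
      (Continuous.matrix_diagonal (continuous_const.update i (by fun_prop)))
      (fun s => hdet _ (hne s))
    refine (cls_congr _ _ fun x => ?_).trans (this.trans (cls_congr _ _ fun x => ?_))
    · simp
    · simp
  rcases lt_or_gt_of_ne ha with h | h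
  · have e : cls (hf.comp_linMap (hdet (-1) (by norm_num))) = (cls hf)⁻¹ := by
      refine cls_reflect hf _ i fun x => ?_
      congr 1
      ext j
      by_cases hj : j = i
      · subst hj
        simp [linMap, Matrix.mulVec_diagonal]
        ring
      · simp [linMap, Matrix.mulVec_diagonal, hj]
    rw [key (-1) (by linarith) (by norm_num), e]
    exact (Subgroup.zpowers _).inv_mem (Subgroup.mem_zpowers _)
  · have e : cls (hf.comp_linMap (hdet 1 one_ne_zero)) = cls hf := by
      refine cls_congr _ _ fun x => ?_
      have : Function.update (1 : Fin m → ℝ) i 1 = 1 := Function.update_eq_self i 1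
      rw [this, show Matrix.diagonal (1 : Fin m → ℝ) = 1 from Matrix.diagonal_one, linMap_one]
    rw [key 1 (by linarith) one_ne_zero, e]
    exact Subgroup.mem_zpowers _

/-- An invertible linear change of variables maps a homotopy class to one of its powers. -/
theorem cls_comp_linMap_mem {m : ℕ} [Nontrivial (Fin m)] {b : S m}
    {M : Matrix (Fin m) (Fin m) ℝ} (hM : M.det ≠ 0) :
    ∀ (f : E m → E (m + 1)) (hf : IsContMap b f) (hg : IsContMap b fun x => f (linMap M x)),
      cls hg ∈ Subgroup.zpowers (cls hf) := by
  have hmul : ∀ A B : Matrix (Fin m) (Fin m) ℝ, A.det ≠ 0 →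
      (∀ (f : E m → E (m + 1)) (hf : IsContMap b f) (hg : IsContMap b fun x => f (linMap A x)),
        cls hg ∈ Subgroup.zpowers (cls hf)) →
      (∀ (f : E m → E (m + 1)) (hf : IsContMap b f) (hg : IsContMap b fun x => f (linMap B x)),
        cls hg ∈ Subgroup.zpowers (cls hf)) →
      (∀ (f : E m → E (m + 1)) (hf : IsContMap b f)
        (hg : IsContMap b fun x => f (linMap (A * B) x)),
        cls hg ∈ Subgroup.zpowers (cls hf)) := by
    intro A B hA h1 h2 f hf hg
    have hfA := hf.comp_linMap hA
    have h3 := h1 f hf hfA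
    have h4 := h2 _ hfA (by simpa only [linMap_mul] using hg)
    have h5 : Subgroup.zpowers (cls hfA) ≤ Subgroup.zpowers (cls hf) := by
      rwa [Subgroup.zpowers_le]
    exact (cls_congr hg _ fun x => by rw [linMap_mul]) ▸ h5 h4
  -- Invertible matrices are products of transvections and diagonal matrices, and `hmul` makes the
  -- property multiplicative. Diagonal matrices are treated one entry at a time; a transvection is
  -- joined to the identity by shrinking its coefficient, with determinant one throughout.
  refine Matrix.diagonal_transvection_induction_of_det_ne_zero
    (fun M => ∀ (f : E m → E (m + 1)) (hf : IsContMap b f)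
      (hg : IsContMap b fun x => f (linMap M x)), cls hg ∈ Subgroup.zpowers (cls hf)) M hM ?_ ?_
    (fun A B hA _ h1 h2 => hmul A B hA h1 h2)
  · intro D hD
    have hD' : ∀ i, D i ≠ 0 := by
      rw [Matrix.det_diagonal, Finset.prod_ne_zero_iff] at hD
      exact fun i => hD i (Finset.mem_univ i)
    classical
    have key : ∀ s : Finset (Fin m), ∀ (f : E m → E (m + 1)) (hf : IsContMap b f)
        (hg : IsContMap b fun x => f (linMap
          (Matrix.diagonal fun i => if i ∈ s then D i else 1) x)),
        cls hg ∈ Subgroup.zpowers (cls hf) := by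
      intro s
      induction s using Finset.induction_on with
      | empty =>
        intro f hf hg
        rw [cls_congr hg hf fun x => by simp [linMap_one]]
        exact Subgroup.mem_zpowers _
      | insert i s hi ih =>
        intro f hf hg
        have hprod : (Matrix.diagonal fun j => if j ∈ insert i s then D j else 1)
            = Matrix.diagonal (Function.update (1 : Fin m → ℝ) i (D i))
              * Matrix.diagonal fun j => if j ∈ s then D j else 1 := by
          rw [Matrix.diagonal_mul_diagonal]
          congr 1
          funext j
          by_cases hj : j = i
          · subst hj; simp [hi]
          · simp [hj]
        revert hg
        rw [hprod]
        intro hg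
        refine hmul (Matrix.diagonal (Function.update (1 : Fin m → ℝ) i (D i))) _ ?_
          (fun f hf hg => cls_comp_linMap_coord hf i (hD' i) hg) ih f hf hg
        rw [Matrix.det_diagonal, Finset.prod_ne_zero_iff]
        intro j _
        by_cases hj : j = i
        · subst hj; simpa using hD' j
        · simp [hj]
    have hu := key Finset.univ
    simp only [Finset.mem_univ, if_true] at hu
    exact hu
  · intro t f hf hg
    have h := cls_comp_linMap_path hf
      (M := fun s : unitInterval => Matrix.transvection t.i t.j ((s : ℝ) * t.c))
      (by
        unfold Matrix.transvection
        refine continuous_const.add (continuous_matrix fun k l => ?_)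
        simp only [Matrix.single_apply]
        split_ifs <;> fun_prop)
      (fun s => by rw [Matrix.det_transvection_of_ne _ _ t.hij]; exact one_ne_zero)
    have h1 : cls hf = cls hg :=
      (cls_congr _ _ fun x => by simp [linMap_one]).trans
        (h.trans (cls_congr _ _ fun x => by simp [Matrix.TransvectionStruct.toMatrix]))
    rw [← h1]
    exact Subgroup.mem_zpowers _

/-! ### Superposition of maps with disjoint supports -/

/-- The superposition of maps `ψ c`, `c ∈ t`, whose supports are disjoint. -/
def bubbleSum {m : ℕ} (b : S m) (t : Finset (E m)) (ψ : E m → E m → E (m + 1)) (x : E m) :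
    E (m + 1) :=
  b + ∑ c ∈ t, (ψ c x - b)

/-- The points of `t` are `2 r`-separated and `ψ c` is constant outside the ball of centre `c ∈ t`
and radius `r`. -/
structure IsSeparated {m : ℕ} (b : S m) (t : Finset (E m)) (r : ℝ) (ψ : E m → E m → E (m + 1)) :
    Prop where
  le_norm_sub : ∀ c ∈ t, ∀ c' ∈ t, c ≠ c' → 2 * r ≤ ‖c - c'‖
  eq_base : ∀ c ∈ t, ∀ x, r ≤ ‖x - c‖ → ψ c x = b

theorem bubbleSum_eq_base {m : ℕ} {b : S m} {t : Finset (E m)} {ψ : E m → E m → E (m + 1)} {x : E m}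
    (h : ∀ c ∈ t, ψ c x = b) : bubbleSum b t ψ x = b := by
  rw [bubbleSum, Finset.sum_eq_zero fun c hc => by rw [h c hc, sub_self], add_zero]

theorem IsSeparated.mono {m : ℕ} {b : S m} {t t' : Finset (E m)} {r : ℝ}
    {ψ : E m → E m → E (m + 1)} (h : IsSeparated b t r ψ) (ht : t' ⊆ t) : IsSeparated b t' r ψ :=
  ⟨fun c hc c' hc' => h.le_norm_sub c (ht hc) c' (ht hc'), fun c hc => h.eq_base c (ht hc)⟩

theorem IsSeparated.bubbleSum_eq {m : ℕ} {b : S m} {t : Finset (E m)} {r : ℝ}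
    {ψ : E m → E m → E (m + 1)} (h : IsSeparated b t r ψ) {c : E m} (hc : c ∈ t) {x : E m}
    (hx : ‖x - c‖ < r) : bubbleSum b t ψ x = ψ c x := by
  rw [bubbleSum, Finset.sum_eq_single_of_mem c hc, add_sub_cancel]
  intro c' hc' hne
  rw [h.eq_base c' hc' x, sub_self]
  have h1 := h.le_norm_sub c' hc' c hc hne
  have h2 : ‖c' - c‖ ≤ ‖x - c'‖ + ‖x - c‖ := by
    have := norm_sub_le (x - c) (x - c')
    rw [sub_sub_sub_cancel_left] at this
    linarith
  linarith

theorem IsSeparated.bubbleSum_cases {m : ℕ} {b : S m} {t : Finset (E m)} {r : ℝ}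
    {ψ : E m → E m → E (m + 1)} (h : IsSeparated b t r ψ) (x : E m) :
    ((∀ c ∈ t, r ≤ ‖x - c‖) ∧ bubbleSum b t ψ x = b) ∨
      ∃ c ∈ t, ‖x - c‖ < r ∧ bubbleSum b t ψ x = ψ c x := by
  by_cases hx : ∃ c ∈ t, ‖x - c‖ < r
  · obtain ⟨c, hc, hxc⟩ := hx
    exact Or.inr ⟨c, hc, hxc, h.bubbleSum_eq hc hxc⟩
  · push Not at hx
    exact Or.inl ⟨hx, bubbleSum_eq_base fun c hc => h.eq_base c hc x (hx c hc)⟩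

theorem exists_bound_bubbleSum {m : ℕ} {b : S m} {t : Finset (E m)} {ψ : E m → E m → E (m + 1)}
    (h : ∀ c ∈ t, ∃ R, ∀ x, R ≤ ‖x‖ → ψ c x = b) :
    ∃ R, ∀ x, R ≤ ‖x‖ → bubbleSum b t ψ x = b := by
  choose! R hR using h
  rcases t.eq_empty_or_nonempty with rfl | ht
  · exact ⟨0, fun x _ => by simp [bubbleSum]⟩
  · exact ⟨t.sup' ht R, fun x hx => bubbleSum_eq_base fun c hc =>
      hR c hc x ((Finset.le_sup' R hc).trans hx)⟩

theorem IsSeparated.isContMap {m : ℕ} {b : S m} {t : Finset (E m)} {r : ℝ}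
    {ψ : E m → E m → E (m + 1)} (h : IsSeparated b t r ψ) (hψ : ∀ c ∈ t, IsContMap b (ψ c)) :
    IsContMap b (bubbleSum b t ψ) := by
  refine ⟨?_, fun x => ?_, exists_bound_bubbleSum fun c hc => (hψ c hc).eq_base⟩
  · exact continuous_const.add
      (continuous_finsetSum _ fun c hc => (hψ c hc).continuous.sub continuous_const)
  · rcases h.bubbleSum_cases x with ⟨-, h'⟩ | ⟨c, hc, -, h'⟩ <;> rw [h']
    · exact norm_base b
    · exact (hψ c hc).norm_eq_one x

theorem IsSeparated.isSmoothMap {m : ℕ} {b : S m} {t : Finset (E m)} {r : ℝ}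
    {ψ : E m → E m → E (m + 1)} (h : IsSeparated b t r ψ)
    (hψ : ∀ c ∈ t, IsSmoothMap (b : E (m + 1)) (ψ c)) :
    IsSmoothMap (b : E (m + 1)) (bubbleSum b t ψ) := by
  have hc := h.isContMap fun c hc => (hψ c hc).isContMap
  exact ⟨contDiff_const.add
    (ContDiff.sum fun c hc => (hψ c hc).contDiff.sub contDiff_const), hc.norm_eq_one, hc.eq_base⟩

/-- By strong induction on the set of centres: if two centres differ in a coordinate `i`, a
hyperplane orthogonal to that axis splits the superposition into two smaller ones, and `cls_mul`
applies. The hypothesis `hsep` leaves room for the hyperplane between the supports. -/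
theorem cls_bubbleSum {m : ℕ} [Nontrivial (Fin m)] {b : S m} {r : ℝ}
    {ψ : E m → E m → E (m + 1)} {e : E m → π_ m (S m) b} (t : Finset (E m))
    (hsep : ∀ c ∈ t, ∀ c' ∈ t, ∀ i, c i ≠ c' i → 2 * r < |c i - c' i|)
    (h : IsSeparated b t r ψ) (hψ : ∀ c ∈ t, IsContMap b (ψ c))
    (he : ∀ c (hc : c ∈ t), cls (hψ c hc) = e c) (hf : IsContMap b (bubbleSum b t ψ)) :
    cls hf = ∏ c ∈ t, e c := by
  induction t using Finset.strongInduction with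
  | H t ih =>
    by_cases ht : ∃ c ∈ t, ∃ c' ∈ t, ∃ i, c i < c' i
    · obtain ⟨c, hc, c', hc', i, hi⟩ := ht
      have hs1 : t.filter (fun d => d i ≤ c i) ⊂ t :=
        Finset.filter_ssubset.2 ⟨c', hc', not_le.2 hi⟩
      have hs2 : t.filter (fun d => ¬ d i ≤ c i) ⊂ t :=
        Finset.filter_ssubset.2 ⟨c, hc, by simp⟩
      have key : ∀ s, s ⊂ t → ∀ hg : IsContMap b (bubbleSum b s ψ), cls hg = ∏ c ∈ s, e c :=
        fun s hs hg => ih s hs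
          (fun c hc c' hc' => hsep c (hs.1 hc) c' (hs.1 hc')) (h.mono hs.1)
          (fun c hc => hψ c (hs.1 hc)) (fun c hc => he c (hs.1 hc)) hg
      have hf1 := (h.mono hs1.1).isContMap fun c hc => hψ c (hs1.1 hc)
      have hf2 := (h.mono hs2.1).isContMap fun c hc => hψ c (hs2.1 hc)
      rw [← Finset.prod_filter_mul_prod_filter_not t (fun d => d i ≤ c i), ← key _ hs1 hf1,
        ← key _ hs2 hf2]
      have hle : ∀ x d : E m, |x i - d i| ≤ ‖x - d‖ := fun x d => by
        simpa using PiLp.norm_apply_le (x - d) i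
      -- Centres with coordinate at most `c i` have their supports below the level `c i + r`; the
      -- others have coordinate above `c i + 2 r`, so their supports are above it.
      refine cls_mul hf hf1 hf2 i (c i + r) (fun x hx => ?_) (fun x hx => ?_) (fun x => ?_)
      · refine bubbleSum_eq_base fun d hd => ?_
        rw [Finset.mem_filter] at hd
        refine h.eq_base d hd.1 x (le_trans ?_ (hle x d))
        exact le_trans (by linarith) (le_abs_self _)
      · refine bubbleSum_eq_base fun d hd => ?_
        rw [Finset.mem_filter, not_le] at hd
        refine h.eq_base d hd.1 x (le_trans ?_ (hle x d))
        have := hsep d hd.1 c hc i hd.2.ne'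
        rw [abs_of_pos (sub_pos.2 hd.2)] at this
        exact le_trans (by linarith) (neg_le_abs _)
      · simp only [bubbleSum]
        rw [← Finset.sum_filter_add_sum_filter_not t (fun d => d i ≤ c i)]
        abel
    · push Not at ht
      have hsub : ∀ c ∈ t, ∀ c' ∈ t, c = c' := fun c hc c' hc' => by
        ext i
        exact le_antisymm (ht c' hc' c hc i) (ht c hc c' hc' i)
      rcases t.eq_empty_or_nonempty with rfl | ⟨c, hc⟩
      · rw [Finset.prod_empty, ← cls_const b]
        exact cls_congr _ _ fun x => by simp [bubbleSum]
      · have : t = {c} := Finset.eq_singleton_iff_unique_mem.2 ⟨hc, fun d hd => hsub d hd c hc⟩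
        subst this
        rw [Finset.prod_singleton, ← he c hc]
        exact cls_congr _ _ fun x => by simp [bubbleSum]

/-! ### Bubbles -/

/-- `ι` identifies `ℝ^m` with the orthogonal complement of the unit vector `b`. -/
structure IsFrame {m : ℕ} (b : E (m + 1)) (ι : E m →ₗᵢ[ℝ] E (m + 1)) : Prop where
  norm_eq_one : ‖b‖ = 1
  inner_eq_zero : ∀ x, inner ℝ b (ι x) = 0

/-- The orthogonal projection to `ℝ^m`. -/
def proj {m : ℕ} (ι : E m →ₗᵢ[ℝ] E (m + 1)) : E (m + 1) →L[ℝ] E m :=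
  ContinuousLinearMap.adjoint ι.toContinuousLinearMap

theorem inner_proj {m : ℕ} (ι : E m →ₗᵢ[ℝ] E (m + 1)) (p : E (m + 1)) (x : E m) :
    inner ℝ (proj ι p) x = inner ℝ p (ι x) := by
  rw [proj, ContinuousLinearMap.adjoint_inner_left]
  rfl

theorem proj_apply_self {m : ℕ} (ι : E m →ₗᵢ[ℝ] E (m + 1)) (x : E m) : proj ι (ι x) = x :=
  ext_inner_right ℝ fun v => by rw [inner_proj, ι.inner_map_map]

namespace IsFrame

variable {m : ℕ} {b : E (m + 1)} {ι : E m →ₗᵢ[ℝ] E (m + 1)}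

theorem proj_base (h : IsFrame b ι) : proj ι b = 0 :=
  ext_inner_right ℝ fun v => by rw [inner_proj, h.inner_eq_zero, inner_zero_left]

theorem inner_base (h : IsFrame b ι) : inner ℝ b b = (1 : ℝ) := by
  rw [real_inner_self_eq_norm_sq, h.norm_eq_one, one_pow]

/-- The range of `ι` lies in the orthogonal complement of `b` and both have dimension `m`, so they
coincide. -/
theorem eq_zero (h : IsFrame b ι) {p : E (m + 1)} (h1 : proj ι p = 0) (h2 : inner ℝ b p = 0) :
    p = 0 := by
  have hb : b ≠ 0 := norm_ne_zero_iff.1 (by rw [h.norm_eq_one]; exact one_ne_zero)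
  have hle : LinearMap.range ι.toLinearMap ≤ (ℝ ∙ b)ᗮ := by
    rintro _ ⟨x, rfl⟩
    exact Submodule.mem_orthogonal_singleton_iff_inner_right.2 (h.inner_eq_zero x)
  have : Fact (Module.finrank ℝ (E (m + 1)) = m + 1) := ⟨by simp⟩
  have heq := Submodule.eq_of_le_of_finrank_eq hle (by
    rw [LinearMap.finrank_range_of_inj ι.injective,
      Submodule.finrank_orthogonal_span_singleton (n := m) hb]
    simp)
  have hp : p ∈ LinearMap.range ι.toLinearMap := by
    rw [heq]
    exact Submodule.mem_orthogonal_singleton_iff_inner_right.2 h2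
  obtain ⟨x, rfl⟩ := hp
  have : x = 0 := by rw [← proj_apply_self ι x]; exact h1
  rw [this, map_zero]

theorem decomp (h : IsFrame b ι) (p : E (m + 1)) :
    p = ι (proj ι p) + (inner ℝ b p : ℝ) • b := by
  rw [← sub_eq_zero]
  refine h.eq_zero ?_ ?_
  · rw [map_sub, map_add, proj_apply_self, map_smul, h.proj_base, smul_zero, add_zero, sub_self]
  · rw [inner_sub_right, inner_add_right, h.inner_eq_zero, inner_smul_right, h.inner_base]
    ring

theorem ext (h : IsFrame b ι) {p q : E (m + 1)} (h1 : proj ι p = proj ι q)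
    (h2 : (inner ℝ b p : ℝ) = inner ℝ b q) : p = q := by
  rw [h.decomp p, h.decomp q, h1, h2]

theorem inner_eq (h : IsFrame b ι) (p q : E (m + 1)) :
    (inner ℝ p q : ℝ) = inner ℝ (proj ι p) (proj ι q) + inner ℝ b p * inner ℝ b q := by
  conv_lhs => rw [h.decomp q]
  rw [inner_add_right, ← inner_proj, inner_smul_right, real_inner_comm]
  rw [real_inner_comm p b]
  rw [real_inner_comm]
  ring

theorem norm_sq_eq (h : IsFrame b ι) (p : E (m + 1)) :
    ‖p‖ ^ 2 = ‖proj ι p‖ ^ 2 + (inner ℝ b p : ℝ) ^ 2 := by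
  rw [← real_inner_self_eq_norm_sq, h.inner_eq, real_inner_self_eq_norm_sq, sq (inner ℝ b p : ℝ)]

end IsFrame

/-- A smooth radial-type cut-off: nonnegative, with compact support, larger than `1` at `0`. -/
structure IsProfile {m : ℕ} (κ : E m → ℝ) : Prop where
  contDiff : ContDiff ℝ ∞ κ
  nonneg : ∀ w, 0 ≤ κ w
  one_lt : 1 < κ 0
  eq_zero : ∃ R, ∀ w, R ≤ ‖w‖ → κ w = 0

/-- The unnormalised bubble. -/
def preBubble {m : ℕ} (b : E (m + 1)) (ι : E m →ₗᵢ[ℝ] E (m + 1)) (κ : E m → ℝ) (w : E m) :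
    E (m + 1) :=
  κ w • ι w + (1 - κ w) • b

/-- The bubble with profile `κ`. -/
def bubble {m : ℕ} (b : E (m + 1)) (ι : E m →ₗᵢ[ℝ] E (m + 1)) (κ : E m → ℝ) (w : E m) :
    E (m + 1) :=
  normalize (preBubble b ι κ w)

section Bubble

variable {m : ℕ} {b : E (m + 1)} {ι : E m →ₗᵢ[ℝ] E (m + 1)} {κ : E m → ℝ}

theorem proj_preBubble (h : IsFrame b ι) (w : E m) : proj ι (preBubble b ι κ w) = κ w • w := by
  rw [preBubble, map_add, map_smul, map_smul, proj_apply_self, h.proj_base, smul_zero, add_zero]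

theorem inner_preBubble (h : IsFrame b ι) (w : E m) :
    (inner ℝ b (preBubble b ι κ w) : ℝ) = 1 - κ w := by
  rw [preBubble, inner_add_right, inner_smul_right, inner_smul_right, h.inner_eq_zero,
    h.inner_base]
  ring

/-- If it vanishes, the component along `b` forces `κ w = 1`, and then the tangential component `κ w
• w` forces `w = 0`. -/
theorem preBubble_ne_zero (h : IsFrame b ι) (hκ : κ 0 ≠ 1) (w : E m) :
    preBubble b ι κ w ≠ 0 := by
  intro h0
  have h1 := proj_preBubble (κ := κ) h w
  have h2 := inner_preBubble (κ := κ) h w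
  rw [h0, inner_zero_right] at h2
  rw [h0, map_zero, show κ w = 1 by linarith, one_smul] at h1
  rw [← h1] at h2
  exact hκ (by linarith)

theorem contDiff_preBubble (hκ : ContDiff ℝ ∞ κ) : ContDiff ℝ ∞ (preBubble b ι κ) :=
  (hκ.smul ι.toContinuousLinearMap.contDiff).add ((contDiff_const.sub hκ).smul contDiff_const)

theorem bubble_eq_base (h : IsFrame b ι) {w : E m} (hw : κ w = 0) : bubble b ι κ w = b := by
  rw [bubble, preBubble, hw, zero_smul, sub_zero, one_smul, zero_add,
    normalize_of_norm h.norm_eq_one]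

theorem isSmoothMap_bubble (h : IsFrame b ι) (hκ : IsProfile κ) :
    IsSmoothMap b (bubble b ι κ) := by
  have hne := preBubble_ne_zero (κ := κ) h hκ.one_lt.ne'
  obtain ⟨R, hR⟩ := hκ.eq_zero
  exact ⟨contDiff_normalize (contDiff_preBubble hκ.contDiff) hne,
    fun w => norm_normalize (hne w), R, fun w hw => bubble_eq_base h (hR w hw)⟩

theorem bubble_zero (h : IsFrame b ι) (hκ : 1 < κ 0) : bubble b ι κ 0 = -b := by
  have : preBubble b ι κ 0 = (1 - κ 0) • b := by
    rw [preBubble, map_zero, smul_zero, zero_add]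
  rw [bubble, normalize, this, norm_smul, h.norm_eq_one, Real.norm_of_nonpos (by linarith),
    smul_smul, ← neg_one_smul ℝ b]
  congr 1
  rw [mul_one, neg_sub, ← neg_sub (κ 0) 1, mul_neg, inv_mul_cancel₀ (by linarith)]

theorem proj_bubble (h : IsFrame b ι) (w : E m) :
    proj ι (bubble b ι κ w) = (‖preBubble b ι κ w‖⁻¹ * κ w) • w := by
  rw [bubble, normalize, map_smul, proj_preBubble h, smul_smul]

end Bubble

/-! ### Regular values -/

theorem fderiv_apply_eq_sum {m : ℕ} {F : Type*} [NormedAddCommGroup F] [NormedSpace ℝ F]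
    (g : E m → F) (x e : E m) : fderiv ℝ g x e = ∑ i, e i • grad g x i := by
  conv_lhs => rw [← (EuclideanSpace.basisFun (Fin m) ℝ).sum_repr e]
  rw [map_sum]
  simp [grad, pderiv]

/-- A vector `e` in the kernel of the derivative gives a linear relation between the rows of the
Jacobian matrix, with coefficients `0` for the row `g x` and `e` for the partial derivatives. -/
theorem injective_of_jacDet_ne_zero {m : ℕ} {g : E m → E (m + 1)} {x : E m}
    (h : orientedJacobian g x ≠ 0) {e : E m} (he : fderiv ℝ g x e = 0) : e = 0 := by
  by_contra hne
  refine h (Matrix.exists_vecMul_eq_zero_iff.1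
    ⟨Fin.cons (α := fun _ => ℝ) 0 e.ofLp, fun h0 => hne ?_, ?_⟩)
  · ext i
    simpa using congrFun h0 i.succ
  · funext c
    rw [fderiv_apply_eq_sum] at he
    have := congrArg (fun p : E (m + 1) => p c) he
    simpa [Matrix.vecMul, dotProduct, Fin.sum_univ_succ, grad] using this

/-- The existence of regular values in the open half sphere of centre `-b`. -/
theorem exists_regularValue {m : ℕ} {b : E (m + 1)} (hb : ‖b‖ = 1) {g : E m → E (m + 1)}
    (hg : IsSmoothMap b g) : ∃ y, ‖y‖ = 1 ∧ y ≠ b ∧ IsRegularValue g y := by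
  -- On the cylinder over the critical points the cone map has zero Jacobian determinant, so its
  -- image is null: the equal-dimensional case of Sard's theorem.
  let C : Set (E (m + 1)) := {z | jacDet (g (tail m z)) (grad g (tail m z)) = 0}
  have h0 : volume (coneMap g '' C) = 0 :=
    addHaar_image_eq_zero_of_det_fderivWithin_eq_zero volume
      (fun z _ => (((contDiff_coneMap hg.contDiff).differentiable (by simp)) z).hasFDerivAt.hasFDerivWithinAt)
      (fun z hz => by rw [det_fderiv_coneMap hg.contDiff, hz, mul_zero])
  -- A point of this ball has negative inner product with `b`, so its direction cannot be `b`.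
  have : ¬ ball (-b) 1 ⊆ coneMap g '' C := fun hsub =>
    (measure_ball_pos volume (-b) one_pos).ne' (measure_mono_null hsub h0)
  obtain ⟨z, hz, hzC⟩ := Set.not_subset.1 this
  have hbz : inner ℝ b z < (0 : ℝ) := by
    have h1 : inner ℝ b (z + b) ≤ ‖b‖ * ‖z + b‖ := real_inner_le_norm _ _
    rw [mem_ball, dist_eq_norm, sub_neg_eq_add] at hz
    rw [inner_add_right, real_inner_self_eq_norm_sq, hb] at h1
    linarith
  have hz0 : z ≠ 0 := by rintro rfl; simp at hbz
  refine ⟨normalize z, norm_normalize hz0, fun h => ?_, fun x hx h => hzC ?_⟩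
  · have : inner ℝ b (normalize z) = (1 : ℝ) := by
      rw [h, real_inner_self_eq_norm_sq, hb, one_pow]
    rw [normalize, inner_smul_right] at this
    have := mul_nonpos_of_nonneg_of_nonpos (inv_nonneg.2 (norm_nonneg z)) hbz.le
    linarith
  · refine ⟨(splitEquiv m).symm (‖z‖, x), ?_, ?_⟩
    all_goals
      have hs := (splitEquiv m).apply_symm_apply (‖z‖, x)
      rw [splitEquiv_apply, Prod.mk.injEq] at hs
    · change jacDet _ _ = 0
      rw [hs.2]
      exact h
    · rw [coneMap, hs.1, hs.2, hx, normalize, smul_smul, mul_inv_cancel₀ (norm_ne_zero_iff.2 hz0),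
        one_smul]

/-! ### Every homotopy class is a power of the class of a bubble -/

theorem IsContMap.comp_sub {m : ℕ} {b : S m} {f : E m → E (m + 1)} (hf : IsContMap b f) (c : E m) :
    IsContMap b fun x => f (x - c) := by
  obtain ⟨R, hR⟩ := hf.eq_base
  refine ⟨hf.continuous.comp (continuous_id.sub continuous_const), fun x => hf.norm_eq_one _,
    R + ‖c‖, fun x hx => hR _ ?_⟩
  have := norm_sub_norm_le x c
  linarith

theorem exists_linMap_eq {m : ℕ} (D : E m →L[ℝ] E m) (hD : ∀ e, D e = 0 → e = 0) :
    ∃ M : Matrix (Fin m) (Fin m) ℝ, M.det ≠ 0 ∧ ∀ x, linMap M x = D x := by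
  let M := Matrix.toEuclideanLin.symm D.toLinearMap
  have hM : ∀ x, linMap M x = D x := fun x => by
    have : Matrix.toEuclideanLin M = D.toLinearMap := LinearEquiv.apply_symm_apply _ _
    exact congrArg (fun L : E m →ₗ[ℝ] E m => L x) this
  refine ⟨M, fun h0 => ?_, hM⟩
  obtain ⟨v, hv, hv0⟩ := Matrix.exists_mulVec_eq_zero_iff.2 h0
  have h1 : WithLp.toLp 2 v = (0 : E m) := hD _ (by
    rw [← hM]
    simp [linMap, hv0])
  exact hv (by simpa using congrArg WithLp.ofLp h1)

theorem ne_neg_of_norm {F : Type*} [NormedAddCommGroup F] [NormedSpace ℝ F] {p : F}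
    (hp : ‖p‖ = 1) : p ≠ -p :=
  ne_neg_of_dist_lt hp (by simp)

/-- A map that has a linear zero of its projection at each preimage of `-b` is homotopic to a
superposition of bubbles. -/
theorem cls_mem_zpowers_of_hasFDerivAt {m : ℕ} [Nontrivial (Fin m)] {b : S m}
    {ι : E m →ₗᵢ[ℝ] E (m + 1)} (hι : IsFrame (b : E (m + 1)) ι) {κ : E m → ℝ} (hκ : IsProfile κ)
    {f : E m → E (m + 1)} (hf : IsContMap b f) {t : Finset (E m)}
    (ht : ∀ x, x ∈ t ↔ f x = -b) {D : E m → E m →L[ℝ] E m}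
    (hD : ∀ c ∈ t, HasFDerivAt (fun x => proj ι (f x)) (D c) c)
    (hinj : ∀ c ∈ t, ∀ e, D c e = 0 → e = 0) :
    cls hf ∈ Subgroup.zpowers (cls (isSmoothMap_bubble hι hκ).isContMap) := by
  have hM : ∀ c ∈ t, ∃ M : Matrix (Fin m) (Fin m) ℝ, M.det ≠ 0 ∧ ∀ x, linMap M x = D c x :=
    fun c hc => exists_linMap_eq (D c) (hinj c hc)
  choose! M hMdet hMD using hM
  have ha : ∀ c ∈ t, ∃ a > 0, ∀ x, a * ‖x‖ ≤ ‖linMap (M c) x‖ := fun c hc => by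
    obtain ⟨a, ha, h⟩ := exists_mul_norm_le_linMap (M := fun _ => M c) continuous_const
      fun _ => hMdet c hc
    exact ⟨a, ha, h 0⟩
  choose! a ha0 ha using ha
  obtain ⟨ρ, hρ⟩ := hκ.eq_zero
  have hev1 : ∀ᶠ r in 𝓝[>] (0 : ℝ), ∀ c ∈ t, ∀ c' ∈ t, ∀ i, c i ≠ c' i → 2 * r < |c i - c' i| := by
    rw [eventually_all_finset]
    intro c hc
    rw [eventually_all_finset]
    intro c' hc'
    rw [eventually_all]
    intro i
    by_cases h : c i = c' i
    · exact Eventually.of_forall fun r h' => absurd h h'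
    · have : 0 < |c i - c' i| / 2 := half_pos (abs_pos.2 (sub_ne_zero.2 h))
      filter_upwards [Ioo_mem_nhdsGT this] with r hr _
      linarith [hr.2]
  -- The linearisation error is made at most half of the lower bound `a c` for the linear part, so
  -- the projection of `f` cannot point against its linear part.
  have hev2 : ∀ᶠ r in 𝓝[>] (0 : ℝ), ∀ c ∈ t, ∀ x, ‖x - c‖ < r →
      ‖proj ι (f x) - linMap (M c) (x - c)‖ ≤ a c / 2 * ‖x - c‖ := by
    rw [eventually_all_finset]
    intro c hc
    have h0 : proj ι (f c) = 0 := by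
      rw [(ht c).1 hc, map_neg, hι.proj_base, neg_zero]
    have h1 := (hasFDerivAt_iff_isLittleO.1 (hD c hc)).def (half_pos (ha0 c hc))
    obtain ⟨r, hr, h2⟩ := Metric.eventually_nhds_iff.1 h1
    filter_upwards [Ioo_mem_nhdsGT hr] with s hs x hx
    have := h2 (show dist x c < r by rw [dist_eq_norm]; linarith [hs.2])
    simpa only [h0, sub_zero, hMD c hc] using this
  obtain ⟨r, ⟨hsep, hloc⟩, hr⟩ := ((hev1.and hev2).and self_mem_nhdsWithin).exists
  have hr : 0 < r := hr
  -- Scaling by `L c` sends every point at distance at least `r` from `c` to norm at least `ρ`,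
  -- where the profile vanishes; the maximum with `1` makes `L c` positive.
  let L : E m → ℝ := fun c => max ρ 1 / (a c * r)
  have hL : ∀ c ∈ t, 0 < L c := fun c hc =>
    div_pos (lt_max_of_lt_right one_pos) (mul_pos (ha0 c hc) hr)
  let ψ : E m → E m → E (m + 1) := fun c x => bubble b ι κ (linMap (L c • M c) (x - c))
  have hlin : ∀ c x, linMap (L c • M c) x = L c • linMap (M c) x := fun c x => by
    simp [linMap, Matrix.smul_mulVec]
  have hdet : ∀ c ∈ t, (L c • M c).det ≠ 0 := fun c hc => by
    rw [Matrix.det_smul]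
    exact mul_ne_zero (pow_ne_zero _ (hL c hc).ne') (hMdet c hc)
  have hβ := (isSmoothMap_bubble hι hκ).isContMap
  have hψ : ∀ c ∈ t, IsContMap b (ψ c) := fun c hc => (hβ.comp_linMap (hdet c hc)).comp_sub c
  have hS : IsSeparated b t r ψ := by
    refine ⟨fun c hc c' hc' hne => ?_, fun c hc x hx => bubble_eq_base hι (hρ _ ?_)⟩
    · obtain ⟨i, hi⟩ : ∃ i, c i ≠ c' i := by
        by_contra! h
        exact hne (by ext i; exact h i)
      refine (hsep c hc c' hc' i hi).le.trans ?_
      simpa using PiLp.norm_apply_le (c - c') i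
    · rw [hlin, norm_smul, Real.norm_of_nonneg (hL c hc).le]
      have h1 := ha c hc (x - c)
      have h2 : a c * r ≤ a c * ‖x - c‖ := mul_le_mul_of_nonneg_left hx (ha0 c hc).le
      calc ρ ≤ max ρ 1 := le_max_left _ _
        _ = L c * (a c * r) := (div_mul_cancel₀ _ (mul_pos (ha0 c hc) hr).ne').symm
        _ ≤ _ := mul_le_mul_of_nonneg_left (h2.trans h1) (hL c hc).le
  have hF := hS.isContMap hψ
  have hψc : ∀ c, ψ c c = -b := fun c => by
    have : linMap (L c • M c) (c - c) = 0 := by simp [linMap]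
    simp only [ψ]
    rw [this, bubble_zero hι hκ.one_lt]
  have hbb := ne_neg_of_norm (norm_base b)
  -- The two maps are never antipodal. Off the small balls the superposition is `b`, while `f = -b`
  -- only at the centres. At a centre both maps are `-b`. Elsewhere in a ball, antipodality would
  -- make `proj ι (f x)` a nonpositive multiple of its linear part, against the error bound.
  have heq : cls hf = cls hF := by
    refine cls_eq_of_ne_neg hf hF fun x hx => ?_
    rcases hS.bubbleSum_cases x with ⟨h1, h2⟩ | ⟨c, hc, hxc, h2⟩
    · rw [h2] at hx
      have := h1 x ((ht x).2 hx)
      rw [sub_self, norm_zero] at this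
      linarith
    · rw [h2] at hx
      by_cases hxc0 : x = c
      · subst hxc0
        rw [hψc, neg_neg, (ht x).1 hc] at hx
        exact hbb hx.symm
      have hpos : 0 < ‖x - c‖ := norm_pos_iff.2 (sub_ne_zero.2 hxc0)
      have h3 := hloc c hc x hxc
      have h4 : proj ι (ψ c x) = (‖preBubble (b : E (m + 1)) ι κ (linMap (L c • M c) (x - c))‖⁻¹ *
          κ (linMap (L c • M c) (x - c)) * L c) • linMap (M c) (x - c) := by
        simp only [ψ]
        rw [proj_bubble hι, hlin, smul_smul]
      set μ := ‖preBubble (b : E (m + 1)) ι κ (linMap (L c • M c) (x - c))‖⁻¹ *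
          κ (linMap (L c • M c) (x - c)) * L c with hμ
      have hμ0 : 0 ≤ μ := mul_nonneg (mul_nonneg (inv_nonneg.2 (norm_nonneg _)) (hκ.nonneg _))
        (hL c hc).le
      rw [hx, map_neg, h4, show -(μ • linMap (M c) (x - c)) - linMap (M c) (x - c)
        = (-(μ + 1)) • linMap (M c) (x - c) by module, norm_smul, norm_neg,
        Real.norm_of_nonneg (by linarith)] at h3
      have h5 := ha c hc (x - c)
      have h6 := mul_pos (ha0 c hc) hpos
      nlinarith [mul_nonneg hμ0 (norm_nonneg (linMap (M c) (x - c)))]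
  rw [heq]
  classical
  have hmem : ∀ c (hc : c ∈ t), cls (hψ c hc) ∈ Subgroup.zpowers (cls hβ) := fun c hc => by
    rw [cls_comp_sub (hβ.comp_linMap (hdet c hc)) (hψ c hc) c fun x => rfl]
    exact cls_comp_linMap_mem (hdet c hc) _ hβ _
  rw [cls_bubbleSum (e := fun c => if hc : c ∈ t then cls (hψ c hc) else 1) t hsep hS hψ
    (fun c hc => by simp [hc]) hF]
  refine prod_mem fun c hc => ?_
  simp only [hc, dif_pos]
  exact hmem c hc

/-! ### Moving a regular value to `-b` by a Möbius homotopy. -/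

/-- Translation by `-v` in the stereographic coordinate centred at `b`, up to normalisation. -/
def moebius {m : ℕ} (b : E (m + 1)) (ι : E m →ₗᵢ[ℝ] E (m + 1)) (v : E m) (p : E (m + 1)) :
    E (m + 1) :=
  ι ((2 : ℝ) • proj ι p - (2 * (1 - inner ℝ b p)) • v) +
    (2 * inner ℝ b p - 2 * inner ℝ (proj ι p) v + (1 - inner ℝ b p) * ‖v‖ ^ 2 : ℝ) • b

section Moebius

variable {m : ℕ} {b : E (m + 1)} {ι : E m →ₗᵢ[ℝ] E (m + 1)}

theorem proj_moebius (h : IsFrame b ι) (v : E m) (p : E (m + 1)) :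
    proj ι (moebius b ι v p) = (2 : ℝ) • proj ι p - (2 * (1 - inner ℝ b p : ℝ)) • v := by
  rw [moebius, map_add, proj_apply_self, map_smul, h.proj_base, smul_zero, add_zero]

theorem inner_moebius (h : IsFrame b ι) (v : E m) (p : E (m + 1)) :
    inner ℝ b (moebius b ι v p) =
      (2 * inner ℝ b p - 2 * inner ℝ (proj ι p) v + (1 - inner ℝ b p) * ‖v‖ ^ 2 : ℝ) := by
  rw [moebius, inner_add_right, h.inner_eq_zero, inner_smul_right, h.inner_base]
  ring

/-- The first identity is the vanishing of `proj_moebius`. Substituting it in `|p|² = 1` and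
cancelling `1 - ⟨b, p⟩` gives the second. -/
theorem eq_of_proj_moebius_eq_zero (h : IsFrame b ι) {v : E m} {p : E (m + 1)} (hp : ‖p‖ = 1)
    (h0 : proj ι (moebius b ι v p) = 0) :
    proj ι p = (1 - inner ℝ b p : ℝ) • v ∧
      ((inner ℝ b p : ℝ) ≠ 1 → 1 + inner ℝ b p = (1 - inner ℝ b p) * ‖v‖ ^ 2) := by
  rw [proj_moebius h] at h0
  have h1 : proj ι p = (1 - inner ℝ b p : ℝ) • v := by
    have : (2 : ℝ) • (proj ι p - (1 - inner ℝ b p : ℝ) • v) = 0 := by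
      rw [smul_sub, smul_smul]; exact h0
    exact sub_eq_zero.1 ((smul_eq_zero.1 this).resolve_left two_ne_zero)
  refine ⟨h1, fun hne => ?_⟩
  have h2 := h.norm_sq_eq p
  rw [h1, hp, norm_smul, mul_pow, Real.norm_eq_abs, sq_abs] at h2
  have h3 : 1 - (inner ℝ b p : ℝ) ≠ 0 := fun h' => hne (by linarith)
  apply mul_left_cancel₀ h3
  linear_combination h2

theorem moebius_ne_zero (h : IsFrame b ι) {v : E m} {p : E (m + 1)} (hp : ‖p‖ = 1) :
    moebius b ι v p ≠ 0 := by
  intro h0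
  obtain ⟨h1, h2⟩ := eq_of_proj_moebius_eq_zero h hp (by rw [h0, map_zero])
  have h3 := inner_moebius h v p
  rw [h0, inner_zero_right, h1, inner_smul_left, real_inner_self_eq_norm_sq] at h3
  simp only [conj_trivial] at h3
  by_cases hne : (inner ℝ b p : ℝ) = 1
  · rw [hne] at h3
    norm_num at h3
  · exact hne (by linarith [h2 hne])

theorem moebius_base (h : IsFrame b ι) (v : E m) : moebius b ι v b = (2 : ℝ) • b := by
  refine h.ext ?_ ?_
  · rw [proj_moebius h, map_smul, h.proj_base, h.inner_base]
    simp
  · rw [inner_moebius h, inner_smul_right, h.proj_base, h.inner_base, inner_zero_left]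
    ring

theorem moebius_zero (h : IsFrame b ι) (p : E (m + 1)) : moebius b ι 0 p = (2 : ℝ) • p := by
  refine h.ext ?_ ?_
  · rw [proj_moebius h, map_smul, smul_zero, sub_zero]
  · rw [inner_moebius h, inner_smul_right, inner_zero_right, norm_zero]
    ring

theorem contDiff_moebius {H : Type*} [NormedAddCommGroup H] [NormedSpace ℝ H] {n : ℕ∞ω}
    {v : H → E m} {p : H → E (m + 1)} (hv : ContDiff ℝ n v) (hp : ContDiff ℝ n p) :
    ContDiff ℝ n fun x => moebius b ι (v x) (p x) := by
  have h1 : ContDiff ℝ n fun x => proj ι (p x) := (proj ι).contDiff.comp hp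
  have h2 : ContDiff ℝ n fun x => (inner ℝ b (p x) : ℝ) := contDiff_const.inner ℝ hp
  have h3 : ContDiff ℝ n fun x => ‖v x‖ ^ 2 := hv.norm_sq ℝ
  have h4 : ContDiff ℝ n fun x => (inner ℝ (proj ι (p x)) (v x) : ℝ) := h1.inner ℝ hv
  refine (ι.toContinuousLinearMap.contDiff.comp ((h1.const_smul (2 : ℝ)).sub
    ((contDiff_const.mul (contDiff_const.sub h2)).smul hv))).add
    (ContDiff.smul ((((contDiff_const.mul h2).sub (contDiff_const.mul h4))).add
      ((contDiff_const.sub h2).mul h3)) contDiff_const)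

theorem continuous_moebius {X : Type*} [TopologicalSpace X] {v : X → E m} {p : X → E (m + 1)}
    (hv : Continuous v) (hp : Continuous p) : Continuous fun x => moebius b ι (v x) (p x) := by
  unfold moebius
  fun_prop

theorem normalize_smul_of_norm {p : E (m + 1)} (hp : ‖p‖ = 1) {r : ℝ} (hr : 0 < r) :
    normalize (r • p) = p := by
  rw [normalize, norm_smul, hp, mul_one, Real.norm_of_nonneg hr.le, smul_smul,
    inv_mul_cancel₀ hr.ne', one_smul]

/-- The stereographic projection from `b`. -/
def stereo (b : E (m + 1)) (ι : E m →ₗᵢ[ℝ] E (m + 1)) (y : E (m + 1)) : E m :=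
  (1 - inner ℝ b y : ℝ)⁻¹ • proj ι y

theorem inner_lt_one (hb : ‖b‖ = 1) {y : E (m + 1)} (hy : ‖y‖ = 1) (hyb : y ≠ b) :
    (inner ℝ b y : ℝ) < 1 := by
  refine lt_of_le_of_ne ?_ fun h => hyb ((inner_eq_one_iff_of_norm_eq_one hb hy).1 h).symm
  have := real_inner_le_norm b y
  rwa [hb, hy, one_mul] at this

theorem proj_eq_smul_stereo (hb : ‖b‖ = 1) {y : E (m + 1)} (hy : ‖y‖ = 1) (hyb : y ≠ b) :
    proj ι y = (1 - inner ℝ b y : ℝ) • stereo b ι y := by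
  have := inner_lt_one hb hy hyb
  rw [stereo, smul_smul, mul_inv_cancel₀ (by linarith), one_smul]

theorem proj_moebius_stereo (h : IsFrame b ι) {y : E (m + 1)} (hy : ‖y‖ = 1) (hyb : y ≠ b) :
    proj ι (moebius b ι (stereo b ι y) y) = 0 := by
  rw [proj_moebius h, proj_eq_smul_stereo h.norm_eq_one hy hyb, smul_smul, sub_self]

theorem norm_stereo (h : IsFrame b ι) {y : E (m + 1)} (hy : ‖y‖ = 1) (hyb : y ≠ b) :
    1 + inner ℝ b y = (1 - inner ℝ b y) * ‖stereo b ι y‖ ^ 2 :=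
  (eq_of_proj_moebius_eq_zero h hy (proj_moebius_stereo h hy hyb)).2
    (inner_lt_one h.norm_eq_one hy hyb).ne

/-- `-b` has stereographic coordinate zero, so translating by the coordinate of `y` brings exactly
`y` there. Indeed the relation `1 + β = (1 - β) |v|²` determines `β = ⟨b, p⟩`, and then `proj ι p =
(1 - β) v` determines `p`. -/
theorem normalize_moebius_eq_neg_iff (h : IsFrame b ι) {y p : E (m + 1)} (hy : ‖y‖ = 1)
    (hyb : y ≠ b) (hp : ‖p‖ = 1) :
    normalize (moebius b ι (stereo b ι y) p) = -b ↔ p = y := by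
  have hb := h.norm_eq_one
  have hvy := norm_stereo h hy hyb
  have hyv := proj_eq_smul_stereo (ι := ι) hb hy hyb
  constructor
  · intro hx
    have h1 : proj ι (moebius b ι (stereo b ι y) p) = 0 := by
      have := congrArg (proj ι) hx
      rw [map_neg, h.proj_base, neg_zero, normalize, map_smul] at this
      exact (smul_eq_zero.1 this).resolve_left
        (inv_ne_zero (norm_ne_zero_iff.2 (moebius_ne_zero h hp)))
    obtain ⟨h2, h3⟩ := eq_of_proj_moebius_eq_zero h hp h1
    have h4 : (inner ℝ b p : ℝ) ≠ 1 := fun h' => by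
      have hfb := (inner_eq_one_iff_of_norm_eq_one hb hp).1 h'
      rw [← hfb, moebius_base h, normalize_smul_of_norm hb two_pos] at hx
      exact ne_neg_of_norm hb hx
    have h5 := h3 h4
    have h6 : (inner ℝ b p : ℝ) = inner ℝ b y := by
      have h8 : ((inner ℝ b p : ℝ) - inner ℝ b y) * (1 + ‖stereo b ι y‖ ^ 2) = 0 := by
        linear_combination h5 - hvy
      have h9 := (mul_eq_zero.1 h8).resolve_right (by positivity)
      linarith
    exact h.ext (by rw [h2, hyv, h6]) h6
  · rintro rfl
    have h1 : (inner ℝ b (moebius b ι (stereo b ι p) p) : ℝ) < 0 := by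
      rw [inner_moebius h]
      rw [hyv, inner_smul_left, real_inner_self_eq_norm_sq]
      simp only [conj_trivial]
      linarith [inner_lt_one hb hp hyb]
    have h2 := h.decomp (moebius b ι (stereo b ι p) p)
    rw [proj_moebius_stereo h hp hyb, map_zero, zero_add] at h2
    have h3 : moebius b ι (stereo b ι p) p
        = (-(inner ℝ b (moebius b ι (stereo b ι p) p) : ℝ)) • (-b) := by
      rw [smul_neg, neg_smul, neg_neg, ← h2]
    rw [h3, normalize_smul_of_norm (by rw [norm_neg, hb]) (by linarith)]

/-- The derivative of the projection of `moebius b ι v`. -/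
def moebiusDeriv (b : E (m + 1)) (ι : E m →ₗᵢ[ℝ] E (m + 1)) (v : E m) : E (m + 1) →L[ℝ] E m :=
  (2 : ℝ) • proj ι + ((2 : ℝ) • innerSL ℝ b).smulRight v

theorem hasFDerivAt_proj_moebius (h : IsFrame b ι) (v : E m) (p : E (m + 1)) :
    HasFDerivAt (fun p => proj ι (moebius b ι v p)) (moebiusDeriv b ι v) p := by
  have e : (fun p => proj ι (moebius b ι v p)) = fun p => moebiusDeriv b ι v p - (2 : ℝ) • v := by
    funext p
    rw [proj_moebius h]
    simp [moebiusDeriv]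
    module
  rw [e]
  exact (moebiusDeriv b ι v).hasFDerivAt.sub_const _

/-- The kernel condition makes `proj ι w` equal to `-⟨b, w⟩` times the stereographic coordinate.
Inserted in `⟨y, w⟩ = 0`, this leaves `⟨b, w⟩ = 0` by `norm_stereo`. Hence the derivative is
injective on the tangent space at `y`. -/
theorem eq_zero_of_moebiusDeriv (h : IsFrame b ι) {y w : E (m + 1)} (hy : ‖y‖ = 1)
    (hyb : y ≠ b) (hw : inner ℝ y w = (0 : ℝ)) (h0 : moebiusDeriv b ι (stereo b ι y) w = 0) :
    w = 0 := by
  have hvy := norm_stereo h hy hyb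
  have hyv := proj_eq_smul_stereo (ι := ι) h.norm_eq_one hy hyb
  have h2 : (2 : ℝ) • proj ι w + (2 * (inner ℝ b w : ℝ)) • stereo b ι y = 0 := by
    simpa [moebiusDeriv] using h0
  have h3 : proj ι w = (-(inner ℝ b w : ℝ)) • stereo b ι y := by
    have : (2 : ℝ) • (proj ι w - (-(inner ℝ b w : ℝ)) • stereo b ι y) = 0 := by
      rw [← h2]; module
    exact sub_eq_zero.1 ((smul_eq_zero.1 this).resolve_left two_ne_zero)
  rw [h.inner_eq, h3, hyv, inner_smul_left, inner_smul_right, real_inner_self_eq_norm_sq] at hw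
  simp only [conj_trivial] at hw
  have h5 : (inner ℝ b w : ℝ) = 0 := by
    linear_combination (inner ℝ b w : ℝ) * hvy - hw
  rw [h5, neg_zero, zero_smul] at h3
  exact h.eq_zero h3 h5

end Moebius

/-- Composing with the Möbius translation that takes a regular value `y` to `-b` does not change the
class: letting the translation vector shrink to zero gives a homotopy fixing `b`. The linear
behaviour at the preimages of `-b` then comes from regularity. -/
theorem cls_mem_zpowers_bubble_of_smooth {m : ℕ} [Nontrivial (Fin m)] {b : S m}
    {ι : E m →ₗᵢ[ℝ] E (m + 1)} (hι : IsFrame (b : E (m + 1)) ι) {κ : E m → ℝ} (hκ : IsProfile κ)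
    {f : E m → E (m + 1)} (hf : IsSmoothMap (b : E (m + 1)) f) :
    cls hf.isContMap ∈ Subgroup.zpowers (cls (isSmoothMap_bubble hι hκ).isContMap) := by
  obtain ⟨y, hy, hyb, hr⟩ := exists_regularValue (norm_base b) hf
  obtain ⟨t, U, η, ht, -⟩ := exists_separation hf hyb hr
  obtain ⟨R, hR⟩ := hf.eq_base
  obtain ⟨v, hv⟩ : ∃ v, v = stereo (b : E (m + 1)) ι y := ⟨_, rfl⟩
  have hu : ContDiff ℝ ∞ fun x => moebius b ι v (f x) := contDiff_moebius contDiff_const hf.contDiff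
  have hu0 : ∀ x, moebius b ι v (f x) ≠ 0 := fun x => moebius_ne_zero hι (hf.norm_eq_one x)
  have hf1 : IsSmoothMap (b : E (m + 1)) fun x => normalize (moebius b ι v (f x)) :=
    ⟨contDiff_normalize hu hu0, fun x => norm_normalize (hu0 x), R, fun x hx => by
      rw [hR x hx, moebius_base hι, normalize_smul_of_norm (norm_base b) two_pos]⟩
  have hcls : cls hf.isContMap = cls hf1.isContMap := by
    refine cls_homotopy_normalize _ _
      (H := fun q : unitInterval × E m => moebius b ι ((q.1 : ℝ) • v) (f q.2)) ?_
      (fun q => moebius_ne_zero hι (hf.norm_eq_one _)) (R := R) (fun s x hx => ?_) (fun x => ?_)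
      (fun x => ?_)
    · exact continuous_moebius (by fun_prop) (hf.contDiff.continuous.comp continuous_snd)
    · simp only
      rw [hR x hx, moebius_base hι, normalize_smul_of_norm (norm_base b) two_pos]
    · simp only [Set.Icc.coe_zero, zero_smul]
      rw [moebius_zero hι, normalize_smul_of_norm (hf.norm_eq_one x) two_pos]
    · simp only [Set.Icc.coe_one, one_smul]
  have hd : ∀ x, DifferentiableAt ℝ f x := hf.contDiff.differentiable (by simp)
  -- In the derivative `D` at a preimage of `-b`, the derivative of the normalising factor does not
  -- appear, because it multiplies a projection that vanishes there.
  rw [hcls]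
  refine cls_mem_zpowers_of_hasFDerivAt hι hκ hf1.isContMap (t := t)
    (fun x => by rw [ht, hv, normalize_moebius_eq_neg_iff hι hy hyb (hf.norm_eq_one x)])
    (D := fun x => ‖moebius b ι v (f x)‖⁻¹ • (moebiusDeriv b ι v).comp (fderiv ℝ f x)) ?_ ?_
  · intro x hx
    have hu1 := hu.differentiable (by simp) x
    have hn := ((hu1.norm ℝ (hu0 x)).inv (norm_ne_zero_iff.2 (hu0 x))).hasFDerivAt
    have hP : HasFDerivAt (fun z => proj ι (moebius b ι v (f z)))
        ((moebiusDeriv b ι v).comp (fderiv ℝ f x)) x :=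
      (hasFDerivAt_proj_moebius hι v (f x)).comp x (hd x).hasFDerivAt
    have h2 := hn.smul hP
    have h0 : proj ι (moebius b ι v (f x)) = 0 := by
      rw [(ht x).1 hx, hv, proj_moebius_stereo hι hy hyb]
    refine (h2.congr_of_eventuallyEq (Eventually.of_forall fun z => ?_)).congr_fderiv ?_
    · simp only [normalize, map_smul]
      rfl
    · rw [h0]
      ext1 e
      simp
  · intro x hx e he
    have hx' := (ht x).1 hx
    have h1 : ‖moebius b ι v (f x)‖⁻¹ • moebiusDeriv b ι v (fderiv ℝ f x e) = 0 := he
    have h2 := (smul_eq_zero.1 h1).resolve_left (inv_ne_zero (norm_ne_zero_iff.2 (hu0 x)))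
    have h4 : (inner ℝ (f x) (fderiv ℝ f x e) : ℝ) = 0 :=
      inner_fderiv_eq_zero (hd x) hf.norm_eq_one e
    rw [hx'] at h4
    rw [hv] at h2
    exact injective_of_jacDet_ne_zero (hr x hx') (eq_zero_of_moebiusDeriv hι hy hyb h4 h2)

/-- Every homotopy class is a power of the class of a bubble. -/
theorem mem_zpowers_bubble {m : ℕ} [Nontrivial (Fin m)] {b : S m}
    {ι : E m →ₗᵢ[ℝ] E (m + 1)} (hι : IsFrame (b : E (m + 1)) ι) {κ : E m → ℝ} (hκ : IsProfile κ)
    (σ : π_ m (S m) b) :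
    σ ∈ Subgroup.zpowers (cls (isSmoothMap_bubble hι hκ).isContMap) := by
  obtain ⟨f, hf, -, rfl⟩ := exists_smooth_rep σ one_pos
  exact cls_mem_zpowers_bubble_of_smooth hι hκ hf

/-! ### The energy of a bubble -/

/-- The Jacobian matrix of a map, as an element of a Euclidean space. -/
def jac {m : ℕ} (f : E m → E (m + 1)) (x : E m) : Jac m := WithLp.toLp 2 (grad f x)

/-- The conformal factor of the inverse stereographic projection. -/
def rho {m : ℕ} (w : E m) : ℝ := 2 / (1 + ‖w‖ ^ 2)

theorem rho_pos {m : ℕ} (w : E m) : 0 < rho w := div_pos two_pos (by positivity)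

theorem rho_mul {m : ℕ} (w : E m) : rho w * (1 + ‖w‖ ^ 2) = 2 :=
  div_mul_cancel₀ _ (by positivity)

theorem contDiff_rho {m : ℕ} : ContDiff ℝ ∞ (rho (m := m)) :=
  contDiff_const.div (contDiff_const.add (contDiff_id.norm_sq ℝ)) fun w => by positivity

theorem hasFDerivAt_rho {m : ℕ} (w : E m) :
    HasFDerivAt rho (-(rho w ^ 2) • innerSL ℝ w) w := by
  have h1 : HasFDerivAt (fun w : E m => 1 + ‖w‖ ^ 2) (2 • innerSL ℝ w) w :=
    ((hasStrictFDerivAt_norm_sq w).hasFDerivAt).const_add 1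
  have hne : 1 + ‖w‖ ^ 2 ≠ 0 := by positivity
  have h2 := ((hasDerivAt_inv hne).comp_hasFDerivAt w h1).const_mul 2
  refine (h2.congr_of_eventuallyEq (Eventually.of_forall fun z => ?_)).congr_fderiv ?_
  · simp [rho, div_eq_mul_inv]
  · ext1 e
    simp [rho]
    field_simp

/-- The difference of the inverse stereographic projection and `b`. -/
def stereoInv {m : ℕ} (b : E (m + 1)) (ι : E m →ₗᵢ[ℝ] E (m + 1)) (w : E m) : E (m + 1) :=
  rho w • (ι w - b)

/-- The derivative of the inverse stereographic projection. -/
def stereoInvDeriv {m : ℕ} (b : E (m + 1)) (ι : E m →ₗᵢ[ℝ] E (m + 1)) (w : E m) :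
    E m →L[ℝ] E (m + 1) :=
  rho w • ι.toContinuousLinearMap + (-(rho w ^ 2) • innerSL ℝ w).smulRight (ι w - b)

section StereoInv

variable {m : ℕ} {b : E (m + 1)} {ι : E m →ₗᵢ[ℝ] E (m + 1)}

theorem hasFDerivAt_stereoInv (w : E m) :
    HasFDerivAt (stereoInv b ι) (stereoInvDeriv b ι w) w :=
  (hasFDerivAt_rho w).smul (ι.toContinuousLinearMap.hasFDerivAt.sub_const b)

theorem inner_sub_base (h : IsFrame b ι) (w e : E m) :
    (inner ℝ (ι w - b) (ι e) : ℝ) = inner ℝ w e := by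
  rw [inner_sub_left, h.inner_eq_zero, ι.inner_map_map, sub_zero]

theorem norm_sub_base_sq (h : IsFrame b ι) (w : E m) : ‖ι w - b‖ ^ 2 = 1 + ‖w‖ ^ 2 := by
  rw [@norm_sub_sq_real, real_inner_comm, h.inner_eq_zero, ι.norm_map, h.norm_eq_one]
  ring

theorem norm_stereoInv_sq (h : IsFrame b ι) (w : E m) : ‖stereoInv b ι w‖ ^ 2 = 2 * rho w := by
  rw [stereoInv, norm_smul, mul_pow, Real.norm_eq_abs, sq_abs, norm_sub_base_sq h]
  linear_combination rho w * rho_mul w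

/-- Conformality of the inverse stereographic projection: the cross terms and the quadratic term in
`ι w - b` cancel because `rho w * (1 + |w|²) = 2`. -/
theorem inner_stereoInvDeriv (h : IsFrame b ι) (w e e' : E m) :
    (inner ℝ (stereoInvDeriv b ι w e) (stereoInvDeriv b ι w e') : ℝ) = rho w ^ 2 * inner ℝ e e' := by
  have h1 : ∀ e, stereoInvDeriv b ι w e
      = rho w • ι e + (-(rho w ^ 2) * inner ℝ w e) • (ι w - b) := fun e => by
    simp [stereoInvDeriv]
  rw [h1, h1, inner_add_left, inner_add_right, inner_add_right]
  simp only [inner_smul_left, inner_smul_right, conj_trivial]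
  rw [real_inner_comm (ι w - b) (ι e), inner_sub_base h, inner_sub_base h, ι.inner_map_map,
    real_inner_self_eq_norm_sq, norm_sub_base_sq h]
  linear_combination (rho w ^ 3 * inner ℝ w e * inner ℝ w e') * rho_mul w

theorem norm_stereoInvDeriv (h : IsFrame b ι) (w e : E m) :
    ‖stereoInvDeriv b ι w e‖ = rho w * ‖e‖ := by
  have := inner_stereoInvDeriv h w e e
  rw [real_inner_self_eq_norm_sq, real_inner_self_eq_norm_sq, ← mul_pow] at this
  exact (pow_left_inj₀ (norm_nonneg _) (mul_nonneg (rho_pos w).le (norm_nonneg _)) two_ne_zero).1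
    this

end StereoInv

/-- The Gram matrix of the rows is diagonal with entries `1, r², …, r²`, and its determinant is the
square of `jacDet p A`. -/
theorem abs_jacDet_of_orthogonal {m : ℕ} {p : E (m + 1)} {A : Fin m → E (m + 1)} {r : ℝ}
    (hr : 0 ≤ r) (hp : ‖p‖ = 1) (hpA : ∀ i, inner ℝ p (A i) = (0 : ℝ))
    (hA : ∀ i j, inner ℝ (A i) (A j) = if i = j then r ^ 2 else 0) :
    |jacDet p A| = r ^ m := by
  have hv : ∀ i j : Fin (m + 1), inner ℝ (Fin.cons (α := fun _ => E (m + 1)) p A i)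
      (Fin.cons (α := fun _ => E (m + 1)) p A j)
        = if i = j then (Fin.cons (α := fun _ => ℝ) 1 (fun _ => r ^ 2) i : ℝ) else 0 := by
    intro i j
    refine Fin.cases ?_ (fun i => ?_) i <;> refine Fin.cases ?_ (fun j => ?_) j
    · simp [hp]
    · simpa [(Fin.succ_ne_zero j).symm] using hpA j
    · simpa [real_inner_comm] using hpA i
    · simpa using hA i j
  set M : Matrix (Fin (m + 1)) (Fin (m + 1)) ℝ :=
    Matrix.of fun r c => Fin.cons (α := fun _ => E (m + 1)) p A r c with hM
  have h1 : M * M.transpose = Matrix.diagonal (Fin.cons (α := fun _ => ℝ) 1 (fun _ => r ^ 2)) := by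
    ext i j
    rw [Matrix.diagonal_apply, ← hv, Matrix.mul_apply, PiLp.inner_apply]
    refine Finset.sum_congr rfl fun c _ => ?_
    simp [hM, mul_comm]
  have h2 := congrArg Matrix.det h1
  rw [Matrix.det_mul, Matrix.det_transpose, Matrix.det_diagonal, Fin.prod_univ_succ] at h2
  simp only [Fin.cons_zero, Fin.cons_succ, one_mul, Finset.prod_const, Finset.card_univ,
    Fintype.card_fin] at h2
  have h3 : jacDet p A = M.det := rfl
  rw [h3, ← Real.sqrt_sq_eq_abs, sq, h2, ← pow_mul, mul_comm, pow_mul,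
    Real.sqrt_sq (pow_nonneg hr m)]

/-- The cut-off inverse stereographic factor. -/
def profile {m : ℕ} (R : ℝ) (w : E m) : ℝ :=
  Real.smoothTransition (2 - ‖R⁻¹ • w‖ ^ 2) * rho w

theorem profile_eq_rho {m : ℕ} {R : ℝ} (hR : 0 < R) {w : E m} (hw : ‖w‖ ≤ R) :
    profile R w = rho w := by
  rw [profile, Real.smoothTransition.one_of_one_le, one_mul]
  have : ‖R⁻¹ • w‖ ≤ 1 := by
    rw [norm_smul, norm_inv, Real.norm_of_nonneg hR.le, inv_mul_le_iff₀ hR, mul_one]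
    exact hw
  nlinarith [norm_nonneg (R⁻¹ • w)]

theorem profile_eq_zero {m : ℕ} {R : ℝ} (hR : 0 < R) {w : E m} (hw : 2 * R ≤ ‖w‖) :
    profile R w = 0 := by
  rw [profile, Real.smoothTransition.zero_of_nonpos, zero_mul]
  have : 2 ≤ ‖R⁻¹ • w‖ := by
    rw [norm_smul, norm_inv, Real.norm_of_nonneg hR.le, le_inv_mul_iff₀ hR]
    linarith
  nlinarith

theorem isProfile_profile {m : ℕ} {R : ℝ} (hR : 0 < R) : IsProfile (profile (m := m) R) := by
  refine ⟨?_, fun w => mul_nonneg (Real.smoothTransition.nonneg _) (rho_pos w).le, ?_, 2 * R,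
    fun w hw => profile_eq_zero hR hw⟩
  · exact (Real.smoothTransition.contDiff.comp (contDiff_const.sub
      ((contDiff_id.const_smul R⁻¹).norm_sq ℝ))).mul contDiff_rho
  · rw [profile_eq_rho hR (by simpa using hR.le), rho]
    norm_num

theorem profile_congr_norm {m : ℕ} (R : ℝ) {w w' : E m} (h : ‖w‖ = ‖w'‖) :
    profile R w = profile R w' := by
  rw [profile, profile, rho, rho, norm_smul, norm_smul, h]

section Bubble

variable {m : ℕ} {b : E (m + 1)} {ι : E m →ₗᵢ[ℝ] E (m + 1)} {R : ℝ}

theorem preBubble_eq (κ : E m → ℝ) (w : E m) : preBubble b ι κ w = b + κ w • (ι w - b) := by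
  rw [preBubble]; module

/-- Inside the cut-off radius the unnormalised bubble is the inverse stereographic projection, which
already has norm one. -/
theorem bubble_profile_eq (h : IsFrame b ι) (hR : 0 < R) {w : E m} (hw : ‖w‖ ≤ R) :
    bubble b ι (profile R) w = b + stereoInv b ι w := by
  have h1 : preBubble b ι (profile R) w = b + stereoInv b ι w := by
    rw [preBubble_eq, profile_eq_rho hR hw, stereoInv]
  rw [bubble, h1, normalize_of_norm]
  rw [← sq_eq_sq₀ (norm_nonneg _) zero_le_one, h.norm_sq_eq, ← h1, proj_preBubble h,
    inner_preBubble h, profile_eq_rho hR hw, norm_smul, mul_pow, Real.norm_eq_abs, sq_abs]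
  linear_combination rho w * rho_mul w

theorem hasFDerivAt_bubble (h : IsFrame b ι) (hR : 0 < R) {w : E m} (hw : ‖w‖ < R) :
    HasFDerivAt (bubble b ι (profile R)) (stereoInvDeriv b ι w) w := by
  refine ((hasFDerivAt_stereoInv w).const_add b).congr_of_eventuallyEq ?_
  filter_upwards [continuous_norm.continuousAt.eventually_lt_const hw] with z hz
  exact bubble_profile_eq h hR hz.le

theorem grad_bubble (h : IsFrame b ι) (hR : 0 < R) {w : E m} (hw : ‖w‖ < R) (i : Fin m) :
    grad (bubble b ι (profile R)) w i = stereoInvDeriv b ι w (EuclideanSpace.single i 1) := by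
  rw [grad, pderiv, (hasFDerivAt_bubble h hR hw).fderiv]

/-- All partial derivatives have length `rho w`, so the Frobenius norm is `√m * rho w`. Together
with `abs_jacDet_bubble` this is the case of equality in `abs_jacDet_le_norm_pow`. -/
theorem norm_jac_bubble (h : IsFrame b ι) (hR : 0 < R) {w : E m} (hw : ‖w‖ < R) :
    ‖jac (bubble b ι (profile R)) w‖ ^ m = (m : ℝ) ^ ((m : ℝ) / 2) * rho w ^ m := by
  have h1 : ‖jac (bubble b ι (profile R)) w‖ ^ 2 = (√m * rho w) ^ 2 := by
    rw [PiLp.norm_sq_eq_of_L2, mul_pow, Real.sq_sqrt (Nat.cast_nonneg m)]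
    simp [jac, grad_bubble h hR hw, norm_stereoInvDeriv h]
  rw [(pow_left_inj₀ (norm_nonneg _) (mul_nonneg (Real.sqrt_nonneg _) (rho_pos w).le)
    two_ne_zero).1 h1, mul_pow, Real.sqrt_eq_rpow, ← Real.rpow_natCast, ← Real.rpow_mul
    (Nat.cast_nonneg m)]
  congr 2
  ring

theorem abs_jacDet_bubble (h : IsFrame b ι) (hR : 0 < R) {w : E m} (hw : ‖w‖ < R) :
    |jacDet (bubble b ι (profile R) w) (grad (bubble b ι (profile R)) w)| = rho w ^ m := by
  have hs := isSmoothMap_bubble h (isProfile_profile (m := m) hR)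
  refine abs_jacDet_of_orthogonal (rho_pos w).le (hs.norm_eq_one w)
    (fun i => inner_fderiv_eq_zero (hs.contDiff.differentiable (by simp) w) hs.norm_eq_one _)
    fun i j => ?_
  rw [grad_bubble h hR hw, grad_bubble h hR hw, inner_stereoInvDeriv h]
  by_cases hij : i = j
  · simp [hij]
  · simp [hij, EuclideanSpace.inner_single_left]

theorem injOn_bubble (h : IsFrame b ι) (hR : 0 < R) :
    Set.InjOn (bubble b ι (profile R)) (ball 0 R) := by
  intro w hw w' hw' heq
  rw [mem_ball_zero_iff] at hw hw'
  rw [bubble_profile_eq h hR hw.le, bubble_profile_eq h hR hw'.le, stereoInv, stereoInv] at heq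
  have h1 := congrArg (fun p => (inner ℝ b p : ℝ)) heq
  have h2 := congrArg (proj ι) heq
  simp only [inner_add_right, inner_smul_right, inner_sub_right, h.inner_eq_zero, h.inner_base]
    at h1
  simp only [map_add, map_smul, map_sub, proj_apply_self, h.proj_base] at h2
  have h3 : rho w = rho w' := by linarith
  rw [h3] at h2
  simpa [(rho_pos w').ne'] using h2

/-- The integrand is the Jacobian of an injective map to the sphere, and the cone over its image is
contained in the unit ball. -/
theorem setIntegral_rho_pow_le (h : IsFrame b ι) (hR : 0 < R) :
    ∫ w in ball (0 : E m) R, rho w ^ m ≤ (sphereArea m).toReal := by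
  have hs := isSmoothMap_bubble h (isProfile_profile (m := m) hR)
  have h1 := setIntegral_image_coneMap hs.contDiff hs.norm_eq_one measurableSet_ball
    (injOn_bubble h hR) fun _ => 1
  simp only [mul_one] at h1
  rw [setIntegral_congr_fun (g := fun w => rho w ^ m) measurableSet_ball fun w hw =>
    abs_jacDet_bubble h hR (mem_ball_zero_iff.1 hw)] at h1
  have h2 : ∫ z in coneMap (bubble b ι (profile R)) '' coneSet (ball 0 R), (1 : ℝ)
      ≤ volume.real (ball (0 : E (m + 1)) 1) := by
    rw [setIntegral_const, smul_eq_mul, mul_one]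
    exact measureReal_mono (coneMap_image_subset_ball hs.norm_eq_one _) measure_ball_lt_top.ne
  rw [sphereArea_toReal]
  have h3 : (0 : ℝ) < m + 1 := by positivity
  rw [h1, inv_mul_le_iff₀ h3] at h2
  exact h2

theorem setLIntegral_jac_bubble_le (h : IsFrame b ι) (hR : 0 < R) :
    ∫⁻ w in ball (0 : E m) R, ‖jac (bubble b ι (profile R)) w‖ₑ ^ m
      ≤ ENNReal.ofReal ((m : ℝ) ^ ((m : ℝ) / 2)) * sphereArea m := by
  have h1 : ∀ w ∈ ball (0 : E m) R, ‖jac (bubble b ι (profile R)) w‖ₑ ^ m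
      = ENNReal.ofReal ((m : ℝ) ^ ((m : ℝ) / 2)) * ENNReal.ofReal (rho w ^ m) := fun w hw => by
    rw [← ofReal_norm, ← ENNReal.ofReal_pow (norm_nonneg _),
      norm_jac_bubble h hR (mem_ball_zero_iff.1 hw), ENNReal.ofReal_mul (by positivity)]
  rw [setLIntegral_congr_fun measurableSet_ball h1,
    lintegral_const_mul _ (by exact (contDiff_rho.continuous.pow m).measurable.ennreal_ofReal)]
  gcongr
  rw [← ofReal_integral_eq_lintegral_ofReal, ← ENNReal.ofReal_toReal (sphereArea_ne_top m)]
  · exact ENNReal.ofReal_le_ofReal (setIntegral_rho_pow_le h hR)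
  · exact ((contDiff_rho.continuous.pow m).continuousOn.integrableOn_compact
      (isCompact_closedBall 0 R)).mono_set ball_subset_closedBall
  · exact Eventually.of_forall fun w => pow_nonneg (rho_pos w).le m

end Bubble

/-! ### The energy of a bubble near infinity -/

/-- Differentiate `u = |u| n` with `n` the normalised map. As `v = ∂ₑn` is orthogonal to `n`, `⟨v,
∂ₑu⟩ = |u| |v|²`, and Cauchy–Schwarz concludes. -/
theorem norm_mul_norm_fderiv_normalize_le {H F : Type*} [NormedAddCommGroup H] [NormedSpace ℝ H]
    [NormedAddCommGroup F] [InnerProductSpace ℝ F] {u : H → F} (hu : ∀ x, u x ≠ 0) {x : H}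
    (hd : DifferentiableAt ℝ u x) (e : H) :
    ‖u x‖ * ‖fderiv ℝ (fun z => normalize (u z)) x e‖ ≤ ‖fderiv ℝ u x e‖ := by
  have hn := hd.norm ℝ (hu x)
  have hf : DifferentiableAt ℝ (fun z => normalize (u z)) x :=
    (hn.inv (norm_ne_zero_iff.2 (hu x))).smul hd
  have h1 : u = fun z => ‖u z‖ • normalize (u z) := by
    funext z
    rw [normalize, smul_smul, mul_inv_cancel₀ (norm_ne_zero_iff.2 (hu z)), one_smul]
  have h2 : fderiv ℝ u x e = ‖u x‖ • fderiv ℝ (fun z => normalize (u z)) x e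
      + fderiv ℝ (fun z => ‖u z‖) x e • normalize (u x) := by
    have h3 := (hn.hasFDerivAt.smul hf.hasFDerivAt).fderiv
    have h4 : fderiv ℝ u x = fderiv ℝ (fun z => ‖u z‖ • normalize (u z)) x := by
      rw [← h1]
    rw [h4]
    erw [h3]
    simp
  set v := fderiv ℝ (fun z => normalize (u z)) x e with hv
  have h3 : (inner ℝ (normalize (u x)) v : ℝ) = 0 :=
    inner_fderiv_eq_zero hf (fun z => norm_normalize (hu z)) e
  have h4 : (inner ℝ v (fderiv ℝ u x e) : ℝ) = ‖u x‖ * ‖v‖ ^ 2 := by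
    rw [h2, inner_add_right, inner_smul_right, inner_smul_right, real_inner_comm (normalize (u x)), h3,
      real_inner_self_eq_norm_sq, mul_zero, add_zero]
  have h5 := real_inner_le_norm v (fderiv ℝ u x e)
  rcases (norm_nonneg v).eq_or_lt with h0 | h0
  · rw [← h0, mul_zero]
    exact norm_nonneg _
  · refine le_of_mul_le_mul_left ?_ h0
    linarith [h4, sq ‖v‖]

theorem norm_jac_le {m : ℕ} {f : E m → E (m + 1)} {x : E m} {K : ℝ} (hK : 0 ≤ K)
    (h : ∀ e, ‖fderiv ℝ f x e‖ ≤ K * ‖e‖) : ‖jac f x‖ ≤ √m * K := by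
  refine le_of_sq_le_sq ?_ (by positivity)
  rw [PiLp.norm_sq_eq_of_L2, mul_pow, Real.sq_sqrt (Nat.cast_nonneg m)]
  have : ∀ i : Fin m, ‖jac f x i‖ ^ 2 ≤ K ^ 2 := fun i => by
    have := h (EuclideanSpace.single i 1)
    rw [PiLp.norm_single, norm_one, mul_one] at this
    exact pow_le_pow_left₀ (norm_nonneg _) this 2
  calc _ ≤ ∑ _i : Fin m, K ^ 2 := Finset.sum_le_sum fun i _ => this i
    _ = _ := by simp

theorem jac_eq_zero {m : ℕ} {f : E m → E (m + 1)} {x : E m} (h : fderiv ℝ f x = 0) :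
    jac f x = 0 := by
  ext1 i
  exact grad_eq_zero h i

theorem exists_norm_fderiv_cutoff_le (m : ℕ) :
    ∃ C, 0 ≤ C ∧ ∀ z : E m,
      ‖fderiv ℝ (fun z : E m => Real.smoothTransition (2 - ‖z‖ ^ 2)) z‖ ≤ C := by
  set T := fun z : E m => Real.smoothTransition (2 - ‖z‖ ^ 2) with hT
  have hsm : ContDiff ℝ ∞ T :=
    Real.smoothTransition.contDiff.comp (contDiff_const.sub (contDiff_id.norm_sq ℝ))
  have hc : HasCompactSupport T := hasCompactSupport_of_forall_norm (R := 2) fun x hx =>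
    Real.smoothTransition.zero_of_nonpos (by nlinarith)
  obtain ⟨C, hC⟩ := (hsm.continuous_fderiv (by simp)).bounded_above_of_compact_support
    (hc.fderiv ℝ)
  exact ⟨C, (norm_nonneg _).trans (hC 0), hC⟩

/-- Beyond radius `R` the conformal factor is of order `R⁻²`; the gradient of the cut-off, of order
`R⁻¹`, multiplies `stereoInv`, also of order `R⁻¹`. The condition `4 ≤ R` makes the perturbation of
`b` at most `1 / 2`, so normalising costs at most a factor `2`. -/
theorem exists_norm_jac_bubble_le {m : ℕ} {b : E (m + 1)} {ι : E m →ₗᵢ[ℝ] E (m + 1)}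
    (h : IsFrame b ι) :
    ∃ K, 0 ≤ K ∧ ∀ R, 4 ≤ R → ∀ w : E m, R ≤ ‖w‖ →
      ‖jac (bubble b ι (profile R)) w‖ ≤ K / R ^ 2 := by
  obtain ⟨C, hC0, hC⟩ := exists_norm_fderiv_cutoff_le m
  refine ⟨√m * (4 * (C + 1)), by positivity, fun R hR w hw => ?_⟩
  have hR0 : 0 < R := by linarith
  set T := fun z : E m => Real.smoothTransition (2 - ‖z‖ ^ 2) with hT
  have hsm : ContDiff ℝ ∞ T :=
    Real.smoothTransition.contDiff.comp (contDiff_const.sub (contDiff_id.norm_sq ℝ))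
  have hpre : preBubble b ι (profile R) = fun w => b + T (R⁻¹ • w) • stereoInv b ι w := by
    funext w
    rw [preBubble_eq, profile, stereoInv, smul_smul]
  have hρ : rho w ≤ 2 / R ^ 2 := by
    rw [rho]
    gcongr
    nlinarith
  have hq : ‖stereoInv b ι w‖ ≤ 2 / R := by
    refine le_of_sq_le_sq ?_ (by positivity)
    rw [norm_stereoInv_sq h, div_pow]
    calc 2 * rho w ≤ 2 * (2 / R ^ 2) := by gcongr
      _ = _ := by ring
  have hT1 : ∀ z, |T z| ≤ 1 := fun z => by
    rw [abs_of_nonneg (Real.smoothTransition.nonneg _)]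
    exact Real.smoothTransition.le_one _
  have hne := preBubble_ne_zero (κ := profile R) h (isProfile_profile (m := m) hR0).one_lt.ne'
  have hnorm : 1 / 2 ≤ ‖preBubble b ι (profile R) w‖ := by
    rw [hpre]
    have h1 : ‖T (R⁻¹ • w) • stereoInv b ι w‖ ≤ 1 / 2 := by
      rw [norm_smul, Real.norm_eq_abs]
      calc _ ≤ 1 * (2 / R) := mul_le_mul (hT1 _) hq (norm_nonneg _) zero_le_one
        _ ≤ 1 / 2 := by
          rw [one_mul, div_le_div_iff₀ hR0 two_pos]
          linarith
    have h2 := norm_sub_norm_le b (-(T (R⁻¹ • w) • stereoInv b ι w))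
    rw [sub_neg_eq_add, norm_neg, h.norm_eq_one] at h2
    simp only
    linarith
  have hder : HasFDerivAt (preBubble b ι (profile R))
      (T (R⁻¹ • w) • stereoInvDeriv b ι w +
        ((fderiv ℝ T (R⁻¹ • w)).comp (R⁻¹ • ContinuousLinearMap.id ℝ (E m))).smulRight
          (stereoInv b ι w)) w := by
    rw [hpre]
    have h1 : HasFDerivAt (fun w : E m => R⁻¹ • w) (R⁻¹ • ContinuousLinearMap.id ℝ (E m)) w :=
      (hasFDerivAt_id w).const_smul R⁻¹
    have h2 : HasFDerivAt (fun w : E m => T (R⁻¹ • w))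
        ((fderiv ℝ T (R⁻¹ • w)).comp (R⁻¹ • ContinuousLinearMap.id ℝ (E m))) w :=
      ((hsm.differentiable (by simp) _).hasFDerivAt).comp w h1
    exact (h2.smul (hasFDerivAt_stereoInv w)).const_add b
  rw [mul_div_assoc]
  refine norm_jac_le (by positivity) fun e => ?_
  have h1 := norm_mul_norm_fderiv_normalize_le hne hder.differentiableAt e
  have h2 : ‖fderiv ℝ (preBubble b ι (profile R)) w e‖ ≤ 2 * (C + 1) / R ^ 2 * ‖e‖ := by
    rw [hder.fderiv]
    have h3 : ‖T (R⁻¹ • w) • stereoInvDeriv b ι w e‖ ≤ 2 / R ^ 2 * ‖e‖ := by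
      rw [norm_smul, norm_stereoInvDeriv h, Real.norm_eq_abs]
      calc _ ≤ 1 * (2 / R ^ 2 * ‖e‖) := by
            gcongr
            · exact mul_nonneg (rho_pos w).le (norm_nonneg _)
            · exact hT1 _
        _ = _ := one_mul _
    have h4 : ‖(fderiv ℝ T (R⁻¹ • w)) (R⁻¹ • e) • stereoInv b ι w‖ ≤ C * (R⁻¹ * ‖e‖) * (2 / R) := by
      rw [norm_smul]
      refine mul_le_mul ?_ hq (norm_nonneg _) (by positivity)
      refine (ContinuousLinearMap.le_opNorm _ _).trans ?_
      rw [norm_smul, norm_inv, Real.norm_of_nonneg hR0.le]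
      gcongr
      exact hC _
    calc _ ≤ ‖T (R⁻¹ • w) • stereoInvDeriv b ι w e‖
          + ‖(fderiv ℝ T (R⁻¹ • w)) (R⁻¹ • e) • stereoInv b ι w‖ := norm_add_le _ _
      _ ≤ 2 / R ^ 2 * ‖e‖ + C * (R⁻¹ * ‖e‖) * (2 / R) := add_le_add h3 h4
      _ = _ := by field_simp; ring
  have h3 : 1 / 2 * ‖fderiv ℝ (bubble b ι (profile R)) w e‖ ≤ 2 * (C + 1) / R ^ 2 * ‖e‖ :=
    ((mul_le_mul_of_nonneg_right hnorm (norm_nonneg _)).trans h1).trans h2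
  calc _ ≤ 2 * (2 * (C + 1) / R ^ 2 * ‖e‖) := by linarith
    _ = _ := by ring

/-- There are bubbles with energy almost `m^(m/2) |S^m|`. -/
theorem eventually_lintegral_jac_bubble_le {m : ℕ} (hm : 2 ≤ m) {b : E (m + 1)}
    {ι : E m →ₗᵢ[ℝ] E (m + 1)} (h : IsFrame b ι) {ε : ℝ≥0∞} (hε : 0 < ε) :
    ∀ᶠ R : ℝ in atTop, ∫⁻ w, ‖jac (bubble b ι (profile R)) w‖ₑ ^ m
      ≤ ENNReal.ofReal ((m : ℝ) ^ ((m : ℝ) / 2)) * sphereArea m + ε := by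
  obtain ⟨K, hK, hjac⟩ := exists_norm_jac_bubble_le h
  have hm0 : m ≠ 0 := by omega
  -- The energy outside radius `R` is at most `(K / R²) ^ m` times the volume of the ball of radius
  -- `2 R`, off which the bubble is constant.
  have hlim : Tendsto (fun R : ℝ => ENNReal.ofReal ((2 * K * R⁻¹) ^ m) * volume (ball (0 : E m) 1))
      atTop (𝓝 0) := by
    have h1 : Tendsto (fun R : ℝ => (2 * K * R⁻¹) ^ m) atTop (𝓝 0) := by
      have := (tendsto_inv_atTop_zero.const_mul (2 * K)).pow m
      rwa [mul_zero, zero_pow hm0] at this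
    have h2 := ENNReal.tendsto_ofReal h1
    rw [ENNReal.ofReal_zero] at h2
    have h3 := ENNReal.Tendsto.mul_const (b := volume (ball (0 : E m) 1)) h2
      (Or.inr measure_ball_lt_top.ne)
    rwa [zero_mul] at h3
  filter_upwards [hlim.eventually_lt_const hε, eventually_ge_atTop 4] with R hRε hR
  have hR0 : 0 < R := by linarith
  rw [← lintegral_add_compl _ (measurableSet_ball (x := (0 : E m)) (ε := R))]
  refine add_le_add (setLIntegral_jac_bubble_le h hR0) (le_trans ?_ hRε.le)
  have hout : ∀ w ∈ (ball (0 : E m) R)ᶜ, ‖jac (bubble b ι (profile R)) w‖ₑ ^ m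
      ≤ (closedBall (0 : E m) (2 * R)).indicator (fun _ => ENNReal.ofReal ((K / R ^ 2) ^ m)) w := by
    intro w hw
    by_cases hw2 : w ∈ closedBall (0 : E m) (2 * R)
    · rw [Set.indicator_of_mem hw2, ← ofReal_norm, ← ENNReal.ofReal_pow (norm_nonneg _)]
      refine ENNReal.ofReal_le_ofReal (pow_le_pow_left₀ (norm_nonneg _) (hjac R hR w ?_) m)
      simpa using hw
    · rw [Set.indicator_of_notMem hw2, jac_eq_zero, enorm_zero, zero_pow hm0]
      refine fderiv_eq_zero_of_norm_gt (R := 2 * R) (b := b)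
        (fun x hx => bubble_eq_base h (profile_eq_zero hR0 hx)) ?_
      simpa using hw2
  calc ∫⁻ w in (ball (0 : E m) R)ᶜ, ‖jac (bubble b ι (profile R)) w‖ₑ ^ m
      ≤ ∫⁻ w in (ball (0 : E m) R)ᶜ,
        (closedBall (0 : E m) (2 * R)).indicator (fun _ => ENNReal.ofReal ((K / R ^ 2) ^ m)) w :=
        setLIntegral_mono' measurableSet_ball.compl hout
    _ ≤ ∫⁻ w, (closedBall (0 : E m) (2 * R)).indicator
        (fun _ => ENNReal.ofReal ((K / R ^ 2) ^ m)) w := setLIntegral_le_lintegral _ _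
    _ = ENNReal.ofReal ((K / R ^ 2) ^ m) * volume (closedBall (0 : E m) (2 * R)) := by
        rw [lintegral_indicator measurableSet_closedBall, setLIntegral_const]
    _ = _ := by
        rw [Measure.addHaar_closedBall _ _ (by positivity), ← mul_assoc,
          ← ENNReal.ofReal_mul (by positivity), finrank_euclideanSpace_fin, ← mul_pow]
        congr 3
        field_simp

/-! ### Superpositions of bubbles -/

/-- Because the exponent equals the dimension, the factor `L ^ m` from the derivative cancels the
Jacobian of the dilation. -/
theorem lintegral_jac_comp_smul_sub {m : ℕ} {f : E m → E (m + 1)} (hf : ContDiff ℝ ∞ f) {L : ℝ}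
    (hL : 0 < L) (c : E m) :
    ∫⁻ x, ‖jac (fun x => f (L • (x - c))) x‖ₑ ^ m = ∫⁻ x, ‖jac f x‖ₑ ^ m := by
  have h1 : ∀ x, jac (fun x => f (L • (x - c))) x = L • jac f (L • (x - c)) := fun x => by
    have h2 : HasFDerivAt (fun x => f (L • (x - c)))
        ((fderiv ℝ f (L • (x - c))).comp (L • ContinuousLinearMap.id ℝ (E m))) x :=
      ((hf.differentiable (by simp) _).hasFDerivAt).comp x
        (((hasFDerivAt_id x).sub_const c).const_smul L)
    ext1 i
    simp [jac, grad, pderiv, h2.fderiv]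
  have h2 : ∀ x, ‖jac (fun x => f (L • (x - c))) x‖ₑ ^ m
      = ENNReal.ofReal (L ^ m) * ‖jac f (L • (x - c))‖ₑ ^ m := fun x => by
    rw [h1, enorm_smul, mul_pow, Real.enorm_of_nonneg hL.le, ENNReal.ofReal_pow hL.le]
  simp_rw [h2]
  rw [lintegral_const_mul' _ _ ENNReal.ofReal_ne_top,
    lintegral_sub_right_eq_self (fun x => ‖jac f (L • x)‖ₑ ^ m) c]
  have h3 := lintegral_map_equiv (μ := (volume : Measure (E m)))
    (fun x => ‖jac f x‖ₑ ^ m) (MeasurableEquiv.smul₀ L hL.ne')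
  have h4 : Measure.map (MeasurableEquiv.smul₀ L hL.ne') (volume : Measure (E m))
    = ENNReal.ofReal (abs (L ^ m)⁻¹) • volume := by
    have := Measure.map_addHaar_smul (volume : Measure (E m)) hL.ne'
    rwa [finrank_euclideanSpace_fin] at this
  rw [h4, lintegral_smul_measure] at h3
  have h5 : ∫⁻ x, ‖jac f (L • x)‖ₑ ^ m
    = ENNReal.ofReal (abs (L ^ m)⁻¹) * ∫⁻ x, ‖jac f x‖ₑ ^ m := h3.symm
  rw [h5, ← mul_assoc, ← ENNReal.ofReal_mul (by positivity), abs_of_pos (by positivity),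
    mul_inv_cancel₀ (by positivity), ENNReal.ofReal_one, one_mul]

/-- At each point at most one of the maps has a nonzero derivative. -/
theorem IsSeparated.fderiv_cases {m : ℕ} {b : S m} {t : Finset (E m)} {r : ℝ}
    {ψ : E m → E m → E (m + 1)} (h : IsSeparated b t r ψ)
    (hlt : ∀ c ∈ t, ∀ c' ∈ t, c ≠ c' → 2 * r < ‖c - c'‖) (x : E m) :
    (∀ c ∈ t, fderiv ℝ (ψ c) x = 0) ∨
      ∃ c ∈ t, bubbleSum b t ψ x = ψ c x ∧ ∀ c' ∈ t, c' ≠ c → fderiv ℝ (ψ c') x = 0 := by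
  have hfd : ∀ c ∈ t, r < ‖x - c‖ → fderiv ℝ (ψ c) x = 0 := fun c hc hx => by
    have : ψ c =ᶠ[𝓝 x] fun _ => (b : E (m + 1)) := by
      have hcont : Continuous fun z : E m => ‖z - c‖ := by fun_prop
      filter_upwards [hcont.continuousAt.eventually_const_lt hx] with z hz
      exact h.eq_base c hc z hz.le
    rw [this.fderiv_eq, fderiv_const_apply]
  by_cases hx : ∀ c ∈ t, r < ‖x - c‖
  · exact Or.inl fun c hc => hfd c hc (hx c hc)
  · push Not at hx
    obtain ⟨c, hc, hxc⟩ := hx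
    -- Strict separation matters here: even for `x` on the boundary of the ball about `c`, every
    -- other `ψ c'` is constant in a neighbourhood of `x`.
    have hother : ∀ c' ∈ t, c' ≠ c → r < ‖x - c'‖ := fun c' hc' hne => by
      have h1 := hlt c' hc' c hc hne
      have h2 := norm_sub_le (x - c) (x - c')
      rw [sub_sub_sub_cancel_left] at h2
      linarith
    refine Or.inr ⟨c, hc, ?_, fun c' hc' hne => hfd c' hc' (hother c' hc' hne)⟩
    rw [bubbleSum, Finset.sum_eq_single_of_mem c hc, add_sub_cancel]
    intro c' hc' hne
    rw [h.eq_base c' hc' x (hother c' hc' hne).le, sub_self]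

theorem grad_bubbleSum {m : ℕ} {b : S m} {t : Finset (E m)} {ψ : E m → E m → E (m + 1)}
    (hψ : ∀ c ∈ t, IsSmoothMap (b : E (m + 1)) (ψ c)) (x : E m) (i : Fin m) :
    grad (bubbleSum b t ψ) x i = ∑ c ∈ t, grad (ψ c) x i := by
  have h : HasFDerivAt (bubbleSum (b : S m) t ψ) (∑ c ∈ t, fderiv ℝ (ψ c) x) x :=
    (HasFDerivAt.fun_sum fun c hc =>
      (((hψ c hc).contDiff.differentiable (by simp) x).hasFDerivAt.sub_const _)).const_add _
  simp [grad, pderiv, h.fderiv]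

theorem IsSeparated.sum_jac {m : ℕ} (hm : 2 ≤ m) {b : S m} {t : Finset (E m)} {r : ℝ}
    {ψ : E m → E m → E (m + 1)} (h : IsSeparated b t r ψ)
    (hlt : ∀ c ∈ t, ∀ c' ∈ t, c ≠ c' → 2 * r < ‖c - c'‖)
    (hψ : ∀ c ∈ t, IsSmoothMap (b : E (m + 1)) (ψ c)) (x : E m) :
    ‖jac (bubbleSum b t ψ) x‖ₑ ^ m = ∑ c ∈ t, ‖jac (ψ c) x‖ₑ ^ m ∧
      jacDet (bubbleSum b t ψ x) (grad (bubbleSum b t ψ) x)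
        = ∑ c ∈ t, jacDet (ψ c x) (grad (ψ c) x) := by
  have hm0 : m ≠ 0 := by omega
  have hz : ∀ (c : E m) (p : E (m + 1)), fderiv ℝ (ψ c) x = 0 → jacDet p (grad (ψ c) x) = 0 :=
    fun c p hc => jacDet_eq_zero_of_eq_zero p (i := ⟨0, by omega⟩) (grad_eq_zero hc _)
  rcases h.fderiv_cases hlt x with h0 | ⟨c, hc, hF, h0⟩
  · have hg : ∀ i, grad (bubbleSum b t ψ) x i = 0 := fun i => by
      rw [grad_bubbleSum hψ, Finset.sum_eq_zero fun c hc => grad_eq_zero (h0 c hc) i]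
    constructor
    · have : jac (bubbleSum b t ψ) x = 0 := by
        ext1 i
        exact hg i
      rw [this, enorm_zero, zero_pow hm0, Finset.sum_eq_zero]
      intro c hc
      rw [jac_eq_zero (h0 c hc), enorm_zero, zero_pow hm0]
    · rw [jacDet_eq_zero_of_eq_zero _ (hg ⟨0, by omega⟩), Finset.sum_eq_zero]
      exact fun c hc => hz c _ (h0 c hc)
  · have hg : grad (bubbleSum b t ψ) x = grad (ψ c) x := by
      funext i
      rw [grad_bubbleSum hψ, Finset.sum_eq_single_of_mem c hc]
      exact fun c' hc' hne => grad_eq_zero (h0 c' hc' hne) i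
    constructor
    · rw [Finset.sum_eq_single_of_mem c hc, jac, jac, hg]
      intro c' hc' hne
      rw [jac_eq_zero (h0 c' hc' hne), enorm_zero, zero_pow hm0]
    · rw [Finset.sum_eq_single_of_mem c hc, hg, hF]
      exact fun c' hc' hne => hz c' _ (h0 c' hc' hne)

/-! ### Maps of small energy in every homotopy class -/

theorem IsSmoothMap.integrable_jacDet {m : ℕ} (hm : 2 ≤ m) {b : E (m + 1)} {f : E m → E (m + 1)}
    (hf : IsSmoothMap b f) : Integrable fun x => jacDet (f x) (grad f x) :=
  (integrable_of_contDiff_of_grad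
    (contDiff_jacDet hf.contDiff (contDiff_grad hf.contDiff)).continuous
    hf.hasCompactSupport_fderiv fun _ hx =>
      jacDet_eq_zero_of_eq_zero _ (i := ⟨0, by omega⟩) (grad_eq_zero hx _)).2

theorem measurable_enorm_jac_pow {m : ℕ} {f : E m → E (m + 1)} (hf : ContDiff ℝ ∞ f) :
    Measurable fun x => ‖jac f x‖ₑ ^ m := by
  have h : Continuous fun x => jac f x :=
    (PiLp.continuous_toLp 2 _).comp (continuous_pi fun i => (contDiff_grad hf i).continuous)
  exact h.enorm.measurable.pow_const m

/-- The points at which the copies of a bubble are placed. -/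
theorem exists_centers {m : ℕ} (hm : 2 ≤ m) (n : ℕ) :
    ∃ (t : Finset (E m)) (r : ℝ), 0 < r ∧ t.card = n ∧
      (∀ c ∈ t, ∀ c' ∈ t, ∀ i, c i ≠ c' i → 2 * r < |c i - c' i|) ∧ ∀ c ∈ t, ‖c‖ + r ≤ 1 := by
  classical
  let i₀ : Fin m := ⟨0, by omega⟩
  -- The centres are `0, d, …, (n - 1) d` on the first axis. They stay within distance `1 / 2` of
  -- the origin, and the radius `d / 4` satisfies `2 (d / 4) < d`.
  let d : ℝ := 1 / (2 * (n + 1))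
  have hd : 0 < d := by positivity
  let g : ℕ → E m := fun j => EuclideanSpace.single i₀ (j * d)
  have hsep : ∀ j j' : ℕ, ∀ i, g j i ≠ g j' i → 2 * (d / 4) < |g j i - g j' i| := by
    intro j j' i hne
    by_cases hi : i = i₀
    · subst hi
      simp only [g, PiLp.single_apply, if_true] at hne ⊢
      have hjj : (j : ℤ) - j' ≠ 0 := fun h => hne (by
        have : (j : ℤ) = j' := by omega
        have : j = j' := by exact_mod_cast this
        rw [this])
      have h1 : (1 : ℝ) ≤ |(j : ℝ) - j'| := by exact_mod_cast Int.one_le_abs hjj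
      rw [← sub_mul, abs_mul, abs_of_pos hd]
      nlinarith
    · exact absurd (by simp [g, hi]) hne
  have hinj : Function.Injective g := by
    intro j j' h
    have := congrArg (fun p : E m => p i₀) h
    simp only [g, PiLp.single_apply, if_true] at this
    exact_mod_cast mul_right_cancel₀ hd.ne' this
  refine ⟨(Finset.range n).image g, d / 4, by positivity, ?_, ?_, ?_⟩
  · rw [Finset.card_image_of_injective _ hinj, Finset.card_range]
  · intro c hc c' hc'
    obtain ⟨j, -, rfl⟩ := Finset.mem_image.1 hc
    obtain ⟨j', -, rfl⟩ := Finset.mem_image.1 hc'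
    exact hsep j j'
  · intro c hc
    obtain ⟨j, hj, rfl⟩ := Finset.mem_image.1 hc
    have hj' : (j : ℝ) ≤ n := by exact_mod_cast (Finset.mem_range.1 hj).le
    simp only [g, PiLp.norm_single, Real.norm_eq_abs, abs_mul, abs_of_pos hd, Nat.abs_cast]
    have h1 : (n + 1) * d = 1 / 2 := by simp only [d]; field_simp
    nlinarith

/-- The superposition of `n` rescaled copies of a map. -/
theorem exists_power {m : ℕ} (hm : 2 ≤ m) [Nontrivial (Fin m)] {b : S m} {f : E m → E (m + 1)}
    (hf : IsSmoothMap (b : E (m + 1)) f) (n : ℕ) :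
    ∃ (F : E m → E (m + 1)) (hF : IsSmoothMap (b : E (m + 1)) F),
      (∀ x, 1 ≤ ‖x‖ → F x = b) ∧ cls hF.isContMap = cls hf.isContMap ^ n ∧
      degInt F = n * degInt f ∧ ∫⁻ x, ‖jac F x‖ₑ ^ m = n * ∫⁻ x, ‖jac f x‖ₑ ^ m := by
  obtain ⟨t, r, hr, hcard, hsep, hnorm⟩ := exists_centers hm n
  obtain ⟨R, hR⟩ := hf.eq_base
  let L : ℝ := max R 1 / r
  have hL : 0 < L := div_pos (lt_max_of_lt_right one_pos) hr
  let f' : E m → E (m + 1) := fun x => f (L • x)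
  let ψ : E m → E m → E (m + 1) := fun c x => f (L • (x - c))
  have hbase : ∀ x : E m, r ≤ ‖x‖ → f (L • x) = b := fun x hx => hR _ (by
    rw [norm_smul, Real.norm_of_nonneg hL.le]
    calc R ≤ max R 1 := le_max_left _ _
      _ = L * r := (div_mul_cancel₀ _ hr.ne').symm
      _ ≤ _ := mul_le_mul_of_nonneg_left hx hL.le)
  have hf' : IsSmoothMap (b : E (m + 1)) f' :=
    ⟨hf.contDiff.comp (contDiff_id.const_smul L), fun x => hf.norm_eq_one _, r, hbase⟩
  have hψ : ∀ c, IsSmoothMap (b : E (m + 1)) (ψ c) := fun c =>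
    ⟨hf'.contDiff.comp (contDiff_id.sub contDiff_const), fun x => hf.norm_eq_one _,
      (hf'.isContMap.comp_sub c).eq_base⟩
  have hlt : ∀ c ∈ t, ∀ c' ∈ t, c ≠ c' → 2 * r < ‖c - c'‖ := fun c hc c' hc' hne => by
    obtain ⟨i, hi⟩ : ∃ i, c i ≠ c' i := by
      by_contra! h
      exact hne (by ext i; exact h i)
    refine (hsep c hc c' hc' i hi).trans_le ?_
    simpa using PiLp.norm_apply_le (c - c') i
  have hS : IsSeparated b t r ψ :=
    ⟨fun c hc c' hc' hne => (hlt c hc c' hc' hne).le, fun c _ x hx => hbase _ hx⟩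
  have hF := hS.isSmoothMap fun c _ => hψ c
  have hcls : ∀ c, cls (hψ c).isContMap = cls hf.isContMap := fun c =>
    (cls_comp_sub hf'.isContMap (hψ c).isContMap c fun x => rfl).trans
      (cls_comp_smul hf.isContMap hf'.isContMap hL fun x => rfl)
  have hsum := hS.sum_jac hm hlt fun c _ => hψ c
  refine ⟨bubbleSum b t ψ, hF, fun x hx => bubbleSum_eq_base fun c hc => hbase _ ?_, ?_, ?_, ?_⟩
  · have h1 := norm_sub_norm_le x c
    have h2 := hnorm c hc
    linarith
  · rw [cls_bubbleSum (e := fun _ => cls hf.isContMap) t hsep hS (fun c _ => (hψ c).isContMap)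
      (fun c _ => hcls c) hF.isContMap, Finset.prod_const, hcard]
  · rw [degInt, integral_congr_ae (Eventually.of_forall fun x => (hsum x).2),
      integral_finsetSum _ fun c _ => (hψ c).integrable_jacDet hm]
    have : ∀ c ∈ t, ∫ x, jacDet (ψ c x) (grad (ψ c) x) = degInt f := fun c _ =>
      degInt_eq_of_cls_eq hm (hψ c) hf (hcls c)
    rw [Finset.sum_congr rfl this, Finset.sum_const, hcard, nsmul_eq_mul]
  · rw [lintegral_congr fun x => (hsum x).1,
      lintegral_finsetSum _ fun c _ => measurable_enorm_jac_pow (hψ c).contDiff]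
    rw [Finset.sum_congr rfl fun c _ => lintegral_jac_comp_smul_sub hf.contDiff hL c,
      Finset.sum_const, hcard, nsmul_eq_mul]

/-- The degree of a bubble is not zero. -/
theorem le_abs_degInt_bubble {m : ℕ} (hm : 2 ≤ m) {b : E (m + 1)}
    {ι : E m →ₗᵢ[ℝ] E (m + 1)} (h : IsFrame b ι) {R : ℝ} (hR : 0 < R) :
    (sphereArea m).toReal ≤ |degInt (bubble b ι (profile R))| := by
  have hp := isProfile_profile (m := m) hR
  have hs := isSmoothMap_bubble h hp
  have hpre : ∀ w, bubble b ι (profile R) w = -b ↔ w = 0 := by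
    intro w
    constructor
    · intro hw
      have h1 := congrArg (proj ι) hw
      rw [proj_bubble h, map_neg, h.proj_base, neg_zero] at h1
      rcases smul_eq_zero.1 h1 with h2 | h2
      · have h3 : profile R w = 0 := (mul_eq_zero.1 h2).resolve_left
          (inv_ne_zero (norm_ne_zero_iff.2 (preBubble_ne_zero h hp.one_lt.ne' w)))
        rw [bubble_eq_base h h3] at hw
        exact absurd hw (ne_neg_of_norm h.norm_eq_one)
      · exact h2
    · rintro rfl
      exact bubble_zero h hp.one_lt
  have hJ : orientedJacobian (bubble b ι (profile R)) 0 ≠ 0 := by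
    rw [orientedJacobian_eq, ← abs_ne_zero, abs_jacDet_bubble h hR (by simpa using hR)]
    exact pow_ne_zero _ (rho_pos _).ne'
  have hreg : IsRegularValue (bubble b ι (profile R)) (-b) := fun x hx => by
    rw [(hpre x).1 hx]
    exact hJ
  -- The regular value `-b` has the origin as its only preimage, so the signed count is a nonzero
  -- integer; its sign is not needed.
  rw [degInt_eq_signedCount hm hs (y := -b) (by rw [norm_neg, h.norm_eq_one])
    (ne_neg_of_norm h.norm_eq_one).symm hreg, abs_mul, abs_of_pos (sphereArea_toReal_pos m)]
  have hset : {x | bubble b ι (profile R) x = -b} = {0} := by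
    ext x
    exact hpre x
  have hcount : signedCount (bubble b ι (profile R)) (-b) ≠ 0 := by
    rw [signedCount, hset, finsum_mem_singleton]
    rcases lt_or_gt_of_ne hJ with h1 | h1
    · rw [sign_neg h1]; decide
    · rw [sign_pos h1]; decide
  have : (1 : ℝ) ≤ |(signedCount (bubble b ι (profile R)) (-b) : ℝ)| := by
    exact_mod_cast Int.one_le_abs hcount
  exact le_mul_of_one_le_right (sphereArea_toReal_pos m).le this

/-- The reflection of `ℝ^m` in a coordinate hyperplane. -/
def coordReflection {m : ℕ} (i : Fin m) : E m →ₗᵢ[ℝ] E m :=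
  (LinearIsometryEquiv.piLpCongrRight 2 fun j : Fin m =>
    if j = i then LinearIsometryEquiv.neg ℝ else LinearIsometryEquiv.refl ℝ ℝ).toLinearIsometry

theorem coordReflection_apply {m : ℕ} (i : Fin m) (x : E m) :
    coordReflection i x = x - (2 * x i) • EuclideanSpace.single i 1 := by
  ext j
  by_cases hj : j = i
  · subst hj
    simp [coordReflection]
    ring
  · simp [coordReflection, hj]

theorem bubble_comp_reflection {m : ℕ} {b : E (m + 1)} {ι : E m →ₗᵢ[ℝ] E (m + 1)} (R : ℝ)
    (i : Fin m) (x : E m) :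
    bubble b (ι.comp (coordReflection i)) (profile R) x
      = bubble b ι (profile R) (coordReflection i x) := by
  rw [bubble, bubble, preBubble, preBubble,
    profile_congr_norm R ((coordReflection i).norm_map x)]
  rfl

/-- Every homotopy class contains smooth maps whose energy is almost the lower bound. -/
theorem exists_smooth_lintegral_le {m : ℕ} (hm : 2 ≤ m) {b : S m} (σ : π_ m (S m) b)
    {ε : ℝ≥0∞} (hε : 0 < ε) :
    ∃ (F : E m → E (m + 1)) (hF : IsSmoothMap (b : E (m + 1)) F) (n : ℕ),
      (∀ x, 1 ≤ ‖x‖ → F x = b) ∧ cls hF.isContMap = σ ∧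
      n * (sphereArea m).toReal ≤ |degInt F| ∧
      ∫⁻ x, ‖jac F x‖ₑ ^ m
        ≤ n * (ENNReal.ofReal ((m : ℝ) ^ ((m : ℝ) / 2)) * sphereArea m + ε) := by
  have : Nontrivial (Fin m) := Fin.nontrivial_iff_two_le.2 hm
  obtain ⟨ι, hι⟩ := exists_isometry_orthogonal (norm_base b)
  have hι : IsFrame (b : E (m + 1)) ι := ⟨norm_base b, hι⟩
  let i₀ : Fin m := ⟨0, by omega⟩
  -- Reflecting the frame gives a bubble of the inverse class that obeys the same estimates, so
  -- negative powers become positive powers of this second bubble.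
  have hι' : IsFrame (b : E (m + 1)) (ι.comp (coordReflection i₀)) :=
    ⟨norm_base b, fun x => hι.inner_eq_zero _⟩
  obtain ⟨R, ⟨he, he'⟩, hR⟩ := (((eventually_lintegral_jac_bubble_le hm hι hε).and
    (eventually_lintegral_jac_bubble_le hm hι' hε)).and (eventually_gt_atTop 0)).exists
  have hβ := isSmoothMap_bubble hι (isProfile_profile (m := m) hR)
  have hβ' := isSmoothMap_bubble hι' (isProfile_profile (m := m) hR)
  have hinv : cls hβ'.isContMap = (cls hβ.isContMap)⁻¹ :=
    cls_reflect _ _ i₀ fun x => by rw [bubble_comp_reflection, coordReflection_apply]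
  have key : ∀ {f : E m → E (m + 1)} (hf : IsSmoothMap (b : E (m + 1)) f) (n : ℕ),
      σ = cls hf.isContMap ^ n → (sphereArea m).toReal ≤ |degInt f| →
      ∫⁻ x, ‖jac f x‖ₑ ^ m ≤ ENNReal.ofReal ((m : ℝ) ^ ((m : ℝ) / 2)) * sphereArea m + ε →
      ∃ (F : E m → E (m + 1)) (hF : IsSmoothMap (b : E (m + 1)) F) (n : ℕ),
      (∀ x, 1 ≤ ‖x‖ → F x = b) ∧ cls hF.isContMap = σ ∧
      n * (sphereArea m).toReal ≤ |degInt F| ∧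
      ∫⁻ x, ‖jac F x‖ₑ ^ m
        ≤ n * (ENNReal.ofReal ((m : ℝ) ^ ((m : ℝ) / 2)) * sphereArea m + ε) := by
    intro f hf n hσ hdeg hen
    obtain ⟨F, hF, h1, h2, h3, h4⟩ := exists_power hm hf n
    refine ⟨F, hF, n, h1, h2.trans hσ.symm, ?_, ?_⟩
    · rw [h3, abs_mul, Nat.abs_cast]
      gcongr
    · rw [h4]
      gcongr
  obtain ⟨j, hj⟩ := Subgroup.mem_zpowers_iff.1
    (mem_zpowers_bubble hι (isProfile_profile (m := m) hR) σ)
  obtain ⟨n, rfl | rfl⟩ := j.eq_nat_or_neg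
  · exact key hβ n (by rw [← hj, zpow_natCast]) (le_abs_degInt_bubble hm hι hR) he
  · exact key hβ' n (by rw [← hj, hinv, zpow_neg, zpow_natCast, inv_pow])
      (le_abs_degInt_bubble hm hι' hR) he'

/-! ### Convergence of integrals of Jacobians -/

/-- The dominated convergence theorem with convergent dominating functions. -/
theorem tendsto_integral_of_dominated_of_tendsto {α : Type*} [MeasurableSpace α] {μ : Measure α}
    {f g : ℕ → α → ℝ} {f₀ g₀ : α → ℝ} (hf : ∀ n, AEStronglyMeasurable (f n) μ)
    (hg : ∀ n, Integrable (g n) μ) (hg₀ : Integrable g₀ μ) (hfg : ∀ n, ∀ᵐ x ∂μ, |f n x| ≤ g n x)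
    (hflim : ∀ᵐ x ∂μ, Tendsto (fun n => f n x) atTop (𝓝 (f₀ x)))
    (hglim : ∀ᵐ x ∂μ, Tendsto (fun n => g n x) atTop (𝓝 (g₀ x)))
    (hint : Tendsto (fun n => ∫ x, g n x ∂μ) atTop (𝓝 (∫ x, g₀ x ∂μ))) :
    Tendsto (fun n => ∫ x, f n x ∂μ) atTop (𝓝 (∫ x, f₀ x ∂μ)) := by
  have hfg' : ∀ᵐ x ∂μ, ∀ n, |f n x| ≤ g n x := ae_all_iff.2 hfg
  have hg₀0 : ∀ᵐ x ∂μ, 0 ≤ g₀ x := by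
    filter_upwards [hfg', hglim] with x hx hl
    exact ge_of_tendsto' hl fun n => (abs_nonneg _).trans (hx n)
  -- Truncation to `[-g₀, g₀]` makes the usual dominated convergence theorem applicable. The
  -- truncation error is at most the positive part of `g n - g₀`.
  let c : ℕ → α → ℝ := fun n x => max (min (f n x) (g₀ x)) (-g₀ x)
  have hcm : ∀ n, AEStronglyMeasurable (c n) μ := fun n =>
    ((hf n).inf hg₀.aestronglyMeasurable).sup hg₀.aestronglyMeasurable.neg
  have hcb : ∀ n, ∀ᵐ x ∂μ, ‖c n x‖ ≤ g₀ x := fun n => by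
    filter_upwards [hg₀0] with x hx
    rw [Real.norm_eq_abs, abs_le]
    exact ⟨le_max_right _ _, max_le (min_le_right _ _) (by linarith)⟩
  have hclim : Tendsto (fun n => ∫ x, c n x ∂μ) atTop (𝓝 (∫ x, f₀ x ∂μ)) := by
    refine tendsto_integral_of_dominated_convergence g₀ hcm hg₀ hcb ?_
    filter_upwards [hfg', hflim, hglim] with x hx hl hgl
    have hb : |f₀ x| ≤ g₀ x := le_of_tendsto_of_tendsto' hl.abs hgl hx
    have h1 := (hl.min (tendsto_const_nhds (x := g₀ x))).max (tendsto_const_nhds (x := -g₀ x))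
    rwa [min_eq_left ((le_abs_self _).trans hb), max_eq_left (by linarith [neg_abs_le (f₀ x)])]
      at h1
  have hdn : Tendsto (fun n => ∫ x, max (g₀ x - g n x) 0 ∂μ) atTop (𝓝 0) := by
    have := tendsto_integral_of_dominated_convergence (μ := μ)
      (F := fun n x => max (g₀ x - g n x) 0) (f := fun _ => 0) g₀
      (fun n => ((hg₀.sub (hg n)).pos_part).aestronglyMeasurable) hg₀ (fun n => by
        filter_upwards [hg₀0, hfg'] with x hx hx'
        rw [Real.norm_of_nonneg (le_max_right _ _)]
        exact max_le (by linarith [(abs_nonneg _).trans (hx' n)]) hx) (by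
        filter_upwards [hglim] with x hx
        have := ((tendsto_const_nhds (x := g₀ x)).sub hx).max (tendsto_const_nhds (x := (0 : ℝ)))
        rwa [sub_self, max_self] at this)
    simpa using this
  -- The positive part is the difference plus the negative part. The integral of the difference
  -- tends to zero by hypothesis, and the negative part is dominated by `g₀`.
  have hup : Tendsto (fun n => ∫ x, max (g n x - g₀ x) 0 ∂μ) atTop (𝓝 0) := by
    have h1 : ∀ n, ∫ x, max (g n x - g₀ x) 0 ∂μ
        = (∫ x, g n x ∂μ - ∫ x, g₀ x ∂μ) + ∫ x, max (g₀ x - g n x) 0 ∂μ := fun n => by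
      have e := integral_add ((hg n).sub hg₀) ((hg₀.sub (hg n)).pos_part)
      simp only [Pi.sub_apply] at e
      rw [← integral_sub (hg n) hg₀, ← e]
      congr 1
      funext x
      rcases le_total (g n x) (g₀ x) with h | h
      · rw [max_eq_right (by linarith), max_eq_left (by linarith)]
        ring
      · rw [max_eq_left (by linarith), max_eq_right (by linarith)]
        ring
    simp_rw [h1]
    have := (hint.sub_const (∫ x, g₀ x ∂μ)).add hdn
    simpa using this
  have hfi : ∀ n, Integrable (f n) μ := fun n =>
    (hg n).mono' (hf n) (hfg n)
  have hci : ∀ n, Integrable (c n) μ := fun n => hg₀.mono' (hcm n) (hcb n)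
  have hdiff : Tendsto (fun n => ∫ x, f n x ∂μ - ∫ x, c n x ∂μ) atTop (𝓝 0) := by
    refine squeeze_zero_norm (fun n => ?_) hup
    rw [← integral_sub (hfi n) (hci n)]
    refine norm_integral_le_of_norm_le ((hg n).sub hg₀).pos_part ?_
    filter_upwards [hg₀0, hfg n] with x hx hx'
    have h1 := abs_le.1 hx'
    rw [Real.norm_eq_abs, abs_le]
    simp only [c]
    rcases le_total (f n x) (g₀ x) with h2 | h2
    · rw [min_eq_left h2]
      rcases le_total (f n x) (-g₀ x) with h3 | h3
      · rw [max_eq_right h3]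
        constructor
        · linarith [le_max_left (g n x - g₀ x) 0]
        · linarith [le_max_right (g n x - g₀ x) 0]
      · rw [max_eq_left h3]
        constructor <;> linarith [le_max_right (g n x - g₀ x) 0]
    · rw [min_eq_right h2, max_eq_left (show -g₀ x ≤ g₀ x by linarith)]
      constructor
      · linarith [le_max_right (g n x - g₀ x) 0]
      · linarith [le_max_left (g n x - g₀ x) 0]
  have := hdiff.add hclim
  simpa using this

theorem abs_jacDet_le_mul_norm_pow {m : ℕ} (hm : 0 < m) (p : E (m + 1)) (A : Jac m) :
    |jacDet p A.ofLp| ≤ ‖p‖ * ‖A‖ ^ m := by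
  refine (abs_jacDet_le p A.ofLp).trans (mul_le_mul_of_nonneg_left ?_ (norm_nonneg _))
  have h1 := prod_norm_le_norm_pow hm A
  have h2 : (1 : ℝ) ≤ (m : ℝ) ^ ((m : ℝ) / 2) :=
    Real.one_le_rpow (by exact_mod_cast hm) (by positivity)
  have h3 : 0 ≤ ∏ i, ‖A i‖ := Finset.prod_nonneg fun i _ => norm_nonneg _
  nlinarith

theorem aestronglyMeasurable_jacDet {α : Type*} [MeasurableSpace α] {μ : Measure α} {m : ℕ}
    {p : α → E (m + 1)} {A : α → Jac m} (hp : AEStronglyMeasurable p μ)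
    (hA : AEStronglyMeasurable A μ) :
    AEStronglyMeasurable (fun x => jacDet (p x) (A x).ofLp) μ :=
  continuous_jacDet.comp_aestronglyMeasurable
    (hp.prodMk ((PiLp.continuous_ofLp 2 _).comp_aestronglyMeasurable hA))

theorem tendsto_integral_jacDet {α : Type*} [MeasurableSpace α] {μ : Measure α} {m : ℕ}
    (hm : 0 < m) {p : ℕ → α → E (m + 1)} {p₀ : α → E (m + 1)} {A : ℕ → α → Jac m} {A₀ : α → Jac m}
    {g : ℕ → α → ℝ} {g₀ : α → ℝ}
    (hp : ∀ n, AEStronglyMeasurable (p n) μ) (hA : ∀ n, AEStronglyMeasurable (A n) μ)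
    (hg : ∀ n, Integrable (g n) μ) (hg₀ : Integrable g₀ μ)
    (hp1 : ∀ n, ∀ᵐ x ∂μ, ‖p n x‖ ≤ 1) (hAg : ∀ n, ∀ᵐ x ∂μ, ‖A n x‖ ^ m ≤ g n x)
    (hplim : ∀ᵐ x ∂μ, Tendsto (fun n => p n x) atTop (𝓝 (p₀ x)))
    (hAlim : ∀ᵐ x ∂μ, Tendsto (fun n => A n x) atTop (𝓝 (A₀ x)))
    (hglim : ∀ᵐ x ∂μ, Tendsto (fun n => g n x) atTop (𝓝 (g₀ x)))
    (hint : Tendsto (fun n => ∫ x, g n x ∂μ) atTop (𝓝 (∫ x, g₀ x ∂μ))) :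
    Tendsto (fun n => ∫ x, jacDet (p n x) (A n x).ofLp ∂μ) atTop
      (𝓝 (∫ x, jacDet (p₀ x) (A₀ x).ofLp ∂μ)) := by
  refine tendsto_integral_of_dominated_of_tendsto
    (fun n => aestronglyMeasurable_jacDet (hp n) (hA n)) hg hg₀ (fun n => ?_) ?_ hglim hint
  · filter_upwards [hp1 n, hAg n] with x h1 h2
    refine (abs_jacDet_le_mul_norm_pow hm _ _).trans (le_trans ?_ h2)
    exact mul_le_of_le_one_left (by positivity) h1
  · filter_upwards [hplim, hAlim] with x h1 h2
    exact (continuous_jacDet.tendsto (p₀ x, (A₀ x).ofLp)).comp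
      (h1.prodMk_nhds (((PiLp.continuous_ofLp 2 _).tendsto _).comp h2))

theorem integral_norm_pow_eq {α F : Type*} [MeasurableSpace α] {μ : Measure α}
    [NormedAddCommGroup F] {m : ℕ} (hm : 0 < m) {f : α → F} (hf : MemLp f m μ) :
    ∫ x, ‖f x‖ ^ m ∂μ = (eLpNorm f m μ).toReal ^ m := by
  have hm' : (m : ℝ) ≠ 0 := by exact_mod_cast hm.ne'
  rw [hf.eLpNorm_eq_integral_rpow_norm (by exact_mod_cast hm.ne') (ENNReal.natCast_ne_top m)]
  have h0 : 0 ≤ ∫ x, ‖f x‖ ^ ((m : ℝ≥0∞).toReal) ∂μ :=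
    integral_nonneg fun x => Real.rpow_nonneg (norm_nonneg _) _
  rw [ENNReal.toReal_ofReal (Real.rpow_nonneg h0 _), ← Real.rpow_natCast, ← Real.rpow_mul h0,
    ENNReal.toReal_natCast, inv_mul_cancel₀ hm', Real.rpow_one]
  simp

theorem integrable_norm_natPow {α F : Type*} [MeasurableSpace α] {μ : Measure α}
    [NormedAddCommGroup F] {m : ℕ} (hm : 0 < m) {f : α → F} (hf : MemLp f m μ) :
    Integrable (fun x => ‖f x‖ ^ m) μ := by
  have := hf.integrable_norm_rpow (by exact_mod_cast hm.ne') (ENNReal.natCast_ne_top m)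
  simpa using this

theorem tendsto_integral_norm_pow {α F : Type*} [MeasurableSpace α] {μ : Measure α}
    [NormedAddCommGroup F] {m : ℕ} (hm : 0 < m) {f : ℕ → α → F} {f₀ : α → F}
    (hf : ∀ n, MemLp (f n) m μ) (hf₀ : MemLp f₀ m μ)
    (h : Tendsto (fun n => eLpNorm (fun x => f n x - f₀ x) m μ) atTop (𝓝 0)) :
    Tendsto (fun n => ∫ x, ‖f n x‖ ^ m ∂μ) atTop (𝓝 (∫ x, ‖f₀ x‖ ^ m ∂μ)) := by
  have hp : (1 : ℝ≥0∞) ≤ m := by exact_mod_cast hm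
  have h1 : Tendsto (fun n => eLpNorm (f n) m μ) atTop (𝓝 (eLpNorm f₀ m μ)) := by
    refine tendsto_of_tendsto_of_tendsto_of_le_of_le
      (g := fun n => eLpNorm f₀ m μ - eLpNorm (fun x => f n x - f₀ x) m μ)
      (h := fun n => eLpNorm f₀ m μ + eLpNorm (fun x => f n x - f₀ x) m μ) ?_ ?_
      (fun n => ?_) (fun n => ?_)
    · have := ENNReal.Tendsto.sub (tendsto_const_nhds (x := eLpNorm f₀ m μ)) h
        (Or.inr ENNReal.zero_ne_top)
      rwa [tsub_zero] at this
    · have := (tendsto_const_nhds (x := eLpNorm f₀ m μ)).add h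
      rwa [add_zero] at this
    · refine tsub_le_iff_right.2 ?_
      have h2 := eLpNorm_sub_le (hf n).1 ((hf n).sub hf₀).1 hp
      have h3 : f n - (f n - f₀) = f₀ := sub_sub_cancel _ _
      rw [h3] at h2
      exact h2
    · have h2 := eLpNorm_add_le hf₀.1 ((hf n).sub hf₀).1 hp
      have h3 : f₀ + (f n - f₀) = f n := add_sub_cancel _ _
      rw [h3] at h2
      exact h2
  simp_rw [integral_norm_pow_eq hm hf₀, fun n => integral_norm_pow_eq hm (hf n)]
  exact ((ENNReal.tendsto_toReal hf₀.2.ne).comp h1).pow m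

/-- The integral of the Jacobian of a Sobolev map. -/
def jacInt {m : ℕ} (f : E m → E (m + 1)) (G : E m → Jac m) : ℝ :=
  ∫ x in B m, jacDet (f x) (G x).ofLp

theorem IsSobolevMap.norm_le_one {m : ℕ} {b : S m} {f : E m → E (m + 1)} {G : E m → Jac m}
    (h : IsSobolevMap b f G) : ∀ᵐ x ∂(volB m), ‖f x‖ ≤ 1 := by
  filter_upwards [h.mem_sphere] with x hx
  exact (mem_sphere_zero_iff_norm.1 hx).le

/-- Continuity of the Jacobian integral for the convergence in `W^{1,m}`. -/
theorem tendsto_jacInt {m : ℕ} (hm : 0 < m) {b : S m} {X : Type*} {l : Filter X}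
    [l.IsCountablyGenerated] {H : X → E m → E (m + 1)} {G : X → E m → Jac m}
    {f₀ : E m → E (m + 1)} {G₀ : E m → Jac m} (h : ∀ᶠ t in l, IsSobolevMap b (H t) (G t))
    (h₀ : IsSobolevMap b f₀ G₀)
    (hH : Tendsto (fun t => eLpNorm (fun x => H t x - f₀ x) m (volB m)) l (𝓝 0))
    (hG : Tendsto (fun t => eLpNorm (fun x => G t x - G₀ x) m (volB m)) l (𝓝 0)) :
    Tendsto (fun t => jacInt (H t) (G t)) l (𝓝 (jacInt f₀ G₀)) := by
  have hm0 : (m : ℝ≥0∞) ≠ 0 := by exact_mod_cast hm.ne'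
  -- Convergence in the norm gives almost everywhere convergence only along subsequences. Two
  -- successive extractions handle the maps and the gradients; the dominating functions `‖G‖ ^ m`
  -- vary, but their integrals converge.
  refine tendsto_of_subseq_tendsto fun ns hns => ?_
  obtain ⟨N, hN⟩ := eventually_atTop.1 (hns.eventually h)
  have hs : ∀ n, IsSobolevMap b (H (ns (n + N))) (G (ns (n + N))) := fun n =>
    hN _ (Nat.le_add_left _ _)
  have hns' : Tendsto (fun n => ns (n + N)) atTop l := hns.comp (tendsto_add_atTop_nat N)
  obtain ⟨k₁, hk₁, hlim₁⟩ := (tendstoInMeasure_of_tendsto_eLpNorm hm0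
    (fun n => (hs n).memLp.1) h₀.memLp.1 (hH.comp hns')).exists_seq_tendsto_ae
  have hG₁ := (hG.comp hns').comp hk₁.tendsto_atTop
  obtain ⟨k₂, hk₂, hlim₂⟩ := (tendstoInMeasure_of_tendsto_eLpNorm hm0
    (fun n => (hs (k₁ n)).memLp_grad.1) h₀.memLp_grad.1 hG₁).exists_seq_tendsto_ae
  refine ⟨fun n => k₁ (k₂ n) + N, ?_⟩
  refine tendsto_integral_jacDet (μ := volB m) hm
    (g := fun n x => ‖G (ns (k₁ (k₂ n) + N)) x‖ ^ m) (g₀ := fun x => ‖G₀ x‖ ^ m)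
    (fun n => (hs _).memLp.1) (fun n => (hs _).memLp_grad.1)
    (fun n => integrable_norm_natPow hm (hs _).memLp_grad)
    (integrable_norm_natPow hm h₀.memLp_grad) (fun n => (hs _).norm_le_one)
    (fun n => Eventually.of_forall fun x => le_rfl) ?_ hlim₂ ?_ ?_
  · filter_upwards [hlim₁] with x hx
    exact hx.comp hk₂.tendsto_atTop
  · filter_upwards [hlim₂] with x hx
    exact hx.norm.pow m
  · exact tendsto_integral_norm_pow hm (fun n => (hs _).memLp_grad) h₀.memLp_grad
      (hG₁.comp hk₂.tendsto_atTop)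

/-! ### Weak gradients -/

theorem integral_pderiv_vector_eq_zero {m n : ℕ} {V : E m → E n} (hV : ContDiff ℝ ∞ V)
    (hc : HasCompactSupport V) (i : Fin m) : ∫ x, pderiv V i x = 0 := by
  have hcont : Continuous fun x => pderiv V i x :=
    (hV.continuous_fderiv (by simp)).clm_apply continuous_const
  have hcs : HasCompactSupport fun x => pderiv V i x := hc.fderiv_apply (𝕜 := ℝ) _
  have hint : Integrable fun x => pderiv V i x := hcont.integrable_of_hasCompactSupport hcs
  refine ext_inner_left ℝ fun v => ?_
  rw [inner_zero_right, ← integral_inner hint]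
  have h1 : ContDiff ℝ 1 fun x => (inner ℝ v (V x) : ℝ) :=
    (contDiff_const.inner ℝ hV).of_le (by simp)
  have h2 : ∀ x, (inner ℝ v (pderiv V i x) : ℝ) = pderiv (fun x => (inner ℝ v (V x) : ℝ)) i x :=
    fun x => by
      have h3 : HasFDerivAt (fun x => (inner ℝ v (V x) : ℝ)) ((innerSL ℝ v).comp (fderiv ℝ V x)) x :=
        (innerSL ℝ v).hasFDerivAt.comp x (hV.differentiable (by simp) x).hasFDerivAt
      simp [pderiv, h3.fderiv]
  simp_rw [h2]
  exact integral_pderiv_eq_zero h1 (hc.comp_left (g := fun p => (inner ℝ v p : ℝ)) (by simp)) i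

theorem integral_pderiv_smul_const {m : ℕ} {F : Type*} [NormedAddCommGroup F] [NormedSpace ℝ F]
    [CompleteSpace F] {φ : E m → ℝ} (hφ : ContDiff ℝ ∞ φ) (hc : HasCompactSupport φ) (i : Fin m)
    (b : F) : ∫ x, pderiv φ i x • b = 0 := by
  rw [integral_smul_const, integral_pderiv_eq_zero (hφ.of_le (by simp)) hc, zero_smul]

theorem continuous_pderiv_of_contDiff {m : ℕ} {φ : E m → ℝ} (hφ : ContDiff ℝ ∞ φ) (i : Fin m) :
    Continuous (pderiv φ i) :=
  (contDiff_pderiv hφ i).continuous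

theorem hasCompactSupport_pderiv {m : ℕ} {φ : E m → ℝ} (hc : HasCompactSupport φ) (i : Fin m) :
    HasCompactSupport (pderiv φ i) :=
  hc.fderiv_apply (𝕜 := ℝ) _

/-- The product of a continuous function with compact support and an integrable function. -/
theorem integrable_smul_of_hasCompactSupport {m : ℕ} {F : Type*} [NormedAddCommGroup F]
    [NormedSpace ℝ F] {μ : Measure (E m)} {φ : E m → ℝ} (hφ : Continuous φ)
    (hc : HasCompactSupport φ) {f : E m → F} (hf : Integrable f μ) :
    Integrable (fun x => φ x • f x) μ := by
  obtain ⟨C, hC⟩ := hφ.bounded_above_of_compact_support hc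
  exact hf.bdd_smul C hφ.aestronglyMeasurable (Eventually.of_forall hC)

theorem IsSobolevMap.integrable {m : ℕ} (hm : 0 < m) {b : S m} {f : E m → E (m + 1)}
    {G : E m → Jac m} (h : IsSobolevMap b f G) : Integrable f (volB m) := by
  have : IsFiniteMeasure (volB m) := ⟨by
    rw [Measure.restrict_apply_univ]
    exact measure_ball_lt_top⟩
  exact h.memLp.integrable (by exact_mod_cast hm)

theorem IsSobolevMap.integrable_grad {m : ℕ} (hm : 0 < m) {b : S m} {f : E m → E (m + 1)}
    {G : E m → Jac m} (h : IsSobolevMap b f G) (i : Fin m) :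
    Integrable (fun x => G x i) (volB m) := by
  have : IsFiniteMeasure (volB m) := ⟨by
    rw [Measure.restrict_apply_univ]
    exact measure_ball_lt_top⟩
  have h1 : Integrable G (volB m) := h.memLp_grad.integrable (by exact_mod_cast hm)
  exact (PiLp.proj 2 (fun _ : Fin m => E (m + 1)) (𝕜 := ℝ) i).integrable_comp h1

/-- Weak gradients are unique. -/
theorem IsSobolevMap.ae_eq_grad {m : ℕ} (hm : 0 < m) {b : S m} {f : E m → E (m + 1)}
    {G G' : E m → Jac m} (h : IsSobolevMap b f G) (h' : IsSobolevMap b f G') :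
    ∀ᵐ x ∂(volB m), G x = G' x := by
  have key : ∀ i, ∀ᵐ x ∂(volume : Measure (E m)), x ∈ B m → G x i - G' x i = 0 := by
    intro i
    have hint := (h.integrable_grad hm i).sub (h'.integrable_grad hm i)
    refine isOpen_ball.ae_eq_zero_of_integral_contDiff_smul_eq_zero
      (IntegrableOn.locallyIntegrableOn hint) fun φ hφ hc hs => ?_
    have h0 : ∫ x, φ x • (G x i - G' x i) = ∫ x in B m, φ x • (G x i - G' x i) := by
      refine (setIntegral_eq_integral_of_forall_compl_eq_zero fun x hx => ?_).symm
      rw [image_eq_zero_of_notMem_tsupport fun hx' => hx (hs hx'), zero_smul]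
    rw [h0]
    simp_rw [smul_sub]
    rw [integral_sub (integrable_smul_of_hasCompactSupport hφ.continuous hc (h.integrable_grad hm i))
      (integrable_smul_of_hasCompactSupport hφ.continuous hc (h'.integrable_grad hm i)),
      sub_eq_zero, ← neg_inj, ← h.weakGradient φ hφ hc hs i, ← h'.weakGradient φ hφ hc hs i]
  rw [ae_restrict_iff' measurableSet_ball]
  filter_upwards [ae_all_iff.2 key] with x hx hxB
  ext1 i
  exact sub_eq_zero.1 (hx i hxB)

/-- Off the closed ball `f` is locally constant; continuity of the derivative extends the conclusion
to the unit sphere. -/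
theorem fderiv_eq_zero_of_one_le {m : ℕ} {b : E (m + 1)} {f : E m → E (m + 1)}
    (hf : ContDiff ℝ ∞ f) (h : ∀ x, 1 ≤ ‖x‖ → f x = b) {x : E m} (hx : 1 ≤ ‖x‖) :
    fderiv ℝ f x = 0 := by
  have hcl : IsClosed {x : E m | fderiv ℝ f x = 0} :=
    isClosed_eq (hf.continuous_fderiv (by simp)) continuous_const
  have hsub : (closedBall (0 : E m) 1)ᶜ ⊆ {x : E m | fderiv ℝ f x = 0} := fun z hz =>
    fderiv_eq_zero_of_norm_gt h (by simpa using hz)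
  have := closure_minimal hsub hcl
  rw [closure_compl, interior_closedBall _ one_ne_zero] at this
  exact this (by simpa using hx)

/-- Smooth maps that are constant outside the ball are Sobolev maps. -/
theorem IsSmoothMap.isSobolevMap {m : ℕ} {b : S m} {f : E m → E (m + 1)}
    (hf : IsSmoothMap (b : E (m + 1)) f) (h : ∀ x, 1 ≤ ‖x‖ → f x = b) :
    IsSobolevMap b f (jac f) := by
  have hfin : IsFiniteMeasure (volB m) := ⟨by
    rw [Measure.restrict_apply_univ]
    exact measure_ball_lt_top⟩
  have hjc : Continuous fun x => jac f x :=
    (PiLp.continuous_toLp 2 _).comp (continuous_pi fun i => (contDiff_grad hf.contDiff i).continuous)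
  have hjs : HasCompactSupport fun x => jac f x := hasCompactSupport_of_forall_norm (R := 1)
    fun x hx => jac_eq_zero (fderiv_eq_zero_of_one_le hf.contDiff h hx)
  have hfi : Integrable f (volB m) := Integrable.of_bound hf.contDiff.continuous.aestronglyMeasurable
    1 (Eventually.of_forall fun x => (hf.norm_eq_one x).le)
  have hgi : ∀ i, Integrable (fun x => jac f x i) (volB m) := fun i =>
    (((PiLp.proj 2 (fun _ : Fin m => E (m + 1)) (𝕜 := ℝ) i).continuous.comp
      hjc).integrable_of_hasCompactSupport
      (hjs.comp_left (g := fun A : Jac m => A i) rfl)).restrict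
  have htrace : HasConstantTrace f (jac f) (b : E (m + 1)) := by
    intro φ hφ hc i
    have hpc := continuous_pderiv_of_contDiff hφ i
    have hps := hasCompactSupport_pderiv hc i
    -- The trace identity says that `∂ᵢ (φ (f - b))` has integral zero over the ball. This
    -- derivative vanishes off the ball, so its integral is that of the derivative of a compactly
    -- supported function over `ℝ^m`.
    have hV : ContDiff ℝ ∞ fun x => φ x • (f x - (b : E (m + 1))) :=
      hφ.smul (hf.contDiff.sub contDiff_const)
    have hVd : ∀ x, pderiv (fun x => φ x • (f x - (b : E (m + 1)))) i x
        = pderiv φ i x • (f x - b) + φ x • jac f x i := fun x => by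
      have h1 := ((hφ.differentiable (by simp) x).hasFDerivAt).smul
        ((hf.contDiff.differentiable (by simp) x).hasFDerivAt.sub_const (b : E (m + 1)))
      have h2 : fderiv ℝ (fun x => φ x • (f x - (b : E (m + 1)))) x = _ := h1.fderiv
      simp [pderiv, h2, jac, grad, add_comm]
    have h0 : ∫ x in B m, pderiv (fun x => φ x • (f x - (b : E (m + 1)))) i x = 0 := by
      rw [setIntegral_eq_integral_of_forall_compl_eq_zero fun x hx => ?_]
      · exact integral_pderiv_vector_eq_zero hV (hc.smul_right) i
      · have hx1 : 1 ≤ ‖x‖ := by simpa using hx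
        rw [hVd, h x hx1, sub_self, smul_zero, jac_eq_zero
          (fderiv_eq_zero_of_one_le hf.contDiff h hx1)]
        simp
    rw [← sub_eq_zero, ← integral_sub _ (integrable_smul_of_hasCompactSupport hpc hps
      (integrable_const _))]
    · refine Eq.trans ?_ h0
      congr 1
      funext x
      rw [hVd, smul_sub]
      abel
    · exact (integrable_smul_of_hasCompactSupport hpc hps hfi).add
        (integrable_smul_of_hasCompactSupport hφ.continuous hc (hgi i))
  refine ⟨?_, (hjc.memLp_of_hasCompactSupport hjs).restrict _, ?_, ?_, htrace⟩
  · exact MemLp.of_bound hf.contDiff.continuous.aestronglyMeasurable 1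
      (Eventually.of_forall fun x => (hf.norm_eq_one x).le)
  · exact Eventually.of_forall fun x => by simp [hf.norm_eq_one x]
  · intro φ hφ hc hs i
    have hpc := continuous_pderiv_of_contDiff hφ i
    have hps := hasCompactSupport_pderiv hc i
    have h1 := htrace φ hφ hc i
    rw [integral_add (integrable_smul_of_hasCompactSupport hpc hps hfi)
      (integrable_smul_of_hasCompactSupport hφ.continuous hc (hgi i))] at h1
    have h2 : ∫ x in B m, pderiv φ i x • (b : E (m + 1)) = 0 := by
      rw [setIntegral_eq_integral_of_forall_compl_eq_zero fun x hx => ?_]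
      · exact integral_pderiv_smul_const hφ hc i _
      · have : fderiv ℝ φ x = 0 := image_eq_zero_of_notMem_tsupport fun hx' =>
          hx (hs (tsupport_fderiv_subset ℝ hx'))
        simp [pderiv, this]
    rw [h2] at h1
    exact eq_neg_of_add_eq_zero_left h1

/-- A map on `ℝ^m` with a weak gradient, constant outside the unit ball. -/
structure IsWeakMap {m : ℕ} (b : E (m + 1)) (u : E m → E (m + 1)) (Γ : E m → Jac m) : Prop where
  aestronglyMeasurable : AEStronglyMeasurable u volume
  norm_eq_one : ∀ᵐ x, ‖u x‖ = 1
  memLp : MemLp Γ m volume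
  eq_base : ∀ x, 1 ≤ ‖x‖ → u x = b
  weak : ∀ φ : E m → ℝ, ContDiff ℝ ∞ φ → HasCompactSupport φ → ∀ i : Fin m,
    ∫ x, pderiv φ i x • u x = - ∫ x, φ x • Γ x i

/-- The extension of a Sobolev map by a constant. -/
theorem IsSobolevMap.isWeakMap {m : ℕ} (hm : 0 < m) {b : S m} {f : E m → E (m + 1)}
    {G : E m → Jac m} (h : IsSobolevMap b f G) :
    IsWeakMap (b : E (m + 1)) (extendBy b f) ((B m).indicator G) := by
  have hmeas : MeasurableSet (B m) := measurableSet_ball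
  have hu : extendBy b f = fun x => (B m).indicator (fun x => f x - (b : E (m + 1))) x + b := by
    funext x
    by_cases hx : x ∈ B m
    · simp [extendBy, hx]
    · simp only [extendBy, hx, if_false, Set.indicator_of_notMem hx, zero_add]
  have hfi := h.integrable hm
  refine ⟨?_, ?_, (memLp_indicator_iff_restrict hmeas).2 h.memLp_grad, fun x hx => ?_, ?_⟩
  · rw [hu]
    exact ((aestronglyMeasurable_indicator_iff hmeas).2
      (hfi.aestronglyMeasurable.sub aestronglyMeasurable_const)).add aestronglyMeasurable_const
  · have := (ae_restrict_iff' hmeas).1 h.mem_sphere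
    filter_upwards [this] with x hx
    by_cases hxB : x ∈ B m
    · simpa [extendBy, hxB] using hx hxB
    · simp only [extendBy, hxB, if_false]
      exact norm_base b
  · have : x ∉ B m := by simpa using hx
    simp only [extendBy, this, if_false]
  · intro φ hφ hc i
    have hpc := continuous_pderiv_of_contDiff hφ i
    have hps := hasCompactSupport_pderiv hc i
    have hfin : IsFiniteMeasure (volB m) := ⟨by
      rw [Measure.restrict_apply_univ]
      exact measure_ball_lt_top⟩
    have hbi : Integrable (fun _ => (b : E (m + 1))) (volB m) := integrable_const _
    -- Testing with functions not supported in the ball is what rules out a boundary term in the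
    -- weak gradient of the extension.
    have h1 := h.trace φ hφ hc i
    rw [integral_add (integrable_smul_of_hasCompactSupport hpc hps hfi)
      (integrable_smul_of_hasCompactSupport hφ.continuous hc (h.integrable_grad hm i))] at h1
    have h2 : ∫ x, pderiv φ i x • extendBy b f x
        = ∫ x in B m, pderiv φ i x • (f x - (b : E (m + 1))) := by
      have h3 : ∀ x, pderiv φ i x • extendBy b f x
          = (B m).indicator (fun x => pderiv φ i x • (f x - (b : E (m + 1)))) x
            + pderiv φ i x • (b : E (m + 1)) := fun x => by
        rw [hu]
        by_cases hx : x ∈ B m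
        · simp only [Set.indicator_of_mem hx]
          rw [smul_add]
        · simp [hx]
      simp_rw [h3]
      rw [integral_add, integral_pderiv_smul_const hφ hc, add_zero, integral_indicator hmeas]
      · exact (integrable_indicator_iff hmeas).2
          (integrable_smul_of_hasCompactSupport hpc hps (hfi.sub hbi))
      · exact (hpc.integrable_of_hasCompactSupport hps).smul_const _
    have h4 : ∫ x, φ x • (B m).indicator G x i = ∫ x in B m, φ x • G x i := by
      rw [← integral_indicator hmeas]
      congr 1
      funext x
      by_cases hx : x ∈ B m <;> simp [hx]
    rw [h2, h4]
    simp_rw [smul_sub]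
    rw [integral_sub (integrable_smul_of_hasCompactSupport hpc hps hfi)
      (integrable_smul_of_hasCompactSupport hpc hps hbi), ← h1]
    abel

theorem jacInt_eq_integral {m : ℕ} (hm : 0 < m) {b : S m} (f : E m → E (m + 1)) (G : E m → Jac m) :
    jacInt f G = ∫ x, jacDet (extendBy b f x) ((B m).indicator G x).ofLp := by
  rw [jacInt, ← integral_indicator measurableSet_ball]
  congr 1
  funext x
  by_cases hx : x ∈ B m
  · simp [hx, extendBy]
  · simp only [Set.indicator_of_notMem hx]
    exact (jacDet_eq_zero_of_eq_zero _ (i := ⟨0, hm⟩) rfl).symm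

/-! ### Mollification -/

section Mol

variable {m : ℕ} {F : Type*} [NormedAddCommGroup F] [NormedSpace ℝ F]

/-- The mollification of a map. -/
def mol (φ : ContDiffBump (0 : E m)) (f : E m → F) (x : E m) : F :=
  convolution (φ.normed volume) f (ContinuousLinearMap.lsmul ℝ ℝ) volume x

theorem mol_eq (φ : ContDiffBump (0 : E m)) (f : E m → F) (x : E m) :
    mol φ f x = ∫ t, φ.normed volume t • f (x - t) := rfl

theorem mol_eq_swap (φ : ContDiffBump (0 : E m)) (f : E m → F) (x : E m) :
    mol φ f x = ∫ y, φ.normed volume (x - y) • f y :=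
  convolution_lsmul_swap

theorem contDiff_bump_normed (φ : ContDiffBump (0 : E m)) : ContDiff ℝ ∞ (φ.normed volume) :=
  φ.contDiff_normed

theorem integrable_mol (φ : ContDiffBump (0 : E m)) {f : E m → F} (hf : LocallyIntegrable f volume)
    (x : E m) : Integrable fun t => φ.normed volume t • f (x - t) :=
  (φ.hasCompactSupport_normed.convolutionExists_left (ContinuousLinearMap.lsmul ℝ ℝ)
    φ.continuous_normed hf x)

theorem integrable_mol_swap (φ : ContDiffBump (0 : E m)) {f : E m → F}
    (hf : LocallyIntegrable f volume) (x : E m) :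
    Integrable fun y => φ.normed volume (x - y) • f y := by
  have := (integrable_mol φ hf x).comp_sub_left x
  simpa using this

theorem contDiff_mol (φ : ContDiffBump (0 : E m)) {f : E m → F} [CompleteSpace F]
    (hf : LocallyIntegrable f volume) : ContDiff ℝ ∞ (mol φ f) :=
  φ.hasCompactSupport_normed.contDiff_convolution_left _ (contDiff_bump_normed φ) hf

theorem mol_eq_const [CompleteSpace F] (φ : ContDiffBump (0 : E m)) {f : E m → F} {c : F} {R : ℝ}
    (h : ∀ x, R ≤ ‖x‖ → f x = c) {x : E m} (hx : R + φ.rOut ≤ ‖x‖) : mol φ f x = c := by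
  have hR : ∀ y ∈ ball x φ.rOut, f y = c := fun y hy => h y (by
    have h1 := norm_sub_norm_le x y
    rw [mem_ball', dist_eq_norm] at hy
    linarith)
  have hxx := hR x (mem_ball_self φ.rOut_pos)
  rw [mol, ContDiffBump.normed_convolution_eq_right fun y hy => (hR y hy).trans hxx.symm, hxx]

theorem norm_mol_le (φ : ContDiffBump (0 : E m)) (f : E m → F) (x : E m) :
    ‖mol φ f x‖ ≤ mol φ (fun y => ‖f y‖) x := by
  refine (norm_integral_le_integral_norm _).trans_eq ?_
  congr 1
  funext t
  rw [ContinuousLinearMap.lsmul_apply, ContinuousLinearMap.lsmul_apply, norm_smul,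
    Real.norm_of_nonneg (φ.nonneg_normed t), smul_eq_mul]

theorem norm_mol_le_one (φ : ContDiffBump (0 : E m)) {f : E m → F} (hf : ∀ᵐ x, ‖f x‖ ≤ 1)
    (x : E m) : ‖mol φ f x‖ ≤ 1 := by
  rw [mol_eq_swap, ← φ.integral_normed (μ := volume),
    ← integral_sub_left_eq_self (φ.normed volume) volume x]
  refine norm_integral_le_of_norm_le (φ.integrable_normed.comp_sub_left x) ?_
  filter_upwards [hf] with y hy
  rw [norm_smul, Real.norm_of_nonneg (φ.nonneg_normed _)]
  exact mul_le_of_le_one_right (φ.nonneg_normed _) hy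

/-- Jensen's inequality for mollifications. -/
theorem mol_pow_le (φ : ContDiffBump (0 : E m)) {a : E m → ℝ} (ha0 : ∀ x, 0 ≤ a x) {k : ℕ}
    (ha : LocallyIntegrable a volume) (hak : LocallyIntegrable (fun x => a x ^ k) volume)
    (x : E m) : mol φ a x ^ k ≤ mol φ (fun y => a y ^ k) x := by
  rcases Nat.eq_zero_or_pos k with rfl | hk
  · simp only [pow_zero]
    rw [mol_eq]
    simp [φ.integral_normed]
  set c := mol φ a x with hc
  have hc0 : 0 ≤ c := integral_nonneg fun t => mul_nonneg (φ.nonneg_normed t) (ha0 _)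
  -- The graph of `s ^ k` lies above its tangent at the mean `c`, by Bernoulli's inequality.
  -- Averaging the tangent line leaves `c ^ k`.
  have htan : ∀ s : ℝ, 0 ≤ s → c ^ k + k * c ^ (k - 1) * (s - c) ≤ s ^ k := by
    intro s hs
    rcases hc0.eq_or_lt with h0 | h0
    · rw [← h0]
      rcases Nat.lt_or_ge 1 k with h1 | h1
      · rw [zero_pow hk.ne', zero_pow (by omega)]
        simpa using pow_nonneg hs k
      · have : k = 1 := by omega
        subst this
        simp
    · have h1 := one_add_mul_le_pow (a := s / c - 1) (by
        have := div_nonneg hs hc0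
        linarith) k
      have h2 := mul_le_mul_of_nonneg_left h1 (pow_nonneg hc0 k)
      rw [← mul_pow, show c * (1 + (s / c - 1)) = s by field_simp; ring] at h2
      refine le_trans (le_of_eq ?_) h2
      obtain ⟨j, rfl⟩ : ∃ j, k = j + 1 := ⟨k - 1, by omega⟩
      simp only [Nat.add_sub_cancel]
      field_simp
      ring
  have hint := integrable_mol φ ha x
  have hint1 : Integrable (φ.normed (volume : Measure (E m))) := φ.integrable_normed
  have h1 : ∫ t, φ.normed volume t • (c ^ k + k * c ^ (k - 1) * (a (x - t) - c))
      ≤ mol φ (fun y => a y ^ k) x := by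
    refine integral_mono ?_ (integrable_mol φ hak x) fun t =>
      mul_le_mul_of_nonneg_left (htan _ (ha0 _)) (φ.nonneg_normed t)
    have : Integrable fun t => (c ^ k - k * c ^ (k - 1) * c) * φ.normed volume t +
      k * c ^ (k - 1) * (φ.normed volume t • a (x - t)) :=
      (hint1.const_mul _).add (hint.const_mul _)
    refine this.congr (Eventually.of_forall fun t => ?_)
    simp only [smul_eq_mul]
    ring
  refine le_trans (le_of_eq ?_) h1
  have h2 : ∀ t, φ.normed volume t • (c ^ k + k * c ^ (k - 1) * (a (x - t) - c))
      = (c ^ k - k * c ^ (k - 1) * c) * φ.normed volume t +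
      k * c ^ (k - 1) * (φ.normed volume t • a (x - t)) := fun t => by
    simp only [smul_eq_mul]
    ring
  simp_rw [h2]
  rw [integral_add (hint1.const_mul _) (hint.const_mul _), integral_const_mul, integral_const_mul,
    φ.integral_normed, ← mol_eq φ a x, ← hc]
  ring

theorem integral_mol (φ : ContDiffBump (0 : E m)) {a : E m → ℝ} (ha : Integrable a) :
    ∫ x, mol φ a x = ∫ x, a x := by
  have := integral_convolution (ContinuousLinearMap.lsmul ℝ ℝ) (μ := (volume : Measure (E m)))
    (ν := volume) (φ.integrable_normed (μ := volume)) ha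
  rw [φ.integral_normed] at this
  simpa [mol] using this

theorem integrable_mol_of_integrable (φ : ContDiffBump (0 : E m)) {a : E m → ℝ}
    (ha : Integrable a) : Integrable (mol φ a) :=
  Integrable.integrable_convolution (ContinuousLinearMap.lsmul ℝ ℝ)
    (φ.integrable_normed (μ := volume)) ha

end Mol

theorem mol_apply {m : ℕ} (φ : ContDiffBump (0 : E m)) {Γ : E m → Jac m}
    (hΓ : LocallyIntegrable Γ volume) (x : E m) (i : Fin m) :
    mol φ Γ x i = mol φ (fun y => Γ y i) x :=
  ((PiLp.proj 2 (fun _ : Fin m => E (m + 1)) (𝕜 := ℝ) i).integral_comp_comm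
    (integrable_mol φ hΓ x)).symm

namespace IsWeakMap

variable {m : ℕ} {b : E (m + 1)} {u : E m → E (m + 1)} {Γ : E m → Jac m}

theorem locallyIntegrable (h : IsWeakMap b u Γ) : LocallyIntegrable u volume := by
  refine LocallyIntegrable.mono (f := fun _ => (1 : ℝ)) (locallyIntegrable_const 1)
    h.aestronglyMeasurable ?_
  filter_upwards [h.norm_eq_one] with x hx
  simp [hx]

theorem locallyIntegrable_grad (hm : 0 < m) (h : IsWeakMap b u Γ) :
    LocallyIntegrable Γ volume :=
  h.memLp.locallyIntegrable (by exact_mod_cast hm)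

theorem integrable_norm_pow (hm : 0 < m) (h : IsWeakMap b u Γ) :
    Integrable fun x => ‖Γ x‖ ^ m :=
  integrable_norm_natPow hm h.memLp

/-- The gradient of the mollification is the mollification of the weak gradient. -/
theorem grad_mol (hm : 0 < m) (h : IsWeakMap b u Γ) (φ : ContDiffBump (0 : E m)) (x : E m)
    (i : Fin m) : grad (mol φ u) x i = mol φ Γ x i := by
  have h1 := φ.hasCompactSupport_normed.hasFDerivAt_convolution_left
    (ContinuousLinearMap.lsmul ℝ ℝ) ((contDiff_bump_normed φ).of_le (by simp))
    h.locallyIntegrable x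
  have h2 := (φ.hasCompactSupport_normed (μ := volume)).fderiv (𝕜 := ℝ)
  have h3 := (h2.convolutionExists_left
    ((ContinuousLinearMap.lsmul ℝ ℝ : ℝ →L[ℝ] E (m + 1) →L[ℝ] E (m + 1)).precompL (E m))
    ((contDiff_bump_normed φ).continuous_fderiv (by simp)) h.locallyIntegrable x)
  have h4 : grad (mol φ u) x i
      = ∫ t, fderiv ℝ (φ.normed volume) t (EuclideanSpace.single i 1) • u (x - t) := by
    have h5 : fderiv ℝ (mol φ u) x = _ := h1.fderiv
    rw [grad, pderiv, h5, convolution_def, ContinuousLinearMap.integral_apply h3]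
    rfl
  rw [h4, mol_apply φ (h.locallyIntegrable_grad hm), mol_eq_swap,
    ← integral_sub_left_eq_self _ volume x]
  have hψ : ContDiff ℝ ∞ fun y => φ.normed volume (x - y) :=
    (contDiff_bump_normed φ).comp (contDiff_const.sub contDiff_id)
  have hc : HasCompactSupport fun y => φ.normed volume (x - y) :=
    φ.hasCompactSupport_normed.comp_homeomorph (Homeomorph.subLeft x)
  have h6 : ∀ y, pderiv (fun y => φ.normed volume (x - y)) i y
      = - fderiv ℝ (φ.normed volume) (x - y) (EuclideanSpace.single i 1) := fun y => by
    have h7 : HasFDerivAt (fun y => φ.normed volume (x - y))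
        ((fderiv ℝ (φ.normed volume) (x - y)).comp (-ContinuousLinearMap.id ℝ (E m))) y :=
      (((contDiff_bump_normed φ).differentiable (by simp) (x - y)).hasFDerivAt).comp y
        ((hasFDerivAt_id y).const_sub x)
    simp [pderiv, h7.fderiv]
  have h8 := h.weak _ hψ hc i
  simp_rw [h6, neg_smul, integral_neg, neg_inj, sub_sub_cancel] at h8 ⊢
  exact h8

theorem jac_mol (hm : 0 < m) (h : IsWeakMap b u Γ) (φ : ContDiffBump (0 : E m)) (x : E m) :
    jac (mol φ u) x = mol φ Γ x := by
  ext1 i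
  exact h.grad_mol hm φ x i

theorem norm_jac_mol_pow_le (hm : 0 < m) (h : IsWeakMap b u Γ) (φ : ContDiffBump (0 : E m))
    (x : E m) : ‖jac (mol φ u) x‖ ^ m ≤ mol φ (fun y => ‖Γ y‖ ^ m) x := by
  rw [h.jac_mol hm]
  exact (pow_le_pow_left₀ (norm_nonneg _) (norm_mol_le φ Γ x) m).trans
    (mol_pow_le φ (fun x => norm_nonneg _) ((h.locallyIntegrable_grad hm).mono
        h.memLp.1.norm (Eventually.of_forall fun y => by simp))
      (h.integrable_norm_pow hm).locallyIntegrable x)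

end IsWeakMap

/-! ### A Poincaré inequality -/

theorem norm_fderiv_le {m : ℕ} (f : E m → E (m + 1)) (x e : E m) :
    ‖fderiv ℝ f x e‖ ≤ ‖jac f x‖ * ‖e‖ := by
  have he : e = ∑ i, e i • EuclideanSpace.single i (1 : ℝ) := by
    have := (EuclideanSpace.basisFun (Fin m) ℝ).sum_repr e
    simpa using this.symm
  conv_lhs => rw [he, map_sum]
  refine (norm_sum_le _ _).trans ?_
  simp_rw [map_smul, norm_smul]
  refine (Real.sum_mul_le_sqrt_mul_sqrt _ _ _).trans_eq ?_
  rw [mul_comm, EuclideanSpace.norm_eq, PiLp.norm_eq_of_L2]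
  rfl

theorem continuous_jac {m : ℕ} {v : E m → E (m + 1)} (hv : ContDiff ℝ ∞ v) :
    Continuous (jac v) :=
  (PiLp.continuous_toLp 2 _).comp (continuous_pi fun i => (contDiff_grad hv i).continuous)

/-- The increment of a smooth map along a segment. -/
theorem enorm_add_sub_le {m : ℕ} {v : E m → E (m + 1)} (hv : ContDiff ℝ ∞ v) (y h : E m) :
    ‖v (y + h) - v y‖ₑ ≤ ∫⁻ s in Set.Icc (0 : ℝ) 1, ‖jac v (y + s • h)‖ₑ * ‖h‖ₑ := by
  have hd : ∀ s : ℝ, HasDerivAt (fun s : ℝ => v (y + s • h)) (fderiv ℝ v (y + s • h) h) s :=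
    fun s => ((hv.differentiable (by simp) _).hasFDerivAt).comp_hasDerivAt s
      (by simpa using ((hasDerivAt_id s).smul_const h).const_add y)
  have hc : Continuous fun s : ℝ => fderiv ℝ v (y + s • h) h :=
    ((hv.continuous_fderiv (by simp)).comp (by fun_prop)).clm_apply continuous_const
  have h1 := intervalIntegral.integral_eq_sub_of_hasDerivAt (a := 0) (b := 1)
    (fun s _ => hd s) (hc.intervalIntegrable _ _)
  rw [one_smul, zero_smul, add_zero] at h1
  rw [← h1, intervalIntegral.integral_of_le zero_le_one, ← integral_Icc_eq_integral_Ioc]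
  refine (enorm_integral_le_lintegral_enorm _).trans (lintegral_mono fun s => ?_)
  rw [← enorm_norm (jac v _), ← enorm_norm h, ← enorm_mul, enorm_le_iff_norm_le,
    Real.norm_of_nonneg (by positivity)]
  exact norm_fderiv_le v _ h

/-- Write `z = y + h` with `|h| < 2 ε` and integrate the derivative along the segment. By convexity
the segment stays in the ball, so the gradient may be cut off there (this is `k`); translation
invariance in `y` then removes the dependence on `h` and on the position along the segment. -/
theorem lintegral_enorm_sub_le {m : ℕ} {v : E m → E (m + 1)} (hv : ContDiff ℝ ∞ v) (x : E m)
    (ε : ℝ) :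
    ∫⁻ y in ball x ε, ∫⁻ z in ball x ε, ‖v z - v y‖ₑ ≤
      volume (ball (0 : E m) (2 * ε)) * (ENNReal.ofReal (2 * ε) *
        ∫⁻ y in ball x ε, ‖jac v y‖ₑ) := by
  have hB : MeasurableSet (ball x ε) := measurableSet_ball
  set k : E m → ℝ≥0∞ := (ball x ε).indicator fun y => ‖jac v y‖ₑ with hk
  have hkm : Measurable k := (continuous_jac hv).enorm.measurable.indicator hB
  have hks : ∀ y h : E m, Measurable fun s : ℝ => k (y + s • h) := fun y h =>
    hkm.comp (by fun_prop)
  have hpt : ∀ y h : E m, (ball x ε).indicator (fun y => (ball x ε).indicator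
      (fun z => ‖v z - v y‖ₑ) (y + h)) y ≤
      (ball (0 : E m) (2 * ε)).indicator (fun _ => ENNReal.ofReal (2 * ε)) h *
        ∫⁻ s in Set.Icc (0 : ℝ) 1, k (y + s • h) := by
    intro y h
    by_cases hy : y ∈ ball x ε
    · by_cases hz : y + h ∈ ball x ε
      · have hh : ‖h‖ < 2 * ε := by
          have h1 := dist_triangle_right (y + h) y x
          rw [dist_eq_norm, add_sub_cancel_left] at h1
          rw [mem_ball] at hy hz
          linarith
        rw [Set.indicator_of_mem hy, Set.indicator_of_mem hz, Set.indicator_of_mem (by simpa using hh),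
          ← lintegral_const_mul _ (hks y h)]
        refine (enorm_add_sub_le hv y h).trans (setLIntegral_mono' measurableSet_Icc fun s hs => ?_)
        have hs' : y + s • h ∈ ball x ε := by
          have := (convex_ball x ε).add_smul_sub_mem hy hz hs
          simpa using this
        rw [hk, Set.indicator_of_mem hs', mul_comm]
        gcongr
        rw [← ofReal_norm]
        exact ENNReal.ofReal_le_ofReal hh.le
      · rw [Set.indicator_of_mem hy, Set.indicator_of_notMem hz]
        exact zero_le
    · simp [Set.indicator_of_notMem hy]
  calc ∫⁻ y in ball x ε, ∫⁻ z in ball x ε, ‖v z - v y‖ₑ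
      = ∫⁻ y, ∫⁻ h, (ball x ε).indicator (fun y => (ball x ε).indicator
          (fun z => ‖v z - v y‖ₑ) (y + h)) y := by
        rw [← lintegral_indicator hB]
        congr 1
        funext y
        by_cases hy : y ∈ ball x ε
        · simp only [Set.indicator_of_mem hy]
          rw [← lintegral_indicator hB,
            lintegral_add_left_eq_self ((ball x ε).indicator fun z => ‖v z - v y‖ₑ) y]
        · simp [Set.indicator_of_notMem hy]
    _ ≤ ∫⁻ y, ∫⁻ h, (ball (0 : E m) (2 * ε)).indicator (fun _ => ENNReal.ofReal (2 * ε)) h *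
        ∫⁻ s in Set.Icc (0 : ℝ) 1, k (y + s • h) :=
        lintegral_mono fun y => lintegral_mono fun h => hpt y h
    _ = ∫⁻ h, ∫⁻ y, (ball (0 : E m) (2 * ε)).indicator (fun _ => ENNReal.ofReal (2 * ε)) h *
        ∫⁻ s in Set.Icc (0 : ℝ) 1, k (y + s • h) := by
        refine lintegral_lintegral_swap (Measurable.aemeasurable ?_)
        refine Measurable.mul ((measurable_const.indicator measurableSet_ball).comp
          measurable_snd) ?_
        exact Measurable.lintegral_prod_right' (f := fun q : (E m × E m) × ℝ =>
          k (q.1.1 + q.2 • q.1.2)) (hkm.comp (by fun_prop))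
    _ = ∫⁻ h, (ball (0 : E m) (2 * ε)).indicator (fun _ => ENNReal.ofReal (2 * ε)) h *
        ∫⁻ y in ball x ε, ‖jac v y‖ₑ := by
        congr 1
        funext h
        rw [lintegral_const_mul _ (Measurable.lintegral_prod_right' (f := fun q : E m × ℝ =>
          k (q.1 + q.2 • h)) (hkm.comp (by fun_prop)))]
        congr 1
        have hsw : Measurable (Function.uncurry fun (y : E m) (s : ℝ) => k (y + s • h)) :=
          hkm.comp (g := k) (f := fun q : E m × ℝ => q.1 + q.2 • h) (by fun_prop)
        refine (lintegral_lintegral_swap hsw.aemeasurable).trans ?_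
        simp_rw [lintegral_add_right_eq_self k]
        rw [lintegral_const, Measure.restrict_apply_univ, Real.volume_Icc, sub_zero,
          ENNReal.ofReal_one, mul_one, hk, lintegral_indicator hB]
    _ = _ := by
        rw [lintegral_mul_const _ (measurable_const.indicator measurableSet_ball),
          lintegral_indicator measurableSet_ball, lintegral_const, Measure.restrict_apply_univ]
        ring

/-- A mollification is an average of translates, and the hypothesis bounds every translate because
it holds for all centres. -/
theorem lintegral_enorm_mol_le {m : ℕ} {F : Type*} [NormedAddCommGroup F] [NormedSpace ℝ F]
    (φ : ContDiffBump (0 : E m)) {Γ : E m → F} (hΓ : AEStronglyMeasurable Γ volume) {ε : ℝ}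
    {Λ : ℝ≥0∞} (h : ∀ x, ∫⁻ y in ball x ε, ‖Γ y‖ₑ ≤ Λ) (x : E m) :
    ∫⁻ y in ball x ε, ‖mol φ Γ y‖ₑ ≤ Λ := by
  set Γ' := hΓ.mk Γ with hΓ'
  have hae := hΓ.ae_eq_mk
  have hm : StronglyMeasurable Γ' := hΓ.stronglyMeasurable_mk
  have h' : ∀ x, ∫⁻ y in ball x ε, ‖Γ' y‖ₑ ≤ Λ := fun x => by
    refine le_trans (le_of_eq (lintegral_congr_ae ?_)) (h x)
    filter_upwards [ae_restrict_of_ae hae] with y hy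
    rw [hy]
  have hmol : ∀ y, mol φ Γ y = mol φ Γ' y := fun y => by
    rw [mol_eq_swap, mol_eq_swap]
    refine integral_congr_ae ?_
    filter_upwards [hae] with z hz
    rw [hz]
  have hφm : Measurable fun t => ‖φ.normed (volume : Measure (E m)) t‖ₑ :=
    φ.continuous_normed.enorm.measurable
  calc ∫⁻ y in ball x ε, ‖mol φ Γ y‖ₑ
      ≤ ∫⁻ y in ball x ε, ∫⁻ t, ‖φ.normed volume t‖ₑ * ‖Γ' (y - t)‖ₑ := by
        refine lintegral_mono fun y => ?_
        rw [hmol, mol_eq]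
        refine (enorm_integral_le_lintegral_enorm _).trans_eq ?_
        simp_rw [enorm_smul]
    _ = ∫⁻ t, ∫⁻ y in ball x ε, ‖φ.normed volume t‖ₑ * ‖Γ' (y - t)‖ₑ := by
        refine lintegral_lintegral_swap (Measurable.aemeasurable ?_)
        exact (hφm.comp measurable_snd).mul (hm.enorm.comp (by fun_prop))
    _ ≤ ∫⁻ t, ‖φ.normed volume t‖ₑ * Λ := by
        refine lintegral_mono fun t => ?_
        have hmt : Measurable fun y => ‖Γ' (y - t)‖ₑ := hm.enorm.comp (by fun_prop)
        rw [lintegral_const_mul _ hmt]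
        gcongr
        refine le_trans (le_of_eq ?_) (h' (x - t))
        rw [← lintegral_indicator measurableSet_ball, ← lintegral_indicator measurableSet_ball,
          ← lintegral_sub_right_eq_self ((ball (x - t) ε).indicator fun y => ‖Γ' y‖ₑ) t]
        congr 1
        funext y
        simp only [Set.indicator, mem_ball, dist_sub_right]
    _ = Λ := by
        rw [lintegral_mul_const _ hφm, ← ofReal_integral_norm_eq_lintegral_enorm φ.integrable_normed]
        simp_rw [Real.norm_of_nonneg (φ.nonneg_normed _)]
        rw [φ.integral_normed, ENNReal.ofReal_one, one_mul]

theorem enorm_bump_le {m : ℕ} (φ : ContDiffBump (0 : E m)) (x y : E m) :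
    ‖φ.normed volume (x - y)‖ₑ ≤ (ball x φ.rOut).indicator
      (fun _ => ENNReal.ofReal (1 / volume.real (closedBall (0 : E m) φ.rIn))) y := by
  by_cases hy : y ∈ ball x φ.rOut
  · rw [Set.indicator_of_mem hy, Real.enorm_of_nonneg (φ.nonneg_normed _)]
    exact ENNReal.ofReal_le_ofReal (φ.normed_le_div_measure_closedBall_rIn _ _)
  · rw [Set.indicator_of_notMem hy]
    have : x - y ∉ Function.support (φ.normed (volume : Measure (E m))) := by
      rw [φ.support_normed_eq]
      simpa [dist_eq_norm, norm_sub_rev] using hy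
    simp [Function.notMem_support.1 this]

/-- The defect of the triangle inequality for a mollification is controlled by the mean
oscillation. -/
theorem ofReal_mol_norm_sub_le {m : ℕ} (φ : ContDiffBump (0 : E m)) {v : E m → E (m + 1)}
    (hv : Continuous v) (x : E m) :
    ENNReal.ofReal (mol φ (fun y => ‖v y‖) x - ‖mol φ v x‖) ≤
      ENNReal.ofReal (1 / volume.real (closedBall (0 : E m) φ.rIn)) ^ 2 *
        ∫⁻ y in ball x φ.rOut, ∫⁻ z in ball x φ.rOut, ‖v z - v y‖ₑ := by
  set M := ENNReal.ofReal (1 / volume.real (closedBall (0 : E m) φ.rIn))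
  set w := mol φ v x with hw
  have hone : ∫ y, φ.normed volume (x - y) = 1 := by
    rw [integral_sub_left_eq_self (φ.normed volume) volume x, φ.integral_normed]
  have hint1 : Integrable fun y => φ.normed (volume : Measure (E m)) (x - y) :=
    φ.integrable_normed.comp_sub_left x
  have hvi := integrable_mol_swap φ (hv.locallyIntegrable (μ := volume)) x
  have hni := integrable_mol_swap φ (hv.norm.locallyIntegrable (μ := volume)) x
  have h1 : mol φ (fun y => ‖v y‖) x - ‖w‖ = ∫ y, φ.normed volume (x - y) * (‖v y‖ - ‖w‖) := by
    simp_rw [mul_sub]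
    simp only [smul_eq_mul] at hni
    rw [integral_sub hni (hint1.mul_const _), integral_mul_const, hone, one_mul, mol_eq_swap]
    rfl
  -- As `w` is a weighted mean of `v`, `w - v y` is the mean of `v z - v y`, with weight at most
  -- `M`. A second factor `M` comes from the average over `y`.
  have h2 : ∀ y, ‖v y - w‖ₑ ≤ M * ∫⁻ z in ball x φ.rOut, ‖v z - v y‖ₑ := fun y => by
    have h3 : w - v y = ∫ z, φ.normed volume (x - z) • (v z - v y) := by
      simp_rw [smul_sub]
      rw [integral_sub hvi (hint1.smul_const _), integral_smul_const, hone, one_smul, hw,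
        mol_eq_swap]
    rw [enorm_sub_rev, h3, ← lintegral_const_mul _ (by fun_prop), ← lintegral_indicator
      measurableSet_ball]
    refine (enorm_integral_le_lintegral_enorm _).trans (lintegral_mono fun z => ?_)
    rw [enorm_smul]
    refine (mul_le_mul_left (enorm_bump_le φ x z) _).trans_eq ?_
    simp only [Set.indicator]
    split_ifs <;> simp [M]
  rw [h1]
  calc ENNReal.ofReal (∫ y, φ.normed volume (x - y) * (‖v y‖ - ‖w‖))
      ≤ ‖∫ y, φ.normed volume (x - y) * (‖v y‖ - ‖w‖)‖ₑ := Real.ofReal_le_enorm _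
    _ ≤ ∫⁻ y, ‖φ.normed volume (x - y) * (‖v y‖ - ‖w‖)‖ₑ := enorm_integral_le_lintegral_enorm _
    _ ≤ ∫⁻ y, (ball x φ.rOut).indicator
        (fun y => M * (M * ∫⁻ z in ball x φ.rOut, ‖v z - v y‖ₑ)) y := by
        refine lintegral_mono fun y => ?_
        rw [enorm_mul]
        have h4 : ‖‖v y‖ - ‖w‖‖ₑ ≤ ‖v y - w‖ₑ := by
          rw [enorm_le_iff_norm_le]
          exact abs_norm_sub_norm_le _ _
        refine (mul_le_mul' (enorm_bump_le φ x y) (h4.trans (h2 y))).trans_eq ?_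
        simp only [Set.indicator]
        split_ifs <;> simp [M]
    _ = _ := by
        rw [lintegral_indicator measurableSet_ball]
        have hm2 : Measurable fun y => ∫⁻ z in ball x φ.rOut, ‖v z - v y‖ₑ :=
          Measurable.lintegral_prod_right' (f := fun q : E m × E m => ‖v q.2 - v q.1‖ₑ)
            (Continuous.measurable (by fun_prop))
        rw [lintegral_const_mul _ (hm2.const_mul _), lintegral_const_mul _ hm2]
        ring

/-! ### Mollifications of maps into the sphere do not vanish -/

/-- A sequence of bump functions with radii tending to zero. -/
def bumpSeq (m n : ℕ) : ContDiffBump (0 : E m) where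
  rIn := (2 * ((n : ℝ) + 1))⁻¹
  rOut := ((n : ℝ) + 1)⁻¹
  rIn_pos := by positivity
  rIn_lt_rOut := by
    apply inv_strictAnti₀ (by positivity)
    have : (0 : ℝ) ≤ n := n.cast_nonneg
    linarith

theorem rOut_bumpSeq_eq (m n : ℕ) : (bumpSeq m n).rOut = 2 * (bumpSeq m n).rIn := by
  simp only [bumpSeq]
  field_simp

theorem tendsto_rOut_bumpSeq (m : ℕ) : Tendsto (fun n => (bumpSeq m n).rOut) atTop (𝓝 0) := by
  simpa [bumpSeq] using tendsto_one_div_add_atTop_nhds_zero_nat (𝕜 := ℝ)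

theorem ae_tendsto_mol {m : ℕ} {F : Type*} [NormedAddCommGroup F] [NormedSpace ℝ F]
    [CompleteSpace F] {f : E m → F} (hf : LocallyIntegrable f volume) :
    ∀ᵐ x, Tendsto (fun n => mol (bumpSeq m n) f x) atTop (𝓝 (f x)) :=
  ContDiffBump.ae_convolution_tendsto_right_of_locallyIntegrable (K := 2) (tendsto_rOut_bumpSeq m)
    (Eventually.of_forall fun n => (rOut_bumpSeq_eq m n).le) hf

theorem tendsto_mol {m : ℕ} {F : Type*} [NormedAddCommGroup F] [NormedSpace ℝ F]
    (φ : ContDiffBump (0 : E m)) {v : ℕ → E m → F} {u : E m → F} (hv : ∀ n, Continuous (v n))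
    (hv1 : ∀ n x, ‖v n x‖ ≤ 1) (h : ∀ᵐ x, Tendsto (fun n => v n x) atTop (𝓝 (u x))) (x : E m) :
    Tendsto (fun n => mol φ (v n) x) atTop (𝓝 (mol φ u x)) := by
  simp_rw [mol_eq_swap]
  refine tendsto_integral_of_dominated_convergence (fun y => φ.normed volume (x - y))
    (fun n => ?_) (φ.integrable_normed.comp_sub_left x) (fun n => ?_) ?_
  · exact ((φ.continuous_normed.comp (by fun_prop)).smul (hv n)).aestronglyMeasurable
  · refine Eventually.of_forall fun y => ?_
    rw [norm_smul, Real.norm_of_nonneg (φ.nonneg_normed _)]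
    exact mul_le_of_le_one_right (φ.nonneg_normed _) (hv1 n y)
  · filter_upwards [h] with y hy
    exact hy.const_smul _

/-- Since `|u| = 1`, the left side is the defect of the triangle inequality for the mollification of
`u`. The oscillation and Poincaré estimates are available for smooth maps, so they are applied to
finer mollifications of `u` and passed to the limit. -/
theorem IsWeakMap.ofReal_one_sub_le {m : ℕ} (hm : 0 < m) {b : E (m + 1)} {u : E m → E (m + 1)}
    {Γ : E m → Jac m} (h : IsWeakMap b u Γ) (φ : ContDiffBump (0 : E m)) {Λ : ℝ≥0∞}
    (hΛ : ∀ x, ∫⁻ y in ball x φ.rOut, ‖Γ y‖ₑ ≤ Λ) (x : E m) :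
    ENNReal.ofReal (1 - ‖mol φ u x‖) ≤
      ENNReal.ofReal (1 / volume.real (closedBall (0 : E m) φ.rIn)) ^ 2 *
        (volume (ball (0 : E m) (2 * φ.rOut)) * (ENNReal.ofReal (2 * φ.rOut) * Λ)) := by
  have hsm : ∀ n, ContDiff ℝ ∞ (mol (bumpSeq m n) u) := fun n =>
    contDiff_mol _ h.locallyIntegrable
  have hle : ∀ n x, ‖mol (bumpSeq m n) u x‖ ≤ 1 := fun n x =>
    norm_mol_le_one _ (h.norm_eq_one.mono fun y hy => hy.le) x
  have hae := ae_tendsto_mol h.locallyIntegrable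
  have h1 := tendsto_mol φ (fun n => (hsm n).continuous) hle hae x
  have h2 := tendsto_mol φ (v := fun n y => ‖mol (bumpSeq m n) u y‖) (u := fun y => ‖u y‖)
    (fun n => (hsm n).continuous.norm) (fun n y => by simpa using hle n y)
    (hae.mono fun y hy => hy.norm) x
  have h3 : mol φ (fun y => ‖u y‖) x = 1 := by
    rw [mol_eq_swap, ← φ.integral_normed (μ := volume),
      ← integral_sub_left_eq_self (φ.normed volume) volume x]
    refine integral_congr_ae ?_
    filter_upwards [h.norm_eq_one] with y hy
    rw [hy, smul_eq_mul, mul_one]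
  rw [h3] at h2
  refine le_of_tendsto ((ENNReal.continuous_ofReal.tendsto _).comp (h2.sub h1.norm))
    (Eventually.of_forall fun n => ?_)
  refine (ofReal_mol_norm_sub_le φ (hsm n).continuous x).trans ?_
  gcongr
  refine (lintegral_enorm_sub_le (hsm n) x φ.rOut).trans ?_
  gcongr
  simp_rw [h.jac_mol hm]
  exact lintegral_enorm_mol_le _ h.memLp.1 hΛ x

/-- Either `a ≤ l`, or `(a / l) ^ (m - 1) ≥ 1`. This elementary bound takes the place of Hölder's
inequality. -/
theorem le_add_mul_pow {m : ℕ} (hm : 0 < m) {a l : ℝ} (ha : 0 ≤ a) (hl : 0 < l) :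
    a ≤ l + (l ^ (m - 1))⁻¹ * a ^ m := by
  rcases le_total a l with h | h
  · have : 0 ≤ (l ^ (m - 1))⁻¹ * a ^ m := by positivity
    linarith
  · obtain ⟨k, rfl⟩ : ∃ k, m = k + 1 := ⟨m - 1, by omega⟩
    have h1 : l ^ k ≤ a ^ k := pow_le_pow_left₀ hl.le h k
    have h2 : a ≤ (l ^ k)⁻¹ * a ^ (k + 1) := by
      rw [inv_mul_eq_div, le_div_iff₀ (by positivity), pow_succ, mul_comm]
      exact mul_le_mul_of_nonneg_right h1 ha
    simp only [Nat.add_sub_cancel]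
    linarith

/-- The threshold `l = η / ε` in `le_add_mul_pow` gives both terms the same order `η ε ^ (m - 1)`.
-/
theorem lintegral_enorm_le_of_pow {m : ℕ} (hm : 0 < m) {F : Type*} [NormedAddCommGroup F]
    {Γ : E m → F} {x : E m} {ε η : ℝ} (hε : 0 < ε) (hη : 0 < η)
    (h : ∫⁻ y in ball x ε, ‖Γ y‖ₑ ^ m ≤ ENNReal.ofReal (η ^ m)) :
    ∫⁻ y in ball x ε, ‖Γ y‖ₑ ≤
      ENNReal.ofReal (η * ε ^ (m - 1) * (volume.real (ball (0 : E m) 1) + 1)) := by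
  set l := η / ε with hl
  have hl0 : 0 < l := by positivity
  have hV : volume (ball x ε) = ENNReal.ofReal (ε ^ m * volume.real (ball (0 : E m) 1)) := by
    rw [Measure.addHaar_ball_of_pos volume x hε, finrank_euclideanSpace_fin, ENNReal.ofReal_mul
      (by positivity), ofReal_measureReal measure_ball_lt_top.ne]
  calc ∫⁻ y in ball x ε, ‖Γ y‖ₑ
      ≤ ∫⁻ y in ball x ε, (ENNReal.ofReal l + ENNReal.ofReal (l ^ (m - 1))⁻¹ * ‖Γ y‖ₑ ^ m) := by
        refine lintegral_mono fun y => ?_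
        rw [← ofReal_norm, ← ENNReal.ofReal_pow (norm_nonneg _), ← ENNReal.ofReal_mul
          (by positivity), ← ENNReal.ofReal_add (by positivity) (by positivity)]
        exact ENNReal.ofReal_le_ofReal (le_add_mul_pow hm (norm_nonneg _) hl0)
    _ = ENNReal.ofReal l * volume (ball x ε) +
        ENNReal.ofReal (l ^ (m - 1))⁻¹ * ∫⁻ y in ball x ε, ‖Γ y‖ₑ ^ m := by
        rw [lintegral_add_left measurable_const, lintegral_const_mul' _ _ ENNReal.ofReal_ne_top,
          lintegral_const, Measure.restrict_apply_univ]
    _ ≤ ENNReal.ofReal l * volume (ball x ε) +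
        ENNReal.ofReal (l ^ (m - 1))⁻¹ * ENNReal.ofReal (η ^ m) := by gcongr
    _ = _ := by
        rw [hV, ← ENNReal.ofReal_mul (by positivity), ← ENNReal.ofReal_mul (by positivity),
          ← ENNReal.ofReal_add (by positivity) (by positivity)]
        congr 1
        obtain ⟨k, rfl⟩ : ∃ k, m = k + 1 := ⟨m - 1, by omega⟩
        simp only [Nat.add_sub_cancel, hl, div_pow]
        field_simp
        ring

/-- Mollifications of a sphere-valued map of class `W^{1,m}` at small scales stay away from the
origin. -/
theorem IsWeakMap.exists_half_le_norm_mol {m : ℕ} (hm : 0 < m) {b : E (m + 1)}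
    {u : E m → E (m + 1)} {Γ : E m → Jac m} (h : IsWeakMap b u Γ) :
    ∃ ε₀ > 0, ∀ φ : ContDiffBump (0 : E m), φ.rOut = 2 * φ.rIn → φ.rOut < ε₀ →
      ∀ x, 1 / 2 ≤ ‖mol φ u x‖ := by
  set V := volume.real (ball (0 : E m) 1) with hV
  have hV0 : 0 < V := ENNReal.toReal_pos (measure_ball_pos _ _ one_pos).ne' measure_ball_lt_top.ne
  -- The constant that results from the Poincaré and `L¹` bounds; `η` is then chosen so that `C * η
  -- = 1 / 2`.
  set C : ℝ := 2 ^ (3 * m + 1) * V⁻¹ * (V + 1) with hC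
  have hC0 : 0 < C := by positivity
  set η : ℝ := 1 / (2 * C) with hη
  have hη0 : 0 < η := by positivity
  have hfin : ∫⁻ x, ‖Γ x‖ₑ ^ m ≠ ⊤ := by
    have := (h.integrable_norm_pow hm).hasFiniteIntegral
    simpa [HasFiniteIntegral, lt_top_iff_ne_top] using this
  -- Absolute continuity of the integral makes the energy on every sufficiently small ball less than
  -- `η ^ m`, uniformly in the centre.
  obtain ⟨δ, hδ, hδs⟩ := exists_pos_setLIntegral_lt_of_measure_lt hfin
    (ε := ENNReal.ofReal (η ^ m)) (by
      rw [Ne, ENNReal.ofReal_eq_zero, not_le]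
      positivity)
  have hvol : ∀ (x : E m) {r : ℝ}, 0 < r → volume (ball x r) = ENNReal.ofReal (r ^ m * V) := by
    intro x r hr
    rw [Measure.addHaar_ball_of_pos volume x hr, finrank_euclideanSpace_fin, ENNReal.ofReal_mul
      (by positivity), hV, ofReal_measureReal measure_ball_lt_top.ne]
  obtain ⟨ε₀, hε₀, hε₀δ⟩ : ∃ ε₀ : ℝ, 0 < ε₀ ∧ ∀ r, 0 ≤ r → r < ε₀ →
      ENNReal.ofReal (r ^ m * V) < δ := by
    have hc : Continuous fun r : ℝ => ENNReal.ofReal (r ^ m * V) :=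
      ENNReal.continuous_ofReal.comp (by fun_prop)
    have h0 : ENNReal.ofReal ((0 : ℝ) ^ m * V) < δ := by
      rw [zero_pow hm.ne', zero_mul, ENNReal.ofReal_zero]
      exact hδ
    obtain ⟨ε₀, hε₀, hs⟩ := Metric.eventually_nhds_iff.1 (hc.continuousAt.eventually_lt
      continuousAt_const h0)
    exact ⟨ε₀, hε₀, fun r hr hlt => hs (by rwa [Real.dist_0_eq_abs, abs_of_nonneg hr])⟩
  refine ⟨ε₀, hε₀, fun φ hφ hlt x => ?_⟩
  set ε := φ.rOut with hε
  have hε0 : 0 < ε := φ.rOut_pos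
  have hin : φ.rIn = ε / 2 := by linarith
  have h1 := h.ofReal_one_sub_le hm φ (fun z => lintegral_enorm_le_of_pow hm hε0 hη0
    (hδs _ (by
      rw [hvol z hε0]
      exact hε₀δ _ hε0.le hlt)).le) x
  have hcb : volume.real (closedBall (0 : E m) φ.rIn) = (ε / 2) ^ m * V := by
    rw [measureReal_def, Measure.addHaar_closedBall volume _ φ.rIn_pos.le,
      finrank_euclideanSpace_fin, ENNReal.toReal_mul,
      ENNReal.toReal_ofReal (pow_nonneg φ.rIn_pos.le _), hin]
    rfl
  rw [hcb, ← hε, hvol _ (by positivity), ← hV, ← ENNReal.ofReal_mul (by positivity),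
    ← ENNReal.ofReal_mul (by positivity), ← ENNReal.ofReal_pow (by positivity),
    ← ENNReal.ofReal_mul (by positivity), ENNReal.ofReal_le_ofReal_iff (by positivity)] at h1
  -- All powers of `ε` cancel, `-2 m + m + 1 + (m - 1) = 0`: the estimate is scale invariant, which
  -- is where the critical exponent `m` enters.
  have h2 : (1 / ((ε / 2) ^ m * V)) ^ 2 *
      ((2 * ε) ^ m * V * (2 * ε * (η * ε ^ (m - 1) * (V + 1)))) = C * η := by
    obtain ⟨k, rfl⟩ : ∃ k, m = k + 1 := ⟨m - 1, by omega⟩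
    simp only [Nat.add_sub_cancel, hC, div_pow, mul_pow]
    field_simp
    ring
  have h3 : C * η = 1 / 2 := by
    rw [hη]
    field_simp
  rw [h2, h3] at h1
  linarith

/-! ### The degree of a Sobolev map is an integer -/

theorem jacDet_add_smul_self {m : ℕ} (p : E (m + 1)) (A : Fin m → E (m + 1)) (d : Fin m → ℝ) :
    jacDet p (fun i => A i + d i • p) = jacDet p A := by
  rw [jacDet, jacDet, detForm_apply, detForm_apply]
  refine Matrix.det_eq_of_forall_row_eq_smul_add_const (Fin.cons (α := fun _ => ℝ) 0 d) 0 rfl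
    fun i j => ?_
  refine Fin.cases ?_ (fun i => ?_) i <;> simp

theorem jacDet_smul_right {m : ℕ} (p : E (m + 1)) (A : Fin m → E (m + 1)) (c : ℝ) :
    jacDet p (fun i => c • A i) = c ^ m * jacDet p A := by
  have h := (detForm m).map_smul_univ (Fin.cons (α := fun _ => ℝ) 1 fun _ => c)
    (Fin.cons (α := fun _ => E (m + 1)) p A)
  rw [Fin.prod_univ_succ] at h
  simp only [Fin.cons_zero, Fin.cons_succ, Finset.prod_const, Finset.card_univ, Fintype.card_fin,
    one_mul] at h
  rw [jacDet, jacDet, ← smul_eq_mul, ← h]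
  congr 1
  funext i
  refine Fin.cases ?_ (fun i => ?_) i <;> simp

/-- The oriented Jacobian of a normalized map. -/
theorem jacDet_normalize {m : ℕ} {w : E m → E (m + 1)} (hw : ContDiff ℝ ∞ w) (h0 : ∀ x, w x ≠ 0)
    (x : E m) : jacDet (normalize (w x)) (grad (fun x => normalize (w x)) x)
      = jacDet ((‖w x‖⁻¹ ^ (m + 1)) • w x) (grad w x) := by
  have hr : DifferentiableAt ℝ (fun z => ‖w z‖⁻¹) x :=
    ((hw.differentiable (by simp) x).norm ℝ (h0 x)).inv (norm_ne_zero_iff.2 (h0 x))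
  have hg : grad (fun x => normalize (w x)) x = fun i => ‖w x‖⁻¹ • grad w x i +
      fderiv ℝ (fun z => ‖w z‖⁻¹) x (EuclideanSpace.single i 1) • w x := by
    funext i
    have h1 : fderiv ℝ (fun z => normalize (w z)) x = _ :=
      (hr.hasFDerivAt.smul (hw.differentiable (by simp) x).hasFDerivAt).fderiv
    rw [grad, pderiv, h1]
    simp [grad, pderiv]
  rw [hg, normalize, jacDet_smul_left, jacDet_add_smul_self, jacDet_smul_right, jacDet_smul_left,
    pow_succ]
  ring

theorem degInt_mem_zmultiples {m : ℕ} (hm : 2 ≤ m) {b : E (m + 1)} (hb : ‖b‖ = 1)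
    {g : E m → E (m + 1)} (hg : IsSmoothMap b g) :
    degInt g ∈ AddSubgroup.zmultiples (sphereArea m).toReal := by
  obtain ⟨y, hy, hyb, hr⟩ := exists_regularValue hb hg
  rw [degInt_eq_signedCount hm hg hy hyb hr, AddSubgroup.mem_zmultiples_iff]
  exact ⟨signedCount g y, by rw [zsmul_eq_mul, mul_comm]⟩

namespace IsWeakMap

variable {m : ℕ} {b : E (m + 1)} {u : E m → E (m + 1)} {Γ : E m → Jac m}

theorem isSmoothMap_normalize_mol (h : IsWeakMap b u Γ) {φ : ContDiffBump (0 : E m)}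
    (h0 : ∀ x, mol φ u x ≠ 0) (hb : ‖b‖ = 1) :
    IsSmoothMap b fun x => normalize (mol φ u x) where
  contDiff := contDiff_normalize (contDiff_mol φ h.locallyIntegrable) h0
  norm_eq_one x := norm_normalize (h0 x)
  eq_base := ⟨1 + φ.rOut, fun x hx => by
    rw [mol_eq_const φ h.eq_base hx, normalize_of_norm hb]⟩

theorem eventually_half_le_norm_mol (hm : 0 < m) (h : IsWeakMap b u Γ) :
    ∀ᶠ n in atTop, ∀ x, 1 / 2 ≤ ‖mol (bumpSeq m n) u x‖ := by
  obtain ⟨ε₀, hε₀, hφ⟩ := h.exists_half_le_norm_mol hm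
  filter_upwards [(tendsto_rOut_bumpSeq m).eventually_lt_const hε₀] with n hn
  exact hφ _ (rOut_bumpSeq_eq m n) hn

theorem ne_zero_of_half_le {w : E m → E (m + 1)} (h : ∀ x, 1 / 2 ≤ ‖w x‖) (x : E m) : w x ≠ 0 :=
  norm_pos_iff.1 (lt_of_lt_of_le (by norm_num) (h x))

/-- The degree integrals of the normalized mollifications converge. -/
theorem tendsto_degInt (hm : 0 < m) (h : IsWeakMap b u Γ) :
    Tendsto (fun n => degInt fun x => normalize (mol (bumpSeq m n) u x)) atTop
      (𝓝 (∫ x, jacDet (u x) (Γ x).ofLp)) := by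
  obtain ⟨N, hN⟩ := eventually_atTop.1 (h.eventually_half_le_norm_mol hm)
  rw [← tendsto_add_atTop_iff_nat N]
  set w : ℕ → E m → E (m + 1) := fun n => mol (bumpSeq m (n + N)) u with hw
  have hhalf : ∀ n x, 1 / 2 ≤ ‖w n x‖ := fun n => hN (n + N) (by omega)
  have hpos : ∀ n x, 0 < ‖w n x‖ := fun n x => lt_of_lt_of_le (by norm_num) (hhalf n x)
  have hws : ∀ n, ContDiff ℝ ∞ (w n) := fun n => contDiff_mol _ h.locallyIntegrable
  have hshift : Tendsto (fun n : ℕ => n + N) atTop atTop := tendsto_add_atTop_nat N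
  -- Since `|w| ≥ 1 / 2`, the vector `|w| ^ (-(m + 1)) w` has norm at most `2 ^ m`; the factor `c`
  -- brings it into the unit ball, as `tendsto_integral_jacDet` requires. The dominating functions
  -- are the mollifications of `‖Γ‖ ^ m`, all with the same integral.
  set c : ℝ := (1 / 2) ^ m with hc
  have hc0 : c ≠ 0 := by positivity
  have hgi := h.integrable_norm_pow hm
  have key := tendsto_integral_jacDet (μ := (volume : Measure (E m))) hm
    (p := fun n x => (c * ‖w n x‖⁻¹ ^ (m + 1)) • w n x)
    (p₀ := fun x => (c * ‖u x‖⁻¹ ^ (m + 1)) • u x) (A := fun n => jac (w n)) (A₀ := Γ)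
    (g := fun n => mol (bumpSeq m (n + N)) fun y => ‖Γ y‖ ^ m) (g₀ := fun y => ‖Γ y‖ ^ m)
    (fun n => ?_) (fun n => (continuous_jac (hws n)).aestronglyMeasurable)
    (fun n => integrable_mol_of_integrable _ hgi) hgi (fun n => Eventually.of_forall fun x => ?_)
    (fun n => Eventually.of_forall fun x => h.norm_jac_mol_pow_le hm _ x) ?_ ?_ ?_ ?_
  · have h1 : ∀ n, ∫ x, jacDet ((c * ‖w n x‖⁻¹ ^ (m + 1)) • w n x) (jac (w n) x).ofLp
        = c * degInt fun x => normalize (w n x) := fun n => by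
      rw [degInt, ← integral_const_mul]
      congr 1
      funext x
      rw [jacDet_normalize (hws n) (fun x => norm_pos_iff.1 (hpos n x)), mul_smul,
        jacDet_smul_left]
      rfl
    have h2 : ∫ x, jacDet ((c * ‖u x‖⁻¹ ^ (m + 1)) • u x) (Γ x).ofLp
        = c * ∫ x, jacDet (u x) (Γ x).ofLp := by
      rw [← integral_const_mul]
      refine integral_congr_ae ?_
      filter_upwards [h.norm_eq_one] with x hx
      rw [hx, jacDet_smul_left]
      simp
    simp_rw [h1, h2] at key
    have := key.const_mul c⁻¹
    simpa only [inv_mul_cancel_left₀ hc0] using this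
  · refine Continuous.aestronglyMeasurable (Continuous.smul (continuous_const.mul
      (((hws n).continuous.norm.inv₀ fun x => (hpos n x).ne').pow _)) (hws n).continuous)
  · have h1 : ‖w n x‖⁻¹ ≤ 2 := by
      rw [inv_le_comm₀ (hpos n x) two_pos]
      simpa using hhalf n x
    have h2 : ‖w n x‖⁻¹ ^ m ≤ 2 ^ m := pow_le_pow_left₀ (by positivity) h1 m
    rw [norm_smul, Real.norm_of_nonneg (by positivity), pow_succ, mul_assoc, mul_assoc,
      inv_mul_cancel₀ (hpos n x).ne', mul_one, hc, one_div, inv_pow, inv_mul_le_iff₀ (by positivity),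
      mul_one]
    exact h2
  · filter_upwards [ae_tendsto_mol h.locallyIntegrable, h.norm_eq_one] with x hx h1
    have hx' := hx.comp hshift
    exact (((hx'.norm.inv₀ (by rw [h1]; norm_num)).pow _).const_mul c).smul hx'
  · filter_upwards [ae_tendsto_mol (h.locallyIntegrable_grad hm)] with x hx
    simp_rw [hw, h.jac_mol hm]
    exact hx.comp hshift
  · filter_upwards [ae_tendsto_mol hgi.locallyIntegrable] with x hx
    exact hx.comp hshift
  · simp_rw [integral_mol _ hgi]
    exact tendsto_const_nhds

end IsWeakMap

/-- The degree integral of a Sobolev map is an integer multiple of the area of the sphere. -/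
theorem IsSobolevMap.jacInt_mem_zmultiples {m : ℕ} (hm : 2 ≤ m) {b : S m} {f : E m → E (m + 1)}
    {G : E m → Jac m} (h : IsSobolevMap b f G) :
    jacInt f G ∈ AddSubgroup.zmultiples (sphereArea m).toReal := by
  have hm0 : 0 < m := by omega
  have hw := h.isWeakMap hm0
  rw [jacInt_eq_integral hm0 (b := b)]
  -- The degree integrals of the smooth approximations lie in this lattice, so their limit does too.
  have hcl : IsClosed (AddSubgroup.zmultiples (sphereArea m).toReal : Set ℝ) :=
    AddSubgroup.isClosed_of_discrete
  refine hcl.mem_of_tendsto (hw.tendsto_degInt hm0) ?_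
  filter_upwards [hw.eventually_half_le_norm_mol hm0] with n hn
  exact degInt_mem_zmultiples hm (norm_base b)
    (hw.isSmoothMap_normalize_mol (IsWeakMap.ne_zero_of_half_le hn) (norm_base b))

/-- The degree integral of a continuous Sobolev map depends only on its homotopy class. -/
theorem IsSobolevMap.jacInt_eq_degInt {m : ℕ} (hm : 2 ≤ m) {b : S m} {σ : π_ m (S m) b}
    {g : E m → E (m + 1)} {G : E m → Jac m} (h : IsSobolevMap b g G) (hg : ContinuousRep σ g)
    {F : E m → E (m + 1)} (hF : IsSmoothMap (b : E (m + 1)) F) (hσ : cls hF.isContMap = σ) :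
    jacInt g G = degInt F := by
  have hm0 : 0 < m := by omega
  have hw := h.isWeakMap hm0
  obtain ⟨hc, hcσ⟩ := hg.exists_cls
  obtain ⟨δ, hδ, hu⟩ := Metric.uniformContinuous_iff.1 hc.uniformContinuous (1 / 2) (by norm_num)
  rw [jacInt_eq_integral hm0 (b := b)]
  refine tendsto_nhds_unique (hw.tendsto_degInt hm0) (tendsto_const_nhds.congr' ?_)
  filter_upwards [hw.eventually_half_le_norm_mol hm0,
    (tendsto_rOut_bumpSeq m).eventually_lt_const hδ] with n hn hnδ
  have h0 := IsWeakMap.ne_zero_of_half_le hn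
  have hs := hw.isSmoothMap_normalize_mol h0 (norm_base b)
  refine degInt_eq_of_cls_eq hm hF hs ?_
  rw [hσ, ← hcσ]
  -- Uniform continuity puts the mollification within `1 / 2` of the map; after normalising the
  -- distance is at most `1`, which excludes antipodal values.
  refine (cls_eq_of_ne_neg hs.isContMap hc fun x => ?_).symm
  refine ne_neg_of_dist_lt (hc.norm_eq_one x) ((dist_normalize_le (hc.norm_eq_one x)
    (h0 x)).trans_lt ?_)
  have : dist (mol (bumpSeq m n) (extendBy b g) x) (extendBy b g x) ≤ 1 / 2 :=
    ContDiffBump.dist_normed_convolution_le hw.aestronglyMeasurable fun y hy =>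
      (hu ((mem_ball.1 hy).trans hnδ)).le
  linarith

/-! ### The topological energy -/

/-- The degree integral is constant along Sobolev homotopies. -/
theorem SobolevHomotopic.exists_jacInt_eq {m : ℕ} (hm : 2 ≤ m) {b : S m} {f g : E m → E (m + 1)}
    {G : E m → Jac m} (hf : IsSobolevMap b f G) (h : SobolevHomotopic b f g) :
    ∃ G', IsSobolevMap b g G' ∧ jacInt f G = jacInt g G' := by
  have hm0 : 0 < m := by omega
  obtain ⟨H, Γ, hs, hc, rfl, rfl⟩ := h
  have h0 : (0 : ℝ) ∈ Set.Icc (0 : ℝ) 1 := by simp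
  have h1 : (1 : ℝ) ∈ Set.Icc (0 : ℝ) 1 := by simp
  refine ⟨Γ 1, hs 1 h1, ?_⟩
  -- The given weak gradient and the one carried by the path agree almost everywhere.
  have hG : jacInt (H 0) G = jacInt (H 0) (Γ 0) := by
    refine integral_congr_ae ?_
    filter_upwards [hf.ae_eq_grad hm0 (hs 0 h0)] with x hx
    rw [hx]
  rw [hG]
  -- A continuous function on a connected interval with values in a discrete set is constant.
  refine isPreconnected_Icc.constant_of_mapsTo (f := fun t => jacInt (H t) (Γ t))
    (T := (AddSubgroup.zmultiples (sphereArea m).toReal : Set ℝ))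
    (isDiscrete_iff_discreteTopology.2
      (inferInstanceAs (DiscreteTopology (AddSubgroup.zmultiples (sphereArea m).toReal))))
    (fun s hs' => ?_)
    (fun t ht => (hs t ht).jacInt_mem_zmultiples hm) h0 h1
  exact tendsto_jacInt hm0 (eventually_mem_nhdsWithin.mono fun t ht => hs t ht) (hs s hs')
    (hc s hs').1 (hc s hs').2

theorem MemClass.jacInt_eq_degInt {m : ℕ} (hm : 2 ≤ m) {b : S m} {σ : π_ m (S m) b}
    {f : E m → E (m + 1)} {G : E m → Jac m} (hf : IsSobolevMap b f G) (h : MemClass f σ)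
    {F : E m → E (m + 1)} (hF : IsSmoothMap (b : E (m + 1)) F) (hσ : cls hF.isContMap = σ) :
    jacInt f G = degInt F := by
  obtain ⟨g, hg, hfg⟩ := h
  obtain ⟨G', hG', heq⟩ := hfg.exists_jacInt_eq hm hf
  rw [heq, hG'.jacInt_eq_degInt hm hg hF hσ]

theorem IsSobolevMap.ofReal_mul_enorm_jacInt_le {m : ℕ} (hm : 0 < m) {b : S m}
    {f : E m → E (m + 1)} {G : E m → Jac m} (h : IsSobolevMap b f G) :
    ENNReal.ofReal ((m : ℝ) ^ ((m : ℝ) / 2)) * ‖jacInt f G‖ₑ ≤ ∫⁻ x in B m, ‖G x‖ₑ ^ m := by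
  calc ENNReal.ofReal ((m : ℝ) ^ ((m : ℝ) / 2)) * ‖jacInt f G‖ₑ
      ≤ ENNReal.ofReal ((m : ℝ) ^ ((m : ℝ) / 2)) *
        ∫⁻ x in B m, ‖jacDet (f x) (G x).ofLp‖ₑ := by
        gcongr
        exact enorm_integral_le_lintegral_enorm _
    _ = ∫⁻ x in B m, ENNReal.ofReal ((m : ℝ) ^ ((m : ℝ) / 2)) * ‖jacDet (f x) (G x).ofLp‖ₑ :=
        (lintegral_const_mul' _ _ ENNReal.ofReal_ne_top).symm
    _ ≤ _ := by
        refine lintegral_mono_ae ?_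
        filter_upwards [h.mem_sphere] with x hx
        have h1 : ‖f x‖ ≤ 1 := (mem_sphere_zero_iff_norm.1 hx).le
        rw [← ofReal_norm, ← ofReal_norm, ← ENNReal.ofReal_mul (by positivity),
          ← ENNReal.ofReal_pow (norm_nonneg _)]
        exact ENNReal.ofReal_le_ofReal (abs_jacDet_le_norm_pow hm h1 (G x))

theorem SobolevHomotopic.refl {m : ℕ} {b : S m} {f : E m → E (m + 1)} {G : E m → Jac m}
    (h : IsSobolevMap b f G) : SobolevHomotopic b f f :=
  ⟨fun _ => f, fun _ => G, fun _ _ => h, fun s _ => by simp [tendsto_const_nhds], rfl, rfl⟩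

/-- The degree of a class can be computed with any regular value of any smooth representative. -/
theorem isBrouwerDegree_signedCount {m : ℕ} (hm : 2 ≤ m) {b : S m} {σ : π_ m (S m) b}
    {F : E m → E (m + 1)} (hF : IsSmoothMap (b : E (m + 1)) F) (hσ : cls hF.isContMap = σ)
    {y : E (m + 1)} (hy : ‖y‖ = 1) (hyb : y ≠ b) (hr : IsRegularValue F y) :
    IsBrouwerDegree σ (signedCount F y) := by
  intro g hg hgb hgσ z hzb hz
  obtain ⟨hc, hcσ⟩ := hgσ.exists_cls
  have hgg : extendBy b g = g := by
    funext x
    rw [extendBy]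
    split_ifs with hx
    · rfl
    · exact (hgb x hx).symm
  have hgs : IsSmoothMap (b : E (m + 1)) g := by
    refine ⟨hg, fun x => ?_, 1, fun x hx => hgb x (by simpa using hx)⟩
    rw [← hgg]
    exact hc.norm_eq_one x
  have hcls : cls hgs.isContMap = cls hF.isContMap := by
    rw [hσ, ← hcσ]
    exact cls_congr _ _ fun x => (congrFun hgg x).symm
  have h1 := degInt_eq_of_cls_eq hm hgs hF hcls
  rw [degInt_eq_signedCount hm hgs (norm_base z) (fun h => hzb (Subtype.ext h)) hz,
    degInt_eq_signedCount hm hF hy hyb hr] at h1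
  exact_mod_cast mul_left_cancel₀ (sphereArea_toReal_pos m).ne' h1

theorem existsUnique_degree_and_topEnergy_eq (m : ℕ) (hm : 2 ≤ m) (b : S m) (σ : π_ m (S m) b) :
    (∃! d : ℤ, IsBrouwerDegree σ d) ∧
    topEnergy σ = ENNReal.ofReal ((m : ℝ) ^ ((m : ℝ) / 2)) * sphereArea m *
      ((brouwerDegree σ).natAbs : ℝ≥0∞) := by
  have hm0 : 0 < m := by omega
  have hS := sphereArea_toReal_pos m
  obtain ⟨F, hF, hF1, hσ⟩ := exists_smooth_rep σ one_pos
  obtain ⟨y, hy, hyb, hr⟩ := exists_regularValue (norm_base b) hF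
  have hd := isBrouwerDegree_signedCount hm hF hσ hy hyb hr
  set d := signedCount F y with hd_def
  -- Without a smooth representative having a regular value, `IsBrouwerDegree` would hold vacuously
  -- for every integer; `F` and `y` rule this out.
  have huniq : ∀ d', IsBrouwerDegree σ d' → d' = d := fun d' hd' =>
    (hd' F hF.contDiff (fun x hx => hF1 x (by simpa using hx))
      (hσ ▸ continuousRep_cls hF.isContMap fun x hx => hF1 x (by simpa using hx))
      ⟨y, mem_sphere_zero_iff_norm.2 hy⟩ (fun h => hyb (congrArg Subtype.val h)) hr).symm
  have hdeg : brouwerDegree σ = d := huniq _ (Classical.epsilon_spec ⟨d, hd⟩)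
  have hdF : degInt F = (sphereArea m).toReal * d := degInt_eq_signedCount hm hF hy hyb hr
  have habs : |degInt F| = (sphereArea m).toReal * d.natAbs := by
    rw [hdF, abs_mul, abs_of_pos hS, Nat.cast_natAbs, Int.cast_abs]
  refine ⟨⟨d, hd, huniq⟩, ?_⟩
  rw [hdeg]
  refine le_antisymm ?_ (le_iInf fun f => le_iInf fun G => le_iInf fun hf => le_iInf fun hfσ => ?_)
  · refine ENNReal.le_of_forall_pos_le_add fun δ hδ _ => ?_
    have hK : (0 : ℝ≥0∞) < (d.natAbs : ℝ≥0∞) + 1 := by positivity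
    -- Each of the at most `|d|` bubbles is allowed an excess `δ / (|d| + 1)`; the added `1` covers
    -- degree zero.
    obtain ⟨F', hF', n, hF1', hσ', hn, hle⟩ := exists_smooth_lintegral_le hm σ
      (ε := δ / (d.natAbs + 1)) (ENNReal.div_pos (by exact_mod_cast hδ.ne') (by finiteness))
    -- The `n` bubbles contribute at least `n |S^m|` to the absolute value of the degree integral,
    -- which is determined by the class.
    have hnd : n ≤ d.natAbs := by
      rw [degInt_eq_of_cls_eq hm hF' hF (hσ'.trans hσ.symm), habs, mul_comm] at hn
      exact_mod_cast le_of_mul_le_mul_left hn hS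
    have hsob := hF'.isSobolevMap hF1'
    have hmem : MemClass F' σ := ⟨F', hσ' ▸ continuousRep_cls hF'.isContMap
      fun x hx => hF1' x (by simpa using hx), SobolevHomotopic.refl hsob⟩
    have hinf : topEnergy σ ≤ ∫⁻ x in B m, ‖jac F' x‖ₑ ^ m :=
      iInf₂_le_of_le F' (jac F') (iInf₂_le hsob hmem)
    refine hinf.trans ((setLIntegral_le_lintegral _ _).trans (hle.trans ?_))
    calc (n : ℝ≥0∞) * (ENNReal.ofReal ((m : ℝ) ^ ((m : ℝ) / 2)) * sphereArea m
          + δ / (d.natAbs + 1))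
        ≤ d.natAbs * (ENNReal.ofReal ((m : ℝ) ^ ((m : ℝ) / 2)) * sphereArea m)
          + (d.natAbs + 1) * (δ / (d.natAbs + 1)) := by
          rw [mul_add]
          gcongr
          exact (Nat.cast_le.2 hnd).trans le_self_add
      _ = _ := by
          rw [ENNReal.mul_div_cancel hK.ne' (by finiteness), mul_comm]
  · have h1 := hf.ofReal_mul_enorm_jacInt_le hm0
    rw [hfσ.jacInt_eq_degInt hm hf hF hσ, ← ofReal_norm, Real.norm_eq_abs, habs,
      ENNReal.ofReal_mul hS.le, ENNReal.ofReal_toReal (sphereArea_ne_top m), ENNReal.ofReal_natCast,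
      ← mul_assoc] at h1
    exact h1

end TopEnergy

end

theorem mainTheorem7 (m : ℕ) (hm : 2 ≤ m) (b : TopEnergy.S m) (σ : π_ m (TopEnergy.S m) b) :
    (∃! d : ℤ, TopEnergy.IsBrouwerDegree σ d) ∧
    TopEnergy.topEnergy σ =
      ENNReal.ofReal ((m : ℝ) ^ ((m : ℝ) / 2)) * TopEnergy.sphereArea m *
        ((TopEnergy.brouwerDegree σ).natAbs : ℝ≥0∞) :=
  TopEnergy.existsUnique_degree_and_topEnergy_eq m hm b σ
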